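/- **Setting.** Let $\mathcal X$ be a measurable space and $\mathcal Y=\{+1,-1\}$. Let $\mathcal D$ be a probability measure on $\mathcal X\times\mathcal Y$ with marginal $\mathcal D_{\mathcal X}$, and $\eta(x)=\mathbb P(y=+1\mid x)$. Let $\mathcal F$ be a set of measurable functions $\mathcal X\to[0,1]$ that is pointwise measurable (some countable $\mathcal F_0\subseteq\mathcal F$ is such that every $f\in\mathcal F$ is the pointwise limit of a sequence in $\mathcal F_0$), and assume that some $f^\star\in\mathcal F$ satisfies $f^\star=\eta$ almost everywhere. Write $\bar y=\mathbb 1(y=+1)$ and $\operatorname{sgn}(0)=+1$, and set $h^\star=\operatorname{sgn}(2f^\star-1)$. For $\hat h:\mathcal X\to\{+1,-1,\bot\}$, the Chow excess error is $\mathbb P(\hat h(x)\ne y,\hat h(x)\neq\bot)+(\tfrac12-\gamma)\mathbb P(\hat h(x)=\bot)-\mathbb P(h^\star(x)\neq y)$. Let $d=\mathrm{Pdim}(\mathcal F)$ be the VC dimension of $\{(x,\zeta)\mapsto \mathbb 1(f(x)>\zeta):f\in\mathcal F\}$, and assume $1\le d<\infty$. Let $$\theta=\sup_{f_0\in\mathcal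 F,\ \iota>0}\Big(1\vee\sup_{\mu}\ \sup_{\gamma'>\gamma/4,\ \epsilon'>\iota}\frac{\gamma'^2}{\epsilon'^2}\,\mu\big(\exists f\in\mathcal F:\ |f(x)-f_0(x)|>\gamma',\ \|f-f_0\|_{L^2(\mu)}\le\epsilon'\big)\Big),$$ with $\mu$ ranging over all probability measures on $\mathcal X$, and assume $\theta<\infty$. Let $0<\epsilon\le1$, $0<\gamma<\tfrac12$, $0<\delta<1$. A *regression oracle* for $\mathcal F$ maps each finite list $S$ of triples $(w,x,y)\in\mathbb R_+\times\mathcal X\times\mathcal Y$ to a minimizer over $\mathcal F$ of $\sum_{S}w(f(x)-\bar y)^2$; for each list length, the value at $x'$ of the returned function is assumed to be jointly measurable in $S$ and $x'$. An *oracle procedure* is a deterministic adaptive procedure that has access to $\mathcal F$ only through calls of this oracle; its cost is its number of calls. **Algorithm.** Put $T=c_T\frac{\theta d}{\epsilon\gamma}\log\frac{\theta d}{\epsilon\gamma\delta}$, $M=\lceil\log_2T\rceil$, $C_\delta=c_C\,d\log(T/\delta)$, $\tau_0=0$, $\tau_m=2^m$ ($m\ge1$), $\beta_m=(M-m+1)C_\delta$,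 $\bar\alpha=\frac{\gamma}{4M}$, $\alpha_m=\frac{(M-m)\gamma}{4M}$. Let $\mathbf{Alg}_{\rm lcb},\mathbf{Alg}_{\rm ucb}$ be oracle procedures that return a real number from a point $x$, labelled data $B$, a radius $\beta$, a slack $\sigma$ and a precision $\alpha$. In epoch $m=1,\dots,M$, let $B_m$ be the list of pairs $(x_t,y_t)$, $t\le\tau_{m-1}$, whose label was queried, let $\hat f_m$ minimize $\sum_{B_m}(f(x_t)-\bar y_t)^2$ over $\mathcal F$ (one oracle call), and put $$\widehat{\mathsf{lcb}}_m(x)=\mathbf{Alg}_{\rm lcb}(x;B_m,\beta_m,\tfrac{C_\delta}2,\bar\alpha)-\alpha_m,\qquad \widehat{\mathsf{ucb}}_m(x)=\mathbf{Alg}_{\rm ucb}(x;B_m,\beta_m,\tfrac{C_\delta}2,\bar\alpha)+\alpha_m .$$ Let $\hat h_m(x)=\bot$ if $[\widehat{\mathsf{lcb}}_m(x),\widehat{\mathsf{ucb}}_m(x)]\subseteq[\frac12-\gamma,\frac12+\gamma]$ and $\hat h_m(x)=\operatorname{sgn}(2\hat f_m(x)-1)$ otherwise, and let $g_m(x)=1$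 iff $\frac12\in(\widehat{\mathsf{lcb}}_m(x),\widehat{\mathsf{ucb}}_m(x))$ and $\hat h_m(x)\ne\bot$. If $m<M$, draw i.i.d. $(x_t,y_t)\sim\mathcal D$ for $\tau_{m-1}<t\le\tau_m$ and query (observe) $y_t$ iff $g_m(x_t)=1$. If $m=M$, return $\hat h_M$. **Theorem.** There are universal constants $c_T,c_C,c_L,c_N,c_I>0$ and $k\in\mathbb N$ and, for every $\mathcal X$, two pairs of oracle procedures $(\mathbf{Alg}_{\rm lcb},\mathbf{Alg}_{\rm ucb})$, one for general classes and one for convex classes, chosen before $\mathcal F$, $\mathcal D$, the oracle and $\epsilon,\gamma,\delta$, such that in the above setting the following holds for the first pair and, if $\mathcal F$ is convex and closed under (sequential) pointwise convergence, also for the second pair. 1. *Confidence bounds.* For data $B$ and $\beta>0$ let $\mathcal F(B,\beta)$ be the set of $f\in\mathcal F$ whose square loss on $B$ exceeds the minimum over $\mathcal F$ by at most $\beta$, and let $\mathsf{lcb}$, $\mathsf{ucb}$ denote the infimum and supremum over a class of the values at $x$. For all $x$, $B$, $\beta,\sigma>0$ and $\alpha\in(0,1]$, $$\mathsf{lcb}(x;\mathcal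 F(B,\beta'))-\alpha\le\mathbf{Alg}_{\rm lcb}(x;B,\beta,\sigma,\alpha)\le\mathsf{lcb}(x;\mathcal F(B,\beta)),$$ $$\mathsf{ucb}(x;\mathcal F(B,\beta))\le\mathbf{Alg}_{\rm ucb}(x;B,\beta,\sigma,\alpha)\le\mathsf{ucb}(x;\mathcal F(B,\beta'))+\alpha,$$ with $\beta'=\beta+\sigma$ for the first pair and $\beta'=\beta$ for the second. 2. *Statistical guarantees.* With probability at least $1-2\delta$, simultaneously: the Chow excess error of $\hat h_M$ is at most $\epsilon$; the number of queried labels is at most $c_L\frac{\theta d}{\gamma^2}\log^2\!\big(\frac{\theta d}{\epsilon\gamma}\big)\log\frac{\theta d}{\epsilon\gamma\delta}$; and for all $1\le m<M$ and all $x$, $[\widehat{\mathsf{lcb}}_{m+1}(x),\widehat{\mathsf{ucb}}_{m+1}(x)]\subseteq[\widehat{\mathsf{lcb}}_{m}(x),\widehat{\mathsf{ucb}}_{m}(x)]$ and $g_{m+1}(x)\le g_m(x)$. 3. *Oracle calls.* On every sample sequence, the whole run makes at most $c_N\frac{\theta d}{\epsilon\gamma^3}\log^k\frac{\theta d}{\epsilon\gamma\delta}$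 oracle calls with the first pair, and at most $c_N\frac{\theta d}{\epsilon\gamma}\log^k\frac{\theta d}{\epsilon\gamma\delta}$ with the second. 4. *Inference.* Let $\Lambda=1+\log\frac{\theta d}{\epsilon\gamma}+\log(1+\log\frac1\delta)$. On every sample sequence and for every $x$, evaluating the confidence bounds that define the returned $\hat h_M(x)$ takes at most $c_I\frac{\Lambda^2}{\gamma^2}\log\frac{\Lambda}{\gamma}=\widetilde O\big(\frac1{\gamma^2}\log^2\frac{\theta d}{\epsilon}\big)$ oracle calls with the first pair, and at most $c_I\log\frac\Lambda\gamma=\widetilde O(\log\frac1\gamma)$ with the second. -/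

import Mathlib

open MeasureTheory ProbabilityTheory Filter Topology
open scoped NNReal ENNReal

noncomputable section

namespace ActiveAbstain

universe u

/- ### Labels, classifiers, errors

The label `+1` is `true`, the label `-1` is `false`; abstention is `none : Option Bool`. -/

/-- Regression encoding of a label: the indicator of the positive label. -/
def labelValue (y : Bool) : ℝ := if y then 1 else 0

open Classical in
/-- The sign of a real number as a label, with `sgn 0 = +1`. -/
def sgnLabel (r : ℝ) : Bool := if 0 ≤ r then true else false

/-- The classifier `x ↦ sgn (2 f x - 1)` induced by a regression function. -/
def inducedClassifier {X : Type u} (f : X → ℝ) (x : X) : Bool := sgnLabel (2 * f x - 1)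

/-- The conditional probability `η x` of a positive label given `x`. -/
def condProb {X : Type u} [MeasurableSpace X] (D : Measure (X × Bool)) [IsFiniteMeasure D]
    (x : X) : ℝ := (D.condKernel x).real {true}

/-- Standard error of a classifier. -/
def stdError {X : Type u} [MeasurableSpace X] (D : Measure (X × Bool)) (h : X → Bool) : ℝ :=
  D.real {p | h p.1 ≠ p.2}

/-- Chow's error of a classifier that may abstain, at cost `1/2 - γ`. -/
def chowError {X : Type u} [MeasurableSpace X] (D : Measure (X × Bool)) (γ : ℝ)
    (h : X → Option Bool) : ℝ :=
  D.real {p | h p.1 ≠ some p.2 ∧ h p.1 ≠ none} + (1 / 2 - γ) * D.real {p | h p.1 = none}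

/- ### Complexity of the class of regression functions -/

/-- The threshold functions `(x, ζ) ↦ 1(f x > ζ)`, `f ∈ F`, shatter the finite set `s`. -/
def PseudoShatters {X : Type u} (F : Set (X → ℝ)) (s : Finset (X × ℝ)) : Prop :=
  ∀ t ⊆ s, ∃ f ∈ F, ∀ p ∈ s, p.2 < f p.1 ↔ p ∈ t

/-- Pseudo dimension: the VC dimension of the class of threshold functions. -/
def pseudoDim {X : Type u} (F : Set (X → ℝ)) : ℕ∞ :=
  ⨆ (s : Finset (X × ℝ)) (_ : PseudoShatters F s), (s.card : ℕ∞)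

/-- Value function disagreement coefficient of `F` at `fs`, with the supremum over all
probability measures on `X`. -/
def disagreementCoeffAt {X : Type u} [MeasurableSpace X] (F : Set (X → ℝ)) (fs : X → ℝ)
    (γ₀ ε₀ : ℝ) : ℝ≥0∞ :=
  max 1 (⨆ (μ : Measure X) (_ : IsProbabilityMeasure μ) (γ : ℝ) (_ : γ₀ < γ) (ε : ℝ) (_ : ε₀ < ε),
    ENNReal.ofReal (γ ^ 2 / ε ^ 2) *
      μ {x | ∃ f ∈ F, γ < |f x - fs x| ∧ Real.sqrt (∫ z, (f z - fs z) ^ 2 ∂μ) ≤ ε})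

/-- The supremum of the value function disagreement coefficients at level `γ₀`, over all base
functions in `F` and all radii `ι > 0`. -/
def disagreementCoeff {X : Type u} [MeasurableSpace X] (F : Set (X → ℝ)) (γ₀ : ℝ) : ℝ≥0∞ :=
  ⨆ (fs : X → ℝ) (_ : fs ∈ F) (ι : ℝ) (_ : 0 < ι), disagreementCoeffAt F fs γ₀ ι

/-- Pointwise measurability: a countable subclass is dense for pointwise sequential limits. -/
def PointwiseMeasurable {X : Type u} (F : Set (X → ℝ)) : Prop :=
  ∃ F₀ ⊆ F, F₀.Countable ∧ ∀ f ∈ F, ∃ g : ℕ → X → ℝ, (∀ n, g n ∈ F₀) ∧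
    ∀ x, Tendsto (fun n => g n x) atTop (𝓝 (f x))

/- ### The weighted square-loss regression oracle and programs that call it -/

/-- A weighted labelled example. -/
abbrev WExample (X : Type u) := ℝ≥0 × X × Bool

/-- Weighted square loss of `f` on a finite list of weighted examples. -/
def weightedLoss {X : Type u} (S : List (WExample X)) (f : X → ℝ) : ℝ :=
  (S.map fun e => (e.1 : ℝ) * (f e.2.1 - labelValue e.2.2) ^ 2).sum

/-- `O` returns, on every input, a minimizer over `F` of the weighted square loss. -/
def IsRegressionOracle {X : Type u} (F : Set (X → ℝ)) (O : List (WExample X) → X → ℝ) : Prop :=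
  ∀ S, O S ∈ F ∧ ∀ f ∈ F, weightedLoss S (O S) ≤ weightedLoss S f

/-- For each input length, the value of the returned function at a point depends measurably on
the input and the point. -/
def MeasurableOracle {X : Type u} [MeasurableSpace X] (O : List (WExample X) → X → ℝ) : Prop :=
  ∀ n : ℕ, Measurable fun p : (Fin n → WExample X) × X => O (List.ofFn p.1) p.2

/-- Deterministic adaptive programs over `X` with result in `A`. A program does not know the
class of regression functions: it learns about it only by submitting weighted examples to the
regression oracle and inspecting the function that comes back. -/
inductive OracleProg (X : Type u) (A : Type) : Type u
  | ret (a : A) : OracleProg X A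
  | call (S : List (WExample X)) (next : (X → ℝ) → OracleProg X A) : OracleProg X A

/-- The result of a program run with oracle `O`. -/
def OracleProg.eval {X : Type u} {A : Type} (O : List (WExample X) → X → ℝ) :
    OracleProg X A → A
  | .ret a => a
  | .call S next => (next (O S)).eval O

/-- The number of oracle calls made by a program run with oracle `O`. -/
def OracleProg.calls {X : Type u} {A : Type} (O : List (WExample X) → X → ℝ) :
    OracleProg X A → ℕ
  | .ret _ => 0
  | .call S next => (next (O S)).calls O + 1

/- ### Active sets and confidence bounds -/

/-- A list of labelled points, as examples of weight one. -/
def unitWeights {X : Type u} (B : List (X × Bool)) : List (WExample X) :=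
  B.map fun p => (1, p.1, p.2)

/-- The empirical square-loss minimizer over the labelled data `B`, by one oracle call. -/
def empMin {X : Type u} (O : List (WExample X) → X → ℝ) (B : List (X × Bool)) : X → ℝ :=
  O (unitWeights B)

/-- The active set: functions of `F` whose square loss on `B` exceeds that of the empirical
minimizer by at most `β`. -/
def activeSet {X : Type u} (F : Set (X → ℝ)) (O : List (WExample X) → X → ℝ)
    (B : List (X × Bool)) (β : ℝ) : Set (X → ℝ) :=
  {f ∈ F | weightedLoss (unitWeights B) f ≤ weightedLoss (unitWeights B) (empMin O B) + β}

/-- Exact lower confidence bound `inf_{f ∈ G} f x`. -/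
def lcb {X : Type u} (G : Set (X → ℝ)) (x : X) : ℝ := sInf ((fun f => f x) '' G)

/-- Exact upper confidence bound `sup_{f ∈ G} f x`. -/
def ucb {X : Type u} (G : Set (X → ℝ)) (x : X) : ℝ := sSup ((fun f => f x) '' G)

/-- A pair of subroutines for the two confidence bounds. The arguments are the point, the labelled
data, the radius `β` of the active set, a slack `σ` for that radius, and the precision `α`. -/
structure CISubroutine (X : Type u) where
  algLcb : X → List (X × Bool) → ℝ → ℝ → ℝ → OracleProg X ℝ
  algUcb : X → List (X × Bool) → ℝ → ℝ → ℝ → OracleProg X ℝ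

/-- With oracle `O` for `F`, the subroutines return one-sided `α`-approximations: the bounds
contain the exact bounds of the active set of radius `β`, and are contained, up to `α`, in the
exact bounds of the active set of radius `β + r σ`. For `r = 0` this is approximation up to `α`
of the exact bounds of the active set of radius `β`. -/
def Certifies {X : Type u} (A : CISubroutine X) (F : Set (X → ℝ))
    (O : List (WExample X) → X → ℝ) (r : ℝ) : Prop :=
  ∀ (x : X) (B : List (X × Bool)) (β σ α : ℝ), 0 < β → 0 < σ → 0 < α → α ≤ 1 →
    (lcb (activeSet F O B (β + r * σ)) x - α ≤ (A.algLcb x B β σ α).eval O ∧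
      (A.algLcb x B β σ α).eval O ≤ lcb (activeSet F O B β) x) ∧
    (ucb (activeSet F O B β) x ≤ (A.algUcb x B β σ α).eval O ∧
      (A.algUcb x B β σ α).eval O ≤ ucb (activeSet F O B (β + r * σ)) x + α)

/- ### The learner -/

/-- Number of epochs `M`, confidence radius `C`, abstention parameter `γ`. -/
structure EpochParams where
  M : ℕ
  C : ℝ
  γ : ℝ

/-- Epoch ends: `τ 0 = 0` and `τ m = 2 ^ m` for `m ≥ 1`. -/
def tau (m : ℕ) : ℕ := if m = 0 then 0 else 2 ^ m

/-- Radius `β_m = (M - m + 1) C` of the active set of epoch `m`. -/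
def EpochParams.beta (p : EpochParams) (m : ℕ) : ℝ := ((p.M : ℝ) - m + 1) * p.C

/-- Precision `γ / (4 M)` of the confidence subroutines. -/
def EpochParams.precision (p : EpochParams) : ℝ := p.γ / (4 * p.M)

/-- The widening `(M - m) γ / (4 M)` of the confidence bounds in epoch `m`. -/
def EpochParams.widening (p : EpochParams) (m : ℕ) : ℝ := ((p.M : ℝ) - m) * p.γ / (4 * p.M)

section Learner

variable {X : Type u} (A : CISubroutine X) (O : List (WExample X) → X → ℝ) (p : EpochParams)

/-- The oracle program that computes the lower bound of epoch `m` at `x`, before widening. -/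
def lcbProg (m : ℕ) (B : List (X × Bool)) (x : X) : OracleProg X ℝ :=
  A.algLcb x B (p.beta m) (p.C / 2) p.precision

/-- The oracle program that computes the upper bound of epoch `m` at `x`, before widening. -/
def ucbProg (m : ℕ) (B : List (X × Bool)) (x : X) : OracleProg X ℝ :=
  A.algUcb x B (p.beta m) (p.C / 2) p.precision

/-- Approximate lower confidence bound of epoch `m`, based on the labelled data `B`. -/
def lcbHat (m : ℕ) (B : List (X × Bool)) (x : X) : ℝ :=
  (lcbProg A p m B x).eval O - p.widening m

/-- Approximate upper confidence bound of epoch `m`, based on the labelled data `B`. -/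
def ucbHat (m : ℕ) (B : List (X × Bool)) (x : X) : ℝ :=
  (ucbProg A p m B x).eval O + p.widening m

open Classical in
/-- The classifier of epoch `m`. -/
def epochClassifier (m : ℕ) (B : List (X × Bool)) (x : X) : Option Bool :=
  if Set.Icc (lcbHat A O p m B x) (ucbHat A O p m B x) ⊆ Set.Icc (1 / 2 - p.γ) (1 / 2 + p.γ)
  then none else some (inducedClassifier (empMin O B) x)

/-- The query rule of epoch `m`. -/
def Queried (m : ℕ) (B : List (X × Bool)) (x : X) : Prop :=
  (1 / 2 : ℝ) ∈ Set.Ioo (lcbHat A O p m B x) (ucbHat A O p m B x) ∧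
    epochClassifier A O p m B x ≠ none

open Classical in
/-- The labelled data at the end of epoch `m`, that is, the pairs `z t` with `1 ≤ t ≤ τ m` whose
label was queried; epoch `m + 1` processes the times `τ m + 1, …, τ (m + 1)`. -/
def collected (z : ℕ → X × Bool) : ℕ → List (X × Bool)
  | 0 => []
  | m + 1 => collected z m ++
      ((List.range' (tau m + 1) (tau (m + 1) - tau m)).map z).filter
        fun q => decide (Queried A O p (m + 1) (collected z m) q.1)

/-- The returned classifier, that of the last epoch `M`. -/
def outputClassifier (z : ℕ → X × Bool) : X → Option Bool :=
  epochClassifier A O p p.M (collected A O p z (p.M - 1))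

/-- Label complexity: the number of queried labels (epoch `M` draws no samples). -/
def labelCount (z : ℕ → X × Bool) : ℕ := (collected A O p z (p.M - 1)).length

/-- Oracle calls for the two confidence bounds of epoch `m` at `x`. -/
def pointCalls (m : ℕ) (B : List (X × Bool)) (x : X) : ℕ :=
  (lcbProg A p m B x).calls O + (ucbProg A p m B x).calls O

/-- Oracle calls of the whole run: one for the empirical minimizer of each epoch `1, …, M`, and
those for the confidence bounds at each of the points drawn in the epochs `1, …, M - 1`. -/
def totalCalls (z : ℕ → X × Bool) : ℕ :=
  p.M + ∑ m ∈ Finset.Icc 1 (p.M - 1), ∑ t ∈ Finset.Icc (tau (m - 1) + 1) (tau m),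
    pointCalls A O p m (collected A O p z (m - 1)) (z t).1

/-- Oracle calls to evaluate the returned classifier at `x`. -/
def inferenceCalls (z : ℕ → X × Bool) (x : X) : ℕ :=
  pointCalls A O p p.M (collected A O p z (p.M - 1)) x

/-- The confidence regions and the sampling regions are non-increasing over the epochs. -/
def NestedRegions (z : ℕ → X × Bool) : Prop :=
  ∀ m : ℕ, 1 ≤ m → m < p.M → ∀ x : X,
    Set.Icc (lcbHat A O p (m + 1) (collected A O p z m) x)
        (ucbHat A O p (m + 1) (collected A O p z m) x) ⊆
      Set.Icc (lcbHat A O p m (collected A O p z (m - 1)) x)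
        (ucbHat A O p m (collected A O p z (m - 1)) x) ∧
    (Queried A O p (m + 1) (collected A O p z m) x →
      Queried A O p m (collected A O p z (m - 1)) x)

end Learner

end ActiveAbstain

end

noncomputable section

namespace ActiveAbstain

universe u

/-! ### The square loss and examples that encode a real-valued target. -/

section Losses

variable {X : Type u}

/-! Confidence bounds from the oracle. Two oppositely labelled weighted examples at `x` add, up to a
constant, a penalty `w (D - a) ^ 2` to the loss, where `D` is the distance of `f x` from a chosen
label and the target `a` in `[0, 1]` is free (`weightedLoss_targetExamples`). For a general class
the targets run through a grid, and the first target attested by a function of small penalized loss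
bounds all active values; the slack in the radius pays for rounding to the grid (`gridBound_spec`).
For a convex class the target is `0` and the weight varies: a larger weight trades loss for
distance, bisection locates a weight at which the minimizer leaves the active set, and strong
convexity makes the values for nearby weights close (`bisectBound_spec`). Both procedures return
bounds strictly outside the active values, which matters because the sampling region is given by an
open interval.

Concentration. Finite pseudo dimension gives covers of polynomial size on finite sets of points
(`exists_cover`). The i.i.d. law is invariant under redrawing one label from its conditional law and
under exchanging two times with probability one half. Iterating such steps bounds exponential
moments, and a cover that depends only on what the steps preserve is fixed along the iteration, so a
union bound over it is legitimate although the cover is random (`measure_le_of_resample`). Redrawing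
labels controls the noise (`measure_noise_le`), exchanging times compares squared distances on two
blocks of samples (`measure_two_sample_le`). A third bound, for one data-dependent function on fresh
samples, follows by integrating out one coordinate at a time (`measure_fresh_sample_le`).

Deterministic analysis of a good run. Let `fs` be the regression function. The noise bound puts `fs`
in every active set and makes all active functions close to `fs` in square on the queried points.
The radius drops by `C` per epoch, which pays for the slack and for the noise, so active sets are
nested; the shrinking widening pays for the precision, so the computed regions are nested too
(`GoodRun.activeSet_succ`, `GoodRun.bounds_succ`). At a queried point some active function is more
than `γ / 4` away from `fs`. The sampling region of an epoch is fixed before that epoch and the next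
are drawn, so inside it the distances carry over from one epoch to the next. The disagreement
coefficient, being uniform over measures, applies to the empirical measure of the points there and
bounds the number of queries (`GoodRun.epoch_labels_le`). In the label count the early epochs are
bounded trivially up to a suitable cut-off, so that the squared logarithm does not involve `δ`
(`ParamBounds.exists_cutoff`).

Excess error. Outside the final sampling region the returned classifier either abstains where
abstaining is no worse than predicting, or agrees with the Bayes classifier; inside, the excess is
at most twice the distance of the empirical minimizer from `fs` (`GoodRun.chow_excess_le`). That
distance is summed over a block of ghost samples after the last sampled epoch, bounded there by
Cauchy-Schwarz (`GoodRun.sum_fresh_le`), and transferred to the expectation. -/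

lemma labelValue_mem (b : Bool) : labelValue b = 0 ∨ labelValue b = 1 := by
  cases b <;> simp [labelValue]

lemma weightedLoss_append (S S' : List (WExample X)) (f : X → ℝ) :
    weightedLoss (S ++ S') f = weightedLoss S f + weightedLoss S' f := by
  simp [weightedLoss]

lemma weightedLoss_midpoint_le (S : List (WExample X)) (f g : X → ℝ) :
    weightedLoss S ((1 / 2 : ℝ) • f + (1 / 2 : ℝ) • g)
      ≤ weightedLoss S f / 2 + weightedLoss S g / 2 := by
  induction S with
  | nil => simp [weightedLoss]
  | cons e S ih =>
    have h (h : X → ℝ) : weightedLoss (e :: S) h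
        = (e.1 : ℝ) * (h e.2.1 - labelValue e.2.2) ^ 2 + weightedLoss S h := by
      simp [weightedLoss]
    rw [h, h, h]
    have h2 : (((1 / 2 : ℝ) • f + (1 / 2 : ℝ) • g) e.2.1 - labelValue e.2.2) ^ 2
        ≤ (f e.2.1 - labelValue e.2.2) ^ 2 / 2 + (g e.2.1 - labelValue e.2.2) ^ 2 / 2 := by
      simp only [Pi.add_apply, Pi.smul_apply, smul_eq_mul]
      nlinarith [sq_nonneg (f e.2.1 - g e.2.1)]
    nlinarith [mul_le_mul_of_nonneg_left h2 e.1.coe_nonneg]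

/-- Distance of a value from a label value, for values in the unit interval. -/
def labelDist (b : Bool) (v : ℝ) : ℝ := if b then 1 - v else v

lemma labelDist_mem {v : ℝ} (b : Bool) (hv : v ∈ Set.Icc (0 : ℝ) 1) :
    labelDist b v ∈ Set.Icc (0 : ℝ) 1 := by
  cases b <;> simp [labelDist] at * <;> constructor <;> linarith [hv.1, hv.2]

/-- Weighted examples at `x` whose loss is, up to a constant, `w (labelDist b (f x) - a) ^ 2`. -/
def targetExamples (x : X) (b : Bool) (w a : ℝ) : List (WExample X) :=
  [((w * (1 - a)).toNNReal, x, b), ((w * a).toNNReal, x, !b)]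

/-- Opposite labels with weights `w (1 - a)` and `w a` have a weighted mean at distance `a` from
label `b`; completing the square leaves a constant free of `f`. Labels in `{0, 1}` thus simulate a
regression target anywhere in between. -/
lemma weightedLoss_targetExamples (x : X) (b : Bool) {w a : ℝ} (hw : 0 ≤ w) (ha : 0 ≤ a)
    (ha' : a ≤ 1) (f : X → ℝ) :
    weightedLoss (targetExamples x b w a) f
      = w * (labelDist b (f x) - a) ^ 2 + w * (a - a ^ 2) := by
  have h1 : 0 ≤ w * (1 - a) := mul_nonneg hw (by linarith)
  have h2 : 0 ≤ w * a := mul_nonneg hw ha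
  cases b <;>
    simp [weightedLoss, targetExamples, labelValue, labelDist, Real.coe_toNNReal _ h1,
      Real.coe_toNNReal _ h2] <;> ring

end Losses

/-! ### Consequences of oracle optimality. -/

section Oracle

variable {X : Type u} {F : Set (X → ℝ)} {O : List (WExample X) → X → ℝ}

lemma IsRegressionOracle.le_unitWeights (hO : IsRegressionOracle F O) (B : List (X × Bool))
    {f : X → ℝ} (hf : f ∈ F) :
    weightedLoss (unitWeights B) (empMin O B) ≤ weightedLoss (unitWeights B) f :=
  (hO _).2 f hf

lemma empMin_mem_activeSet (hO : IsRegressionOracle F O) (B : List (X × Bool)) {β : ℝ}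
    (hβ : 0 ≤ β) : empMin O B ∈ activeSet F O B β :=
  ⟨(hO _).1, by linarith⟩

lemma activeSet_subset (B : List (X × Bool)) (β : ℝ) : activeSet F O B β ⊆ F :=
  fun _ h => h.1

lemma activeSet_mono (B : List (X × Bool)) {β β' : ℝ} (h : β ≤ β') :
    activeSet F O B β ⊆ activeSet F O B β' :=
  fun _ hf => ⟨hf.1, hf.2.trans (by linarith)⟩

lemma IsRegressionOracle.target_le (hO : IsRegressionOracle F O) (B : List (X × Bool)) (x : X)
    (b : Bool) {w a : ℝ} (hw : 0 ≤ w) (ha : 0 ≤ a) (ha' : a ≤ 1) {f : X → ℝ} (hf : f ∈ F) :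
    weightedLoss (unitWeights B) (O (unitWeights B ++ targetExamples x b w a))
        + w * (labelDist b (O (unitWeights B ++ targetExamples x b w a) x) - a) ^ 2
      ≤ weightedLoss (unitWeights B) f + w * (labelDist b (f x) - a) ^ 2 := by
  have h := (hO (unitWeights B ++ targetExamples x b w a)).2 f hf
  rw [weightedLoss_append, weightedLoss_append, weightedLoss_targetExamples x b hw ha ha',
    weightedLoss_targetExamples x b hw ha ha'] at h
  linarith

end Oracle

/- ### Grid search, for general classes -/

section Grid

variable {X : Type u}

open Classical in
/-- Tests the target values `i η, (i + 1) η, …` (at most `n` of them), and returns the first value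
that some function close to it and of small loss attests, less `2 η`. -/
def gridSearch (x : X) (B : List (X × Bool)) (b : Bool) (w η thr : ℝ) :
    ℕ → ℕ → OracleProg X ℝ
  | 0, _ => .ret 0
  | n + 1, i => .call (unitWeights B ++ targetExamples x b w (i * η)) fun f =>
      if weightedLoss (unitWeights B) f + w * (labelDist b (f x) - i * η) ^ 2 ≤ thr
      then .ret (i * η - 2 * η)
      else gridSearch x B b w η thr n (i + 1)

/-- Mesh of the grid search. -/
def gridMesh (β σ α : ℝ) : ℝ := α / (3 + β / σ)

/-- Lower confidence bound on the distance from label `b`, by grid search. -/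
def gridBound (b : Bool) (x : X) (B : List (X × Bool)) (β σ α : ℝ) : OracleProg X ℝ :=
  .call (unitWeights B) fun f₀ =>
    gridSearch x B b (σ / gridMesh β σ α ^ 2) (gridMesh β σ α)
      (weightedLoss (unitWeights B) f₀ + β + σ) (⌊1 / gridMesh β σ α⌋₊ + 1) 0

variable {F : Set (X → ℝ)} {O : List (WExample X) → X → ℝ}

lemma gridSearch_calls (x : X) (B : List (X × Bool)) (b : Bool) (w η thr : ℝ) (n i : ℕ) :
    (gridSearch x B b w η thr n i).calls O ≤ n := by
  induction n generalizing i with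
  | zero => simp [gridSearch, OracleProg.calls]
  | succ n ih =>
    simp only [gridSearch, OracleProg.calls]
    split_ifs
    · simp [OracleProg.calls]
    · simpa using ih (i + 1)

/-- The grid search returns the first accepted value less `2 η`. -/
lemma gridSearch_eval (x : X) (B : List (X × Bool)) (b : Bool) (w η thr : ℝ) (n i j : ℕ)
    (hij : i ≤ j) (hjn : j < i + n)
    (hj : weightedLoss (unitWeights B) (O (unitWeights B ++ targetExamples x b w (j * η)))
      + w * (labelDist b (O (unitWeights B ++ targetExamples x b w (j * η)) x) - j * η) ^ 2
        ≤ thr) :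
    ∃ k : ℕ, k ≤ j ∧
      weightedLoss (unitWeights B) (O (unitWeights B ++ targetExamples x b w (k * η)))
      + w * (labelDist b (O (unitWeights B ++ targetExamples x b w (k * η)) x) - k * η) ^ 2
        ≤ thr ∧ (gridSearch x B b w η thr n i).eval O = k * η - 2 * η := by
  induction n generalizing i with
  | zero => omega
  | succ n ih =>
    by_cases h : weightedLoss (unitWeights B) (O (unitWeights B ++ targetExamples x b w (i * η)))
      + w * (labelDist b (O (unitWeights B ++ targetExamples x b w (i * η)) x) - i * η) ^ 2 ≤ thr
    · exact ⟨i, hij, h, by simp only [gridSearch, OracleProg.eval, if_pos h]⟩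
    · have hne : i ≠ j := by rintro rfl; exact h hj
      obtain ⟨k, hk, hk', he⟩ := ih (i + 1) (by omega) (by omega)
      exact ⟨k, hk, hk', by simp only [gridSearch, OracleProg.eval, if_neg h]; exact he⟩

lemma gridMesh_pos {β σ α : ℝ} (hβ : 0 < β) (hσ : 0 < σ) (hα : 0 < α) : 0 < gridMesh β σ α := by
  unfold gridMesh; positivity

lemma gridBound_calls {β σ α : ℝ} (hβ : 0 < β) (hσ : 0 < σ) (hα : 0 < α) (b : Bool) (x : X)
    (B : List (X × Bool)) :
    ((gridBound b x B β σ α).calls O : ℝ) ≤ (3 + β / σ) / α + 2 := by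
  have h1 := gridSearch_calls (O := O) x B b (σ / gridMesh β σ α ^ 2) (gridMesh β σ α)
      (weightedLoss (unitWeights B) (O (unitWeights B)) + β + σ) (⌊1 / gridMesh β σ α⌋₊ + 1) 0
  have h2 : (⌊1 / gridMesh β σ α⌋₊ : ℝ) ≤ 1 / gridMesh β σ α :=
    Nat.floor_le (by have := gridMesh_pos hβ hσ hα; positivity)
  have h3 : 1 / gridMesh β σ α = (3 + β / σ) / α := by unfold gridMesh; field_simp
  have h4 : (gridBound b x B β σ α).calls O ≤ ⌊1 / gridMesh β σ α⌋₊ + 2 := by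
    simp only [gridBound, OracleProg.calls]; omega
  calc ((gridBound b x B β σ α).calls O : ℝ) ≤ (⌊1 / gridMesh β σ α⌋₊ + 2 : ℕ) := by
        exact_mod_cast h4
    _ ≤ _ := by push_cast; linarith

/-- If `f` is active with distance `v`, the grid point just below `v` costs penalty at most `σ` and
is accepted, so the first accepted target is at most every active `v`. Conversely, acceptance bounds
both the loss and the penalty of the attesting function, hence its membership in the larger active
set and its distance from the target. -/
lemma gridBound_spec (hF : ∀ f ∈ F, ∀ x, f x ∈ Set.Icc (0 : ℝ) 1) (hO : IsRegressionOracle F O)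
    {β σ α : ℝ} (hβ : 0 < β) (hσ : 0 < σ) (hα : 0 < α) (b : Bool) (x : X)
    (B : List (X × Bool)) :
    (∀ f ∈ activeSet F O B β, (gridBound b x B β σ α).eval O < labelDist b (f x)) ∧
    ∃ f ∈ activeSet F O B (β + σ),
      labelDist b (f x) - α ≤ (gridBound b x B β σ α).eval O := by
  set η := gridMesh β σ α with hη
  have hη0 : 0 < η := gridMesh_pos hβ hσ hα
  set R₀ := weightedLoss (unitWeights B) (O (unitWeights B)) with hR₀
  set w := σ / η ^ 2 with hw
  have hw0 : 0 < w := by positivity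
  have heval : (gridBound b x B β σ α).eval O
      = (gridSearch x B b w η (R₀ + β + σ) (⌊1 / η⌋₊ + 1) 0).eval O := rfl
  have key : ∀ f ∈ activeSet F O B β, ∃ k : ℕ, (k : ℝ) * η ≤ labelDist b (f x) ∧
      weightedLoss (unitWeights B) (O (unitWeights B ++ targetExamples x b w (k * η)))
      + w * (labelDist b (O (unitWeights B ++ targetExamples x b w (k * η)) x) - k * η) ^ 2
        ≤ R₀ + β + σ ∧ (gridBound b x B β σ α).eval O = k * η - 2 * η := by
    intro f hf
    have hu := labelDist_mem b (hF f hf.1 x)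
    set v := labelDist b (f x)
    have hj1 : (⌊v / η⌋₊ : ℝ) ≤ v / η := Nat.floor_le (div_nonneg hu.1 hη0.le)
    have hj2 : v / η < ⌊v / η⌋₊ + 1 := Nat.lt_floor_add_one _
    rw [le_div_iff₀ hη0] at hj1
    rw [div_lt_iff₀ hη0] at hj2
    -- Distances are at most `1`, so the search budget `⌊1 / η⌋₊ + 1` reaches this grid point.
    have hjle : ⌊v / η⌋₊ ≤ ⌊1 / η⌋₊ := Nat.floor_le_floor (by gcongr; exact hu.2)
    have hacc := hO.target_le B x b hw0.le (a := (⌊v / η⌋₊ : ℝ) * η) (by positivity)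
      (hj1.trans hu.2) hf.1
    have hsq : w * (labelDist b (f x) - (⌊v / η⌋₊ : ℝ) * η) ^ 2 ≤ σ := by
      have : (v - (⌊v / η⌋₊ : ℝ) * η) ^ 2 ≤ η ^ 2 := by
        apply pow_le_pow_left₀ <;> nlinarith
      calc w * (v - (⌊v / η⌋₊ : ℝ) * η) ^ 2 ≤ w * η ^ 2 := by gcongr
        _ = σ := by rw [hw]; field_simp
    have hfl : weightedLoss (unitWeights B) f ≤ R₀ + β := hf.2
    obtain ⟨k, hk, hk', he⟩ := gridSearch_eval (O := O) x B b w η (R₀ + β + σ) (⌊1 / η⌋₊ + 1) 0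
      ⌊v / η⌋₊ (Nat.zero_le _) (by omega) (by linarith)
    refine ⟨k, ?_, hk', heval ▸ he⟩
    calc (k : ℝ) * η ≤ (⌊v / η⌋₊ : ℝ) * η := by gcongr
      _ ≤ v := hj1
  constructor
  · intro f hf
    obtain ⟨k, hk, -, he⟩ := key f hf
    rw [he]; linarith
  · obtain ⟨k, hk, hk', he⟩ := key _ (empMin_mem_activeSet hO B hβ.le)
    set g := O (unitWeights B ++ targetExamples x b w (k * η)) with hg
    have hgF : g ∈ F := (hO _).1
    have hgR : R₀ ≤ weightedLoss (unitWeights B) g := hO.le_unitWeights B hgF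
    refine ⟨g, ⟨hgF, ?_⟩, ?_⟩
    · have : 0 ≤ w * (labelDist b (g x) - k * η) ^ 2 := by positivity
      change _ ≤ R₀ + _
      linarith
    · rw [he]
      have h1 : w * (labelDist b (g x) - k * η) ^ 2 ≤ β + σ := by linarith
      -- The penalty is at most `β + σ = w η ^ 2 (1 + β / σ)`; squaring the last factor is lossy but
      -- avoids a square root.
      have h2 : (labelDist b (g x) - k * η) ^ 2 ≤ (η * (1 + β / σ)) ^ 2 := by
        have hwη : w * η ^ 2 = σ := by rw [hw]; field_simp
        have h3 : w * (labelDist b (g x) - k * η) ^ 2 ≤ w * (η * (1 + β / σ)) ^ 2 := by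
          calc _ ≤ β + σ := h1
            _ = σ * (1 + β / σ) := by field_simp; ring
            _ ≤ σ * (1 + β / σ) ^ 2 := by
              gcongr
              have : 0 ≤ β / σ := by positivity
              nlinarith
            _ = w * η ^ 2 * (1 + β / σ) ^ 2 := by rw [hwη]
            _ = _ := by ring
        exact le_of_mul_le_mul_left h3 hw0
      have h4 := abs_le_of_sq_le_sq' h2 (by positivity)
      -- The mesh is chosen so that the error `η (1 + β / σ)` of the attesting function and the
      -- shift `2 η` add up to `α`.
      have h5 : η * (3 + β / σ) = α := by rw [hη]; unfold gridMesh; field_simp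
      nlinarith [h4.2]

end Grid

/- ### Bisection over the weight, for convex classes -/

section Bisection

variable {X : Type u}

open Classical in
/-- Bisects the interval `[lo, hi]` of weights `n` times, with the invariant that the minimizer at
weight `lo` has loss at most `thr`, and that the minimizer at weight `hi` has not. Returns the
distance of the latter from label `b`. -/
def bisect (x : X) (B : List (X × Bool)) (b : Bool) (thr : ℝ) : ℕ → ℝ → ℝ → OracleProg X ℝ
  | 0, _, hi => .call (unitWeights B ++ targetExamples x b hi 0) fun f => .ret (labelDist b (f x))
  | n + 1, lo, hi => .call (unitWeights B ++ targetExamples x b ((lo + hi) / 2) 0) fun f =>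
      if weightedLoss (unitWeights B) f ≤ thr then bisect x B b thr n ((lo + hi) / 2) hi
      else bisect x B b thr n lo ((lo + hi) / 2)

/-- Subtracts a constant from the result of a program. -/
def OracleProg.subConst (c : ℝ) : OracleProg X ℝ → OracleProg X ℝ
  | .ret a => .ret (a - c)
  | .call S next => .call S fun f => (next f).subConst c

/-- Number of bisection steps at precision `α`. -/
def bisectSteps (α : ℝ) : ℕ := ⌈Real.logb 2 (16 / α ^ 3)⌉₊

open Classical in
/-- Lower confidence bound on the distance from label `b`, by bisection. -/
def bisectBound (b : Bool) (x : X) (B : List (X × Bool)) (β α : ℝ) : OracleProg X ℝ :=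
  .call (unitWeights B) fun f₀ =>
    .call (unitWeights B ++ targetExamples x b (β / (α / 2) ^ 2) 0) fun f₁ =>
      if weightedLoss (unitWeights B) f₁ ≤ weightedLoss (unitWeights B) f₀ + β
      then .ret (labelDist b (f₁ x) - α)
      else (bisect x B b (weightedLoss (unitWeights B) f₀ + β) (bisectSteps α) β
        (β / (α / 2) ^ 2)).subConst (α / 2)

variable {F : Set (X → ℝ)} {O : List (WExample X) → X → ℝ}

lemma OracleProg.subConst_eval (c : ℝ) (p : OracleProg X ℝ) :
    (p.subConst c).eval O = p.eval O - c := by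
  induction p with
  | ret a => rfl
  | call S next ih => exact ih _

lemma OracleProg.subConst_calls (c : ℝ) (p : OracleProg X ℝ) :
    (p.subConst c).calls O = p.calls O := by
  induction p with
  | ret a => rfl
  | call S next ih => simp only [subConst, OracleProg.calls, ih]

lemma bisect_calls (x : X) (B : List (X × Bool)) (b : Bool) (thr : ℝ) (n : ℕ) (lo hi : ℝ) :
    (bisect x B b thr n lo hi).calls O = n + 1 := by
  induction n generalizing lo hi with
  | zero => simp [bisect, OracleProg.calls]
  | succ n ih =>
    simp only [bisect, OracleProg.calls]
    split_ifs <;> simp [ih]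

lemma bisectBound_calls (b : Bool) (x : X) (B : List (X × Bool)) (β α : ℝ) :
    (bisectBound b x B β α).calls O ≤ bisectSteps α + 3 := by
  simp only [bisectBound, OracleProg.calls]
  split_ifs
  · simp [OracleProg.calls]
  · simp [OracleProg.subConst_calls, bisect_calls]

/-- The minimizer of the loss plus `w` times the squared distance from label `b` at `x`. -/
def tilted (O : List (WExample X) → X → ℝ) (x : X) (B : List (X × Bool)) (b : Bool) (w : ℝ) :
    X → ℝ := O (unitWeights B ++ targetExamples x b w 0)

/-- The two loss conditions at the endpoints are invariants of bisection. No monotonicity of the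
loss in the weight is needed: some crossing is found, whichever it is. -/
lemma bisect_eval (x : X) (B : List (X × Bool)) (b : Bool) (thr : ℝ) (n : ℕ) (lo hi : ℝ)
    (hle : lo ≤ hi)
    (hlo : weightedLoss (unitWeights B) (tilted O x B b lo) ≤ thr)
    (hhi : thr < weightedLoss (unitWeights B) (tilted O x B b hi)) :
    ∃ lo' hi', lo ≤ lo' ∧ lo' ≤ hi' ∧ hi' - lo' = (hi - lo) / 2 ^ n ∧
      weightedLoss (unitWeights B) (tilted O x B b lo') ≤ thr ∧
      thr < weightedLoss (unitWeights B) (tilted O x B b hi') ∧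
      (bisect x B b thr n lo hi).eval O = labelDist b (tilted O x B b hi' x) := by
  induction n generalizing lo hi with
  | zero => exact ⟨lo, hi, le_rfl, hle, by simp, hlo, hhi, rfl⟩
  | succ n ih =>
    by_cases h : weightedLoss (unitWeights B) (tilted O x B b ((lo + hi) / 2)) ≤ thr
    · obtain ⟨l, u, h1, h2, h3, h4, h5, h6⟩ := ih ((lo + hi) / 2) hi (by linarith) h hhi
      refine ⟨l, u, by linarith, h2, ?_, h4, h5, ?_⟩
      · rw [h3, pow_succ]; field_simp; ring
      · simp only [bisect, OracleProg.eval]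
        unfold tilted at h
        rw [if_pos h]; exact h6
    · obtain ⟨l, u, h1, h2, h3, h4, h5, h6⟩ := ih lo ((lo + hi) / 2) (by linarith) hlo
        (not_le.1 h)
      refine ⟨l, u, by linarith, h2, ?_, h4, h5, ?_⟩
      · rw [h3, pow_succ]; field_simp; ring
      · simp only [bisect, OracleProg.eval]
        unfold tilted at h
        rw [if_neg h]; exact h6

lemma tilted_le (hO : IsRegressionOracle F O) (x : X) (B : List (X × Bool)) (b : Bool) {w : ℝ}
    (hw : 0 ≤ w) {f : X → ℝ} (hf : f ∈ F) :
    weightedLoss (unitWeights B) (tilted O x B b w) + w * labelDist b (tilted O x B b w x) ^ 2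
      ≤ weightedLoss (unitWeights B) f + w * labelDist b (f x) ^ 2 := by
  have := hO.target_le B x b hw le_rfl zero_le_one hf
  simpa [tilted] using this

lemma labelDist_midpoint (b : Bool) (x : X) (f g : X → ℝ) :
    labelDist b (((1 / 2 : ℝ) • f + (1 / 2 : ℝ) • g) x)
      = (labelDist b (f x) + labelDist b (g x)) / 2 := by
  cases b <;> simp [labelDist] <;> ring

/-- In a convex class the tilted minimizer is a strong minimizer. -/
lemma tilted_strong (hO : IsRegressionOracle F O) (hconv : Convex ℝ F) (x : X)
    (B : List (X × Bool)) (b : Bool) {w : ℝ} (hw : 0 ≤ w) {f : X → ℝ} (hf : f ∈ F) :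
    weightedLoss (unitWeights B) (tilted O x B b w) + w * labelDist b (tilted O x B b w x) ^ 2
        + w / 2 * (labelDist b (tilted O x B b w x) - labelDist b (f x)) ^ 2
      ≤ weightedLoss (unitWeights B) f + w * labelDist b (f x) ^ 2 := by
  set g := tilted O x B b w
  have hg : g ∈ F := (hO _).1
  have hmid : (1 / 2 : ℝ) • g + (1 / 2 : ℝ) • f ∈ F :=
    hconv hg hf (by norm_num) (by norm_num) (by norm_num)
  have h1 := tilted_le hO x B b hw hmid
  have h2 := weightedLoss_midpoint_le (unitWeights B) g f
  rw [labelDist_midpoint] at h1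
  change weightedLoss (unitWeights B) g + w * labelDist b (g x) ^ 2 ≤ _ at h1
  -- Optimality against the midpoint gains `w / 4` times the squared difference of the distances;
  -- doubling gives the factor `w / 2`.
  nlinarith

/-- The constant makes the initial interval, of length at most `4 β / α ^ 2`, shrink to at most `β α
/ 4`. -/
lemma two_pow_bisectSteps {α : ℝ} (hα : 0 < α) : 16 / α ^ 3 ≤ 2 ^ bisectSteps α := by
  have h : Real.logb 2 (16 / α ^ 3) ≤ bisectSteps α := Nat.le_ceil _
  rw [Real.logb_le_iff_le_rpow (by norm_num) (by positivity)] at h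
  simpa using h

/-- A minimizer outside the active set has larger loss than any active function, hence by optimality
a smaller penalty: its distance is a valid lower bound. A minimizer inside the active set witnesses
tightness. Bisection yields one of each kind at almost equal weights. -/
lemma bisectBound_spec (hF : ∀ f ∈ F, ∀ x, f x ∈ Set.Icc (0 : ℝ) 1)
    (hO : IsRegressionOracle F O) (hconv : Convex ℝ F)
    {β α : ℝ} (hβ : 0 < β) (hα : 0 < α) (hα1 : α ≤ 1) (b : Bool) (x : X)
    (B : List (X × Bool)) :
    (∀ f ∈ activeSet F O B β, (bisectBound b x B β α).eval O < labelDist b (f x)) ∧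
    ∃ f ∈ activeSet F O B β,
      labelDist b (f x) - α ≤ (bisectBound b x B β α).eval O := by
  set R₀ := weightedLoss (unitWeights B) (O (unitWeights B)) with hR₀
  set W := β / (α / 2) ^ 2 with hW
  have hW0 : 0 < W := by positivity
  have hWβ : β ≤ W := by
    rw [hW, le_div_iff₀ (by positivity)]
    have : (α / 2) ^ 2 ≤ 1 := by nlinarith
    nlinarith
  have hmem (w : ℝ) : tilted O x B b w ∈ F := (hO _).1
  have hR (f) (hf : f ∈ F) : R₀ ≤ weightedLoss (unitWeights B) f := hO.le_unitWeights B hf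
  -- If the minimizer is still active at the largest weight `W`, a loss difference of at most `β` is
  -- worth only `β / W = (α / 2) ^ 2` in squared distance, and a single value settles both bounds.
  by_cases h : weightedLoss (unitWeights B) (tilted O x B b W) ≤ R₀ + β
  · have he : (bisectBound b x B β α).eval O = labelDist b (tilted O x B b W x) - α := by
      unfold tilted at h
      simp only [bisectBound, OracleProg.eval]
      rw [if_pos h]; rfl
    rw [he]
    refine ⟨fun f hf => ?_, tilted O x B b W, ⟨hmem W, h⟩, le_rfl⟩
    have h1 := tilted_le hO x B b hW0.le hf.1
    have h2 := hR _ (hmem W)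
    have h3 : weightedLoss (unitWeights B) f ≤ R₀ + β := hf.2
    have h4 : W * labelDist b (tilted O x B b W x) ^ 2
        ≤ W * (labelDist b (f x) ^ 2 + (α / 2) ^ 2) := by
      have : W * (α / 2) ^ 2 = β := by rw [hW]; field_simp
      nlinarith
    have h5 := le_of_mul_le_mul_left h4 hW0
    have hu := (labelDist_mem b (hF f hf.1 x)).1
    have h6 : labelDist b (tilted O x B b W x) ^ 2 ≤ (labelDist b (f x) + α / 2) ^ 2 := by
      nlinarith
    have := abs_le_of_sq_le_sq' h6 (by positivity)
    linarith [this.2]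
  -- Weight `β` is a safe left endpoint: the penalty of the empirical minimizer is at most `β`
  -- there, since distances are at most `1`.
  · have hlo : weightedLoss (unitWeights B) (tilted O x B b β) ≤ R₀ + β := by
      have h1 := tilted_le hO x B b hβ.le (hO (unitWeights B)).1
      have h2 := labelDist_mem b (hF _ (hO (unitWeights B)).1 x)
      have h3 := labelDist_mem b (hF _ (hmem β) x)
      change _ ≤ R₀ + _ at h1
      have h4 : labelDist b (O (unitWeights B) x) ^ 2 ≤ 1 := by nlinarith [h2.1, h2.2]
      nlinarith [sq_nonneg (labelDist b (tilted O x B b β x))]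
    obtain ⟨l, u, hl, hlu, hd, hl', hu', he'⟩ :=
      bisect_eval (O := O) x B b (R₀ + β) (bisectSteps α) β W hWβ hlo (not_le.1 h)
    have he : (bisectBound b x B β α).eval O = labelDist b (tilted O x B b u x) - α / 2 := by
      rw [← he', ← OracleProg.subConst_eval]
      unfold tilted at h
      simp only [bisectBound, OracleProg.eval]
      rw [if_neg h]
    rw [he]
    constructor
    · intro f hf
      have h1 := tilted_le hO x B b (hβ.le.trans (hl.trans hlu)) hf.1
      have h3 : weightedLoss (unitWeights B) f ≤ R₀ + β := hf.2
      have h4 : u * labelDist b (tilted O x B b u x) ^ 2 < u * labelDist b (f x) ^ 2 := by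
        linarith
      have h5 := lt_of_mul_lt_mul_left h4 (hβ.le.trans (hl.trans hlu))
      have := lt_of_pow_lt_pow_left₀ 2 (labelDist_mem b (hF f hf.1 x)).1 h5
      linarith
    · refine ⟨tilted O x B b l, ⟨hmem l, hl'⟩, ?_⟩
      have h1 := tilted_strong hO hconv x B b (hβ.le.trans hl) (hmem u)
      have h2 := tilted_strong hO hconv x B b (hβ.le.trans (hl.trans hlu)) (hmem l)
      have hvl := labelDist_mem b (hF _ (hmem l) x)
      have hvu := labelDist_mem b (hF _ (hmem u) x)
      set v := labelDist b (tilted O x B b l x)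
      set v' := labelDist b (tilted O x B b u x)
      have hgap : u - l ≤ β * α / 4 := by
        rw [hd, div_le_iff₀ (by positivity)]
        have h6 := two_pow_bisectSteps hα
        calc W - β ≤ W := by linarith
          _ = β * α / 4 * (16 / α ^ 3) := by rw [hW]; field_simp; norm_num
          _ ≤ _ := by gcongr
      by_contra hcon
      have hΔ : α / 2 < v - v' := by linarith
      -- Adding the two strong minimality inequalities cancels the losses. Since `l ≥ β` and `u - l
      -- ≤ β α / 4`, dividing by `v - v'` gives `v - v' ≤ α / 2`.
      have h7 : (l + u) / 2 * (v - v') ^ 2 ≤ (u - l) * ((v - v') * (v + v')) := by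
        nlinarith
      have h8 : (l + u) / 2 * (v - v') ≤ (u - l) * (v + v') := by
        have : (v - v') * ((l + u) / 2 * (v - v')) ≤ (v - v') * ((u - l) * (v + v')) := by
          nlinarith
        exact le_of_mul_le_mul_left this (by linarith)
      have h9 : (u - l) * (v + v') ≤ β * α / 4 * 2 := by
        apply mul_le_mul hgap (by linarith [hvl.2, hvu.2]) (by linarith [hvl.1, hvu.1])
        positivity
      have h10 : β * (v - v') ≤ (l + u) / 2 * (v - v') := by
        apply mul_le_mul_of_nonneg_right <;> linarith
      nlinarith

end Bisection

/- ### The two subroutines -/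

section Subroutines

variable {X : Type u} {F : Set (X → ℝ)} {O : List (WExample X) → X → ℝ}

/-- Maps the result of a program by `v ↦ 1 - v`. -/
def OracleProg.oneSub : OracleProg X ℝ → OracleProg X ℝ
  | .ret a => .ret (1 - a)
  | .call S next => .call S fun f => (next f).oneSub

lemma OracleProg.oneSub_eval (p : OracleProg X ℝ) : p.oneSub.eval O = 1 - p.eval O := by
  induction p with
  | ret a => rfl
  | call S next ih => exact ih _

lemma OracleProg.oneSub_calls (p : OracleProg X ℝ) : p.oneSub.calls O = p.calls O := by
  induction p with
  | ret a => rfl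
  | call S next ih => simp only [oneSub, OracleProg.calls, ih]

variable (X) in
/-- Confidence bounds for general classes, by grid search. -/
def gridSubroutine : CISubroutine X where
  algLcb x B β σ α := gridBound false x B β σ α
  algUcb x B β σ α := (gridBound true x B β σ α).oneSub

variable (X) in
/-- Confidence bounds for convex classes, by bisection. -/
def bisectSubroutine : CISubroutine X where
  algLcb x B β _ α := bisectBound false x B β α
  algUcb x B β _ α := (bisectBound true x B β α).oneSub

/-- The computed bounds lie strictly outside of the values of the active functions. -/
def StrictBounds (A : CISubroutine X) (F : Set (X → ℝ)) (O : List (WExample X) → X → ℝ) : Prop :=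
  ∀ (x : X) (B : List (X × Bool)) (β σ α : ℝ), 0 < β → 0 < σ → 0 < α → α ≤ 1 →
    ∀ f ∈ activeSet F O B β,
      (A.algLcb x B β σ α).eval O < f x ∧ f x < (A.algUcb x B β σ α).eval O

lemma lcb_le (hF : ∀ f ∈ F, ∀ x, f x ∈ Set.Icc (0 : ℝ) 1) {G : Set (X → ℝ)} (hG : G ⊆ F)
    {f : X → ℝ} (hf : f ∈ G) (x : X) : lcb G x ≤ f x :=
  csInf_le ⟨0, by rintro _ ⟨g, hg, rfl⟩; exact (hF g (hG hg) x).1⟩ ⟨f, hf, rfl⟩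

lemma le_ucb (hF : ∀ f ∈ F, ∀ x, f x ∈ Set.Icc (0 : ℝ) 1) {G : Set (X → ℝ)} (hG : G ⊆ F)
    {f : X → ℝ} (hf : f ∈ G) (x : X) : f x ≤ ucb G x :=
  le_csSup ⟨1, by rintro _ ⟨g, hg, rfl⟩; exact (hF g (hG hg) x).2⟩ ⟨f, hf, rfl⟩

lemma le_lcb {G : Set (X → ℝ)} (hG : G.Nonempty) {x : X} {v : ℝ} (h : ∀ f ∈ G, v ≤ f x) :
    v ≤ lcb G x :=
  le_csInf (hG.image _) (by rintro _ ⟨g, hg, rfl⟩; exact h g hg)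

lemma ucb_le {G : Set (X → ℝ)} (hG : G.Nonempty) {x : X} {v : ℝ} (h : ∀ f ∈ G, f x ≤ v) :
    ucb G x ≤ v :=
  csSup_le (hG.image _) (by rintro _ ⟨g, hg, rfl⟩; exact h g hg)

/-- Distance from label `false` is the value itself and distance from label `true` is one minus the
value, so lower bounds on distances serve both sides. -/
lemma certifies_of_spec (hF : ∀ f ∈ F, ∀ x, f x ∈ Set.Icc (0 : ℝ) 1)
    (hO : IsRegressionOracle F O) {A : CISubroutine X} {r : ℝ}
    (hl : ∀ (x : X) (B : List (X × Bool)) (β σ α : ℝ), 0 < β → 0 < σ → 0 < α → α ≤ 1 →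
      (∀ f ∈ activeSet F O B β, (A.algLcb x B β σ α).eval O < labelDist false (f x)) ∧
      ∃ f ∈ activeSet F O B (β + r * σ),
        labelDist false (f x) - α ≤ (A.algLcb x B β σ α).eval O)
    (hu : ∀ (x : X) (B : List (X × Bool)) (β σ α : ℝ), 0 < β → 0 < σ → 0 < α → α ≤ 1 →
      (∀ f ∈ activeSet F O B β, 1 - (A.algUcb x B β σ α).eval O < labelDist true (f x)) ∧
      ∃ f ∈ activeSet F O B (β + r * σ),
        labelDist true (f x) - α ≤ 1 - (A.algUcb x B β σ α).eval O) :
    Certifies A F O r ∧ StrictBounds A F O := by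
  have hs : StrictBounds A F O := by
    intro x B β σ α hβ hσ hα hα1 f hf
    have h1 := (hl x B β σ α hβ hσ hα hα1).1 f hf
    have h2 := (hu x B β σ α hβ hσ hα hα1).1 f hf
    simp only [labelDist, Bool.false_eq_true, if_false, if_true] at h1 h2
    exact ⟨h1, by linarith⟩
  refine ⟨fun x B β σ α hβ hσ hα hα1 => ?_, hs⟩
  have hne : (activeSet F O B β).Nonempty := ⟨_, empMin_mem_activeSet hO B hβ.le⟩
  obtain ⟨f, hf, hfl⟩ := (hl x B β σ α hβ hσ hα hα1).2
  obtain ⟨g, hg, hgl⟩ := (hu x B β σ α hβ hσ hα hα1).2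
  simp only [labelDist, Bool.false_eq_true, if_false, if_true] at hfl hgl
  refine ⟨⟨?_, ?_⟩, ?_, ?_⟩
  · linarith [lcb_le hF (activeSet_subset _ _) hf x]
  · exact le_lcb hne fun f hf => (hs x B β σ α hβ hσ hα hα1 f hf).1.le
  · exact ucb_le hne fun f hf => (hs x B β σ α hβ hσ hα hα1 f hf).2.le
  · linarith [le_ucb hF (activeSet_subset _ _) hg x]

lemma gridSubroutine_certifies (hF : ∀ f ∈ F, ∀ x, f x ∈ Set.Icc (0 : ℝ) 1)
    (hO : IsRegressionOracle F O) :
    Certifies (gridSubroutine X) F O 1 ∧ StrictBounds (gridSubroutine X) F O := by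
  apply certifies_of_spec hF hO
  · intro x B β σ α hβ hσ hα _
    simpa [gridSubroutine] using gridBound_spec hF hO hβ hσ hα false x B
  · intro x B β σ α hβ hσ hα _
    simpa [gridSubroutine, OracleProg.oneSub_eval] using gridBound_spec hF hO hβ hσ hα true x B

lemma bisectSubroutine_certifies (hF : ∀ f ∈ F, ∀ x, f x ∈ Set.Icc (0 : ℝ) 1)
    (hO : IsRegressionOracle F O) (hconv : Convex ℝ F) :
    Certifies (bisectSubroutine X) F O 0 ∧ StrictBounds (bisectSubroutine X) F O := by
  apply certifies_of_spec hF hO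
  · intro x B β σ α hβ _ hα hα1
    simpa [bisectSubroutine] using bisectBound_spec hF hO hconv hβ hα hα1 false x B
  · intro x B β σ α hβ _ hα hα1
    simpa [bisectSubroutine, OracleProg.oneSub_eval] using
      bisectBound_spec hF hO hconv hβ hα hα1 true x B

/-- Exact certification implies certification with slack. -/
lemma Certifies.slack (hF : ∀ f ∈ F, ∀ x, f x ∈ Set.Icc (0 : ℝ) 1)
    (hO : IsRegressionOracle F O) {A : CISubroutine X} (h : Certifies A F O 0) :
    Certifies A F O 1 := by
  intro x B β σ α hβ hσ hα hα1
  have hne : (activeSet F O B β).Nonempty := ⟨_, empMin_mem_activeSet hO B hβ.le⟩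
  obtain ⟨⟨h1, h2⟩, h3, h4⟩ := h x B β σ α hβ hσ hα hα1
  rw [zero_mul, add_zero] at h1 h4
  have hsub : activeSet F O B β ⊆ activeSet F O B (β + 1 * σ) := activeSet_mono B (by linarith)
  refine ⟨⟨?_, h2⟩, h3, ?_⟩
  · have := le_lcb hne (x := x) fun f hf => lcb_le hF (activeSet_subset _ _) (hsub hf) x
    linarith
  · have := ucb_le hne (x := x) fun f hf => le_ucb hF (activeSet_subset _ _) (hsub hf) x
    linarith

end Subroutines

/- ### Measurability of functions of lists -/

section ListMeasurable

/-- The `σ`-algebra on lists for which a set is measurable if its part of each length is. -/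
instance listMeasurableSpace {α : Type*} [MeasurableSpace α] : MeasurableSpace (List α) :=
  ⨅ n : ℕ, MeasurableSpace.map (List.ofFn : (Fin n → α) → List α) inferInstance

variable {α β γ : Type*} [MeasurableSpace α] [MeasurableSpace β] [MeasurableSpace γ]

lemma measurableSet_list_iff {s : Set (List α)} :
    MeasurableSet s ↔ ∀ n, MeasurableSet ((List.ofFn : (Fin n → α) → List α) ⁻¹' s) := by
  change MeasurableSet[⨅ n : ℕ, MeasurableSpace.map _ _] s ↔ _
  rw [MeasurableSpace.measurableSet_iInf]
  rfl

lemma measurable_ofFn (n : ℕ) : Measurable (List.ofFn : (Fin n → α) → List α) :=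
  fun _ hs => measurableSet_list_iff.1 hs n

lemma measurable_list_of_forall {f : List α → β}
    (h : ∀ n, Measurable fun v : Fin n → α => f (List.ofFn v)) : Measurable f :=
  fun _ hs => measurableSet_list_iff.2 fun n => h n hs

lemma measurable_list_length : Measurable (List.length : List α → ℕ) :=
  measurable_list_of_forall fun n => by simp

lemma measurable_list_getD (a : α) (i : ℕ) : Measurable fun l : List α => l.getD i a := by
  refine measurable_list_of_forall fun n => ?_
  by_cases h : i < n
  · have : (fun v : Fin n → α => (List.ofFn v).getD i a) = fun v => v ⟨i, h⟩ := by
      funext v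
      simp [List.getD_eq_getElem?_getD, h]
    rw [this]
    exact measurable_pi_apply _
  · have : (fun v : Fin n → α => (List.ofFn v).getD i a) = fun _ => a := by
      funext v
      simp [List.getD_eq_getElem?_getD, h]
    rw [this]
    exact measurable_const

/-- A function of a list and a parameter is measurable if it is so on lists of each length. -/
lemma measurable_list_prod {f : List α × β → γ}
    (h : ∀ n, Measurable fun p : (Fin n → α) × β => f (List.ofFn p.1, p.2)) : Measurable f := by
  have hlen (n : ℕ) : MeasurableSet {p : List α × β | p.1.length = n} :=
    (measurable_list_length.comp measurable_fst) (measurableSet_singleton n)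
  rcases isEmpty_or_nonempty α with hα | ⟨⟨a⟩⟩
  · have : f = fun p => f ([], p.2) := by
      funext ⟨l, b⟩
      cases l with
      | nil => rfl
      | cons a l => exact isEmptyElim a
    rw [this]
    have h0 := h 0
    simp only [List.ofFn_zero] at h0
    exact h0.comp (measurable_const.prodMk measurable_snd : Measurable fun p : List α × β =>
      ((Fin.elim0 : Fin 0 → α), p.2))
  · intro s hs
    -- On lists of length `n` the coordinates are recovered by `getD`, a total function whose dummy
    -- value `a` is never used on that piece.
    have : f ⁻¹' s = ⋃ n : ℕ, {p | p.1.length = n} ∩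
        (fun p : List α × β => f (List.ofFn (fun i : Fin n => p.1.getD i a), p.2)) ⁻¹' s := by
      ext ⟨l, b⟩
      simp only [Set.mem_preimage, Set.mem_iUnion, Set.mem_inter_iff, Set.mem_ofPred_eq,
        exists_eq_left']
      have : List.ofFn (fun i : Fin l.length => l.getD i a) = l := by
        apply List.ext_getElem <;> simp
      rw [this]
    rw [this]
    refine MeasurableSet.iUnion fun n => (hlen n).inter ?_
    refine ((h n).comp (g := fun p : (Fin n → α) × β => f (List.ofFn p.1, p.2))
      (f := fun p : List α × β => ((fun i : Fin n => p.1.getD i a), p.2)) ?_) hs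
    refine Measurable.prodMk ?_ measurable_snd
    exact measurable_pi_lambda _ fun i => (measurable_list_getD a i).comp measurable_fst

lemma _root_.Measurable.list_append {f g : β → List α} (hf : Measurable f) (hg : Measurable g) :
    Measurable fun b => f b ++ g b := by
  have : Measurable fun p : List α × List α => p.1 ++ p.2 := by
    refine measurable_list_prod fun n => ?_
    have h2 : Measurable fun p : List α × (Fin n → α) => List.ofFn p.2 ++ p.1 := by
      refine measurable_list_prod fun m => ?_
      have h3 : (fun p : (Fin m → α) × (Fin n → α) => List.ofFn p.2 ++ List.ofFn p.1)
          = fun p => List.ofFn (Fin.append p.2 p.1) := by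
        funext p; rw [List.ofFn_fin_append]
      change Measurable fun p : (Fin m → α) × (Fin n → α) => List.ofFn p.2 ++ List.ofFn p.1
      rw [h3]
      refine (measurable_ofFn _).comp (measurable_pi_lambda _ fun i => ?_)
      refine Fin.addCases (fun i => ?_) (fun i => ?_) i
      · simpa using! (measurable_pi_apply i).comp measurable_snd
      · simpa using! (measurable_pi_apply i).comp measurable_fst
    exact h2.comp measurable_swap
  exact this.comp (hf.prodMk hg)

lemma measurable_list_singleton : Measurable fun a : α => [a] := by
  have : (fun a : α => [a]) = fun a => List.ofFn (fun _ : Fin 1 => a) := by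
    funext a; simp
  rw [this]
  exact (measurable_ofFn 1).comp (measurable_pi_lambda _ fun _ => measurable_id)

lemma _root_.Measurable.list_map {f : α → β} (hf : Measurable f) : Measurable (List.map f) := by
  refine measurable_list_of_forall fun n => ?_
  simp only [List.map_ofFn]
  exact (measurable_ofFn n).comp
    (measurable_pi_lambda _ fun i => hf.comp (measurable_pi_apply i))

end ListMeasurable

/- ### Measurability of the learner -/

/-- An inverted interval is empty and therefore leads to abstention, which accounts for the first
conjunct. In this form the abstention rule is visibly measurable. -/
lemma epochClassifier_ne_none_iff {X : Type u} {O : List (WExample X) → X → ℝ}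
    {A : CISubroutine X} (p : EpochParams) (m : ℕ) (B : List (X × Bool)) (x : X) :
    epochClassifier A O p m B x ≠ none ↔
      lcbHat A O p m B x ≤ ucbHat A O p m B x ∧
      (lcbHat A O p m B x < 1 / 2 - p.γ ∨ 1 / 2 + p.γ < ucbHat A O p m B x) := by
  unfold epochClassifier
  split_ifs with h
  · simp only [ne_eq, not_true_eq_false, false_iff, not_and, not_or, not_lt]
    intro hle
    rwa [Set.Icc_subset_Icc_iff hle] at h
  · simp only [ne_eq, reduceCtorEq, not_false_eq_true, true_iff]
    have hle : lcbHat A O p m B x ≤ ucbHat A O p m B x := by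
      by_contra hlt
      exact h (by rw [Set.Icc_eq_empty hlt]; exact Set.empty_subset _)
    rw [Set.Icc_subset_Icc_iff hle, not_and_or, not_le, not_le] at h
    exact ⟨hle, h⟩

section Learner

variable {X : Type u} [MeasurableSpace X] {O : List (WExample X) → X → ℝ}

lemma measurable_labelValue : Measurable labelValue := measurable_of_countable _

lemma measurable_labelDist (b : Bool) : Measurable (labelDist b) := by
  change Measurable fun v => labelDist b v
  cases b <;> simp only [labelDist, Bool.false_eq_true, if_false, if_true] <;> fun_prop

lemma measurable_unitWeights : Measurable (unitWeights : List (X × Bool) → List (WExample X)) :=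
  Measurable.list_map (by fun_prop)

lemma MeasurableOracle.measurable (hO : MeasurableOracle O) {Ω : Type*} [MeasurableSpace Ω]
    {S : Ω → List (WExample X)} {x : Ω → X} (hS : Measurable S) (hx : Measurable x) :
    Measurable fun ω => O (S ω) (x ω) := by
  have : Measurable fun p : List (WExample X) × X => O p.1 p.2 := measurable_list_prod fun n => hO n
  exact this.comp (hS.prodMk hx)

lemma MeasurableOracle.weightedLoss (hO : MeasurableOracle O) {Ω : Type*} [MeasurableSpace Ω]
    {S S' : Ω → List (WExample X)} (hS : Measurable S) (hS' : Measurable S') :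
    Measurable fun ω => weightedLoss (S ω) (O (S' ω)) := by
  have : Measurable fun p : List (WExample X) × List (WExample X) =>
      ActiveAbstain.weightedLoss p.1 (O p.2) := by
    refine measurable_list_prod fun n => ?_
    simp only [ActiveAbstain.weightedLoss, List.map_ofFn, List.sum_ofFn]
    refine Finset.measurable_sum _ fun i _ => ?_
    have hi : Measurable fun p : (Fin n → WExample X) × List (WExample X) => p.1 i :=
      (measurable_pi_apply i).comp measurable_fst
    refine Measurable.mul ?_ (Measurable.pow_const (Measurable.sub ?_ ?_) 2)
    · exact measurable_coe_nnreal_real.comp (measurable_fst.comp hi)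
    · exact hO.measurable measurable_snd ((measurable_fst.comp measurable_snd).comp hi)
    · exact measurable_labelValue.comp ((measurable_snd.comp measurable_snd).comp hi)
  exact this.comp (hS.prodMk hS')

/-- The computed confidence bounds depend measurably on the data and the point. -/
def MeasurableSubroutine (A : CISubroutine X) (O : List (WExample X) → X → ℝ) : Prop :=
  ∀ β σ α : ℝ,
    (Measurable fun q : List (X × Bool) × X => (A.algLcb q.2 q.1 β σ α).eval O) ∧
    Measurable fun q : List (X × Bool) × X => (A.algUcb q.2 q.1 β σ α).eval O

lemma measurable_targetExamples (b : Bool) {Ω : Type*} [MeasurableSpace Ω] {x : Ω → X}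
    {w a : Ω → ℝ} (hx : Measurable x) (hw : Measurable w) (ha : Measurable a) :
    Measurable fun ω => targetExamples (x ω) b (w ω) (a ω) := by
  have h1 : Measurable fun ω => [(((w ω) * (1 - a ω)).toNNReal, x ω, b)] :=
    measurable_list_singleton.comp (by fun_prop)
  have h2 : Measurable fun ω => [(((w ω) * a ω).toNNReal, x ω, !b)] :=
    measurable_list_singleton.comp (by fun_prop)
  exact Measurable.list_append h1 h2

lemma measurable_gridSearch (hO : MeasurableOracle O) (b : Bool) (w η : ℝ) (n i : ℕ)
    {Ω : Type*} [MeasurableSpace Ω] {x : Ω → X} {B : Ω → List (X × Bool)} {thr : Ω → ℝ}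
    (hx : Measurable x) (hB : Measurable B) (ht : Measurable thr) :
    Measurable fun ω => (gridSearch (x ω) (B ω) b w η (thr ω) n i).eval O := by
  induction n generalizing i with
  | zero => simp [gridSearch, OracleProg.eval]
  | succ n ih =>
    have hS : Measurable fun ω => unitWeights (B ω) ++ targetExamples (x ω) b w (i * η) :=
      (measurable_unitWeights.comp hB).list_append
        (measurable_targetExamples b hx measurable_const measurable_const)
    have hv := hO.measurable hS hx
    have hl := hO.weightedLoss (measurable_unitWeights.comp hB) hS
    have : (fun ω => (gridSearch (x ω) (B ω) b w η (thr ω) (n + 1) i).eval O) = fun ω =>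
        if weightedLoss (unitWeights (B ω)) (O (unitWeights (B ω) ++
            targetExamples (x ω) b w (i * η))) + w * (labelDist b (O (unitWeights (B ω) ++
            targetExamples (x ω) b w (i * η)) (x ω)) - i * η) ^ 2 ≤ thr ω
        then i * η - 2 * η else (gridSearch (x ω) (B ω) b w η (thr ω) n (i + 1)).eval O := by
      funext ω
      simp only [gridSearch, OracleProg.eval]
      split_ifs <;> rfl
    rw [this]
    refine Measurable.ite (measurableSet_le ?_ ht) measurable_const (ih (i + 1))
    exact hl.add (measurable_const.mul
      ((((measurable_labelDist b).comp hv).sub measurable_const).pow_const 2))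

lemma measurable_bisect (hO : MeasurableOracle O) (b : Bool) (n : ℕ) (lo hi : ℝ)
    {Ω : Type*} [MeasurableSpace Ω] {x : Ω → X} {B : Ω → List (X × Bool)} {thr : Ω → ℝ}
    (hx : Measurable x) (hB : Measurable B) (ht : Measurable thr) :
    Measurable fun ω => (bisect (x ω) (B ω) b (thr ω) n lo hi).eval O := by
  have hS (w : ℝ) : Measurable fun ω => unitWeights (B ω) ++ targetExamples (x ω) b w 0 :=
    (measurable_unitWeights.comp hB).list_append
      (measurable_targetExamples b hx measurable_const measurable_const)
  induction n generalizing lo hi with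
  | zero =>
    simp only [bisect, OracleProg.eval]
    exact (measurable_labelDist b).comp (hO.measurable (hS hi) hx)
  | succ n ih =>
    have : (fun ω => (bisect (x ω) (B ω) b (thr ω) (n + 1) lo hi).eval O) = fun ω =>
        if weightedLoss (unitWeights (B ω)) (O (unitWeights (B ω) ++
            targetExamples (x ω) b ((lo + hi) / 2) 0)) ≤ thr ω
        then (bisect (x ω) (B ω) b (thr ω) n ((lo + hi) / 2) hi).eval O
        else (bisect (x ω) (B ω) b (thr ω) n lo ((lo + hi) / 2)).eval O := by
      funext ω
      simp only [bisect, OracleProg.eval]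
      split_ifs <;> rfl
    rw [this]
    exact Measurable.ite (measurableSet_le
      (hO.weightedLoss (measurable_unitWeights.comp hB) (hS _)) ht) (ih _ _) (ih _ _)

lemma measurable_gridBound (hO : MeasurableOracle O) (b : Bool) (β σ α : ℝ) :
    Measurable fun q : List (X × Bool) × X => (gridBound b q.2 q.1 β σ α).eval O := by
  simp only [gridBound, OracleProg.eval]
  have hu : Measurable fun q : List (X × Bool) × X => unitWeights q.1 :=
    measurable_unitWeights.comp measurable_fst
  exact measurable_gridSearch hO b _ _ _ _ measurable_snd measurable_fst
    (((hO.weightedLoss hu hu).add_const _).add_const _)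

lemma measurable_bisectBound (hO : MeasurableOracle O) (b : Bool) (β α : ℝ) :
    Measurable fun q : List (X × Bool) × X => (bisectBound b q.2 q.1 β α).eval O := by
  have hu : Measurable fun q : List (X × Bool) × X => unitWeights q.1 :=
    measurable_unitWeights.comp measurable_fst
  have hS : Measurable fun q : List (X × Bool) × X =>
      unitWeights q.1 ++ targetExamples q.2 b (β / (α / 2) ^ 2) 0 :=
    hu.list_append (measurable_targetExamples b measurable_snd measurable_const measurable_const)
  have : (fun q : List (X × Bool) × X => (bisectBound b q.2 q.1 β α).eval O) = fun q =>
      if weightedLoss (unitWeights q.1) (O (unitWeights q.1 ++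
          targetExamples q.2 b (β / (α / 2) ^ 2) 0))
          ≤ weightedLoss (unitWeights q.1) (O (unitWeights q.1)) + β
      then labelDist b (O (unitWeights q.1 ++ targetExamples q.2 b (β / (α / 2) ^ 2) 0) q.2) - α
      else (bisect q.2 q.1 b (weightedLoss (unitWeights q.1) (O (unitWeights q.1)) + β)
        (bisectSteps α) β (β / (α / 2) ^ 2)).eval O - α / 2 := by
    funext q
    simp only [bisectBound, OracleProg.eval]
    split_ifs
    · rfl
    · rw [OracleProg.subConst_eval]
  rw [this]
  have ht := (hO.weightedLoss hu hu).add_const β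
  exact Measurable.ite (measurableSet_le (hO.weightedLoss hu hS) ht)
    (((measurable_labelDist b).comp (hO.measurable hS measurable_snd)).sub_const _)
    ((measurable_bisect hO b _ _ _ measurable_snd measurable_fst ht).sub_const _)

lemma gridSubroutine_measurable (hO : MeasurableOracle O) :
    MeasurableSubroutine (gridSubroutine X) O := by
  intro β σ α
  refine ⟨measurable_gridBound hO false β σ α, ?_⟩
  simp only [gridSubroutine, OracleProg.oneSub_eval]
  exact (measurable_gridBound hO true β σ α).const_sub 1

lemma bisectSubroutine_measurable (hO : MeasurableOracle O) :
    MeasurableSubroutine (bisectSubroutine X) O := by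
  intro β σ α
  refine ⟨measurable_bisectBound hO false β α, ?_⟩
  simp only [bisectSubroutine, OracleProg.oneSub_eval]
  exact (measurable_bisectBound hO true β α).const_sub 1

variable {A : CISubroutine X} (p : EpochParams)

lemma measurable_lcbHat (hA : MeasurableSubroutine A O) (m : ℕ) :
    Measurable fun q : List (X × Bool) × X => lcbHat A O p m q.1 q.2 :=
  (hA _ _ _).1.sub_const _

lemma measurable_ucbHat (hA : MeasurableSubroutine A O) (m : ℕ) :
    Measurable fun q : List (X × Bool) × X => ucbHat A O p m q.1 q.2 :=
  (hA _ _ _).2.add_const _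

lemma measurableSet_epochClassifier_ne_none (hA : MeasurableSubroutine A O) (m : ℕ) :
    MeasurableSet {q : List (X × Bool) × X | epochClassifier A O p m q.1 q.2 ≠ none} := by
  simp only [epochClassifier_ne_none_iff]
  have hl := measurable_lcbHat p hA m
  have hu := measurable_ucbHat p hA m
  exact (measurableSet_le hl hu).inter
    ((measurableSet_lt hl measurable_const).union (measurableSet_lt measurable_const hu))

lemma measurableSet_queried (hA : MeasurableSubroutine A O) (m : ℕ) :
    MeasurableSet {q : List (X × Bool) × X | Queried A O p m q.1 q.2} := by
  have hl := measurable_lcbHat p hA m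
  have hu := measurable_ucbHat p hA m
  exact ((measurableSet_lt hl measurable_const).inter (measurableSet_lt measurable_const hu)).inter
    (measurableSet_epochClassifier_ne_none p hA m)

lemma measurable_collected (hA : MeasurableSubroutine A O) (m : ℕ) :
    Measurable fun z : ℕ → X × Bool => collected A O p z m := by
  classical
  induction m with
  | zero => exact measurable_const
  | succ m ih =>
    simp only [collected]
    refine ih.list_append ?_
    -- The filter predicate itself depends on `z`, so the list is built one time at a time from
    -- measurable pieces of length at most one.
    induction List.range' (tau m + 1) (tau (m + 1) - tau m) with
    | nil => exact measurable_const
    | cons t l ihl =>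
      have : (fun z : ℕ → X × Bool => ((t :: l).map z).filter
          fun q => decide (Queried A O p (m + 1) (collected A O p z m) q.1)) = fun z =>
          (if Queried A O p (m + 1) (collected A O p z m) (z t).1 then [z t] else []) ++
            (l.map z).filter fun q => decide (Queried A O p (m + 1) (collected A O p z m) q.1) := by
        funext z
        rw [List.map_cons, List.filter_cons]
        split_ifs <;> simp_all
      have h2 : Measurable fun z : ℕ → X × Bool =>
          (if Queried A O p (m + 1) (collected A O p z m) (z t).1 then [z t] else []) := by
        refine Measurable.ite ?_ (measurable_list_singleton.comp (measurable_pi_apply t))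
          measurable_const
        exact (ih.prodMk (measurable_fst.comp (measurable_pi_apply t)))
          (measurableSet_queried p hA (m + 1))
      have h3 := h2.list_append ihl
      convert h3 using 1

lemma measurable_empMin (hO : MeasurableOracle O) :
    Measurable fun q : List (X × Bool) × X => empMin O q.1 q.2 :=
  hO.measurable (measurable_unitWeights.comp measurable_fst) measurable_snd

end Learner

/- ### Uniform covers on finite sets of points -/

section Cover

/-- A term-by-term comparison with the binomial expansion turns the Sauer-Shelah bound into a power.
-/
lemma sum_choose_le_pow (n d : ℕ) : ∑ k ∈ Finset.Iic d, n.choose k ≤ (n + 1) ^ d := by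
  rw [add_pow]
  have : Finset.Iic d = Finset.range (d + 1) := by ext; simp
  rw [this]
  refine Finset.sum_le_sum fun k hk => ?_
  have h1 : 1 ≤ d.choose k := Nat.choose_pos (by simpa [Nat.lt_succ_iff] using hk)
  calc n.choose k ≤ n ^ k := Nat.choose_le_pow n k
    _ ≤ n ^ k * 1 ^ (d - k) * d.choose k := by
      rw [one_pow, mul_one]; exact Nat.le_mul_of_pos_right _ h1

variable {X : Type u} {F : Set (X → ℝ)}

lemma card_le_of_pseudoShatters {d : ℕ} (hd : pseudoDim F ≤ d) {s : Finset (X × ℝ)}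
    (hs : PseudoShatters F s) : s.card ≤ d := by
  have : (s.card : ℕ∞) ≤ pseudoDim F := le_iSup₂_of_le s hs le_rfl
  exact_mod_cast this.trans hd

open Classical in
/-- A class of finite pseudo dimension has a small uniform cover on each finite set. -/
lemma exists_cover (hF : ∀ f ∈ F, ∀ x, f x ∈ Set.Icc (0 : ℝ) 1) {d : ℕ} (hd : pseudoDim F ≤ d)
    (s : Finset X) {K : ℕ} (hK : 1 ≤ K) :
    ∃ G : Finset (X → ℝ), (G : Set (X → ℝ)) ⊆ F ∧ G.card ≤ (s.card * K + 1) ^ d ∧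
      ∀ f ∈ F, ∃ g ∈ G, ∀ x ∈ s, |f x - g x| ≤ 1 / K := by
  have hK0 : (0 : ℝ) < K := by exact_mod_cast hK
  set U : Finset (X × ℝ) := s ×ˢ (Finset.range K).image fun j : ℕ => (j : ℝ) / K with hU
  let pat : (X → ℝ) → Finset U := fun f => Finset.univ.filter fun p => p.1.2 < f p.1.1
  have hUcard : U.card ≤ s.card * K := by
    rw [hU, Finset.card_product]
    exact Nat.mul_le_mul_left _ (Finset.card_image_le.trans (by simp))
  let 𝒜 : Finset (Finset U) := Finset.univ.filter fun t => ∃ f ∈ F, pat f = t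
  -- A set of pairs shattered by the patterns is pseudo-shattered by `F`, so the pseudo dimension
  -- controls the VC dimension of the patterns.
  have hvc : 𝒜.vcDim ≤ d := by
    refine Finset.sup_le fun S hS => ?_
    rw [Finset.mem_shatterer] at hS
    rw [← Finset.card_map (Function.Embedding.subtype _)]
    refine card_le_of_pseudoShatters hd fun t ht => ?_
    obtain ⟨V, hV, hSV⟩ := hS (t := S.filter fun p => p.1 ∈ t) (Finset.filter_subset _ _)
    obtain ⟨f, hf, rfl⟩ := (Finset.mem_filter.1 hV).2
    refine ⟨f, hf, fun p hp => ?_⟩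
    obtain ⟨q, hq, rfl⟩ := Finset.mem_map.1 hp
    have h1 := Finset.ext_iff.1 hSV q
    simpa [pat, hq] using h1
  have hcard : 𝒜.card ≤ (s.card * K + 1) ^ d := by
    calc 𝒜.card ≤ 𝒜.shatterer.card := Finset.card_le_card_shatterer _
      _ ≤ ∑ k ∈ Finset.Iic 𝒜.vcDim, (Fintype.card U).choose k :=
        Finset.card_shatterer_le_sum_vcDim
      _ ≤ (Fintype.card U + 1) ^ 𝒜.vcDim := sum_choose_le_pow _ _
      _ ≤ (Fintype.card U + 1) ^ d := Nat.pow_le_pow_right (by omega) hvc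
      _ ≤ _ := by
        apply Nat.pow_le_pow_left
        rw [Fintype.card_coe]; omega
  let rep : Finset U → X → ℝ := fun t => if h : ∃ f ∈ F, pat f = t then h.choose else 0
  have hrep (t) (h : ∃ f ∈ F, pat f = t) : rep t ∈ F ∧ pat (rep t) = t := by
    simp only [rep, dif_pos h]; exact h.choose_spec
  refine ⟨𝒜.image rep, ?_, Finset.card_image_le.trans hcard, fun f hf => ?_⟩
  · intro g hg
    obtain ⟨t, ht, rfl⟩ := Finset.mem_image.1 (Finset.mem_coe.1 hg)
    exact (hrep t (Finset.mem_filter.1 ht).2).1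
  · have hfp : ∃ f' ∈ F, pat f' = pat f := ⟨f, hf, rfl⟩
    obtain ⟨hgF, hgp⟩ := hrep _ hfp
    refine ⟨rep (pat f), Finset.mem_image_of_mem _ (Finset.mem_filter.2 ⟨Finset.mem_univ _, hfp⟩),
      fun x hx => ?_⟩
    -- If `f₁ x > f₂ x + 1 / K`, the threshold `⌈K f₂ x⌉₊ / K` separates the two values, so the
    -- patterns differ.
    have aux : ∀ f₁ ∈ F, ∀ f₂ ∈ F, pat f₁ = pat f₂ → f₁ x ≤ f₂ x + 1 / K := by
      intro f₁ h₁ f₂ h₂ h12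
      by_contra! hlt
      have h3 := hF _ h₁ x
      have h4 := hF _ h₂ x
      have hc1 : (K : ℝ) * f₂ x ≤ ⌈(K : ℝ) * f₂ x⌉₊ := Nat.le_ceil _
      have hc2 : (⌈(K : ℝ) * f₂ x⌉₊ : ℝ) < K * f₂ x + 1 :=
        Nat.ceil_lt_add_one (mul_nonneg hK0.le h4.1)
      set j := ⌈(K : ℝ) * f₂ x⌉₊
      have hjf : (j : ℝ) / K < f₁ x := by
        rw [div_lt_iff₀ hK0]
        have : (K : ℝ) * (f₂ x + 1 / K) < K * f₁ x := by gcongr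
        have h5 : (K : ℝ) * (f₂ x + 1 / K) = K * f₂ x + 1 := by field_simp
        linarith
      have hjK : j < K := by
        have : (j : ℝ) / K < 1 := hjf.trans_le h3.2
        rw [div_lt_one hK0] at this
        exact_mod_cast this
      have hmem : (x, (j : ℝ) / K) ∈ U :=
        Finset.mem_product.2 ⟨hx, Finset.mem_image.2 ⟨j, Finset.mem_range.2 hjK, rfl⟩⟩
      have h6 : (⟨_, hmem⟩ : U) ∈ pat f₁ := by simpa [pat] using hjf
      rw [h12] at h6
      have h7 : (j : ℝ) / K < f₂ x := by simpa [pat] using h6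
      rw [div_lt_iff₀ hK0] at h7
      linarith
    rw [abs_le]
    constructor
    · linarith [aux _ hgF _ hf hgp]
    · linarith [aux _ hf _ hgF hgp.symm]

end Cover

/- ### The disagreement coefficient on an empirical measure -/

section Disagreement

variable {X : Type u} [MeasurableSpace X] {F : Set (X → ℝ)}

lemma one_le_disagreementCoeff {γ₀ : ℝ} (hne : F.Nonempty) : 1 ≤ disagreementCoeff F γ₀ := by
  obtain ⟨f, hf⟩ := hne
  refine le_iSup₂_of_le f hf (le_iSup₂_of_le 1 one_pos ?_)
  exact le_max_left _ _

lemma measure_disagreement_le {γ₀ : ℝ} {fs : X → ℝ} (hfs : fs ∈ F)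
    (hθ : disagreementCoeff F γ₀ ≠ ⊤) (μ : Measure X) [IsProbabilityMeasure μ] {γ ε : ℝ}
    (hγ : γ₀ < γ) (hε : 0 < ε) :
    γ ^ 2 / ε ^ 2 *
      μ.real {x | ∃ f ∈ F, γ < |f x - fs x| ∧ Real.sqrt (∫ z, (f z - fs z) ^ 2 ∂μ) ≤ ε}
      ≤ (disagreementCoeff F γ₀).toReal := by
  have h : ENNReal.ofReal (γ ^ 2 / ε ^ 2) *
      μ {x | ∃ f ∈ F, γ < |f x - fs x| ∧ Real.sqrt (∫ z, (f z - fs z) ^ 2 ∂μ) ≤ ε}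
      ≤ disagreementCoeff F γ₀ := by
    -- The coefficient only admits radii strictly above `ι`; taking `ι = ε / 2` admits `ε` itself.
    refine le_trans ?_ (le_iSup₂_of_le fs hfs (le_iSup₂_of_le (ε / 2) (half_pos hε) le_rfl))
    refine le_trans ?_ (le_max_right _ _)
    exact le_iSup₂_of_le μ ‹_› (le_iSup₂_of_le γ hγ
      (le_iSup₂_of_le ε (half_lt_self hε) le_rfl))
  have h2 := ENNReal.toReal_mono hθ h
  rwa [ENNReal.toReal_mul, ENNReal.toReal_ofReal (by positivity)] at h2

open Classical in
/-- Functions that are close to `fs` on a finite list of points differ from `fs` by more than `γ₀`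
on few of these points. -/
lemma card_disagreement_le {γ₀ : ℝ} (hγ₀ : 0 < γ₀) {fs : X → ℝ} (hfs : fs ∈ F)
    (hmeas : ∀ f ∈ F, Measurable f) (hθ : disagreementCoeff F γ₀ ≠ ⊤)
    {ι : Type*} (I : Finset ι) (x : ι → X) {ρ : ℝ} (hρ : 0 < ρ) (G : Set (X → ℝ)) (hG : G ⊆ F)
    (hGρ : ∀ f ∈ G, ∑ t ∈ I, (f (x t) - fs (x t)) ^ 2 ≤ ρ) :
    ((I.filter fun t => ∃ f ∈ G, γ₀ < |f (x t) - fs (x t)|).card : ℝ)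
      ≤ (disagreementCoeff F γ₀).toReal * ρ / γ₀ ^ 2 := by
  set J := I.filter fun t => ∃ f ∈ G, γ₀ < |f (x t) - fs (x t)| with hJ
  rcases I.eq_empty_or_nonempty with rfl | hI
  · simp only [hJ, Finset.filter_empty, Finset.card_empty, Nat.cast_zero]; positivity
  have hn : (0 : ℝ) < I.card := by exact_mod_cast hI.card_pos
  -- The coefficient only admits levels strictly above `γ₀`. Finitely many strict inequalities leave
  -- room for a common larger level.
  obtain ⟨γ, hγ, hJγ⟩ : ∃ γ, γ₀ < γ ∧ ∀ t ∈ J, ∃ f ∈ G, γ < |f (x t) - fs (x t)| := by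
    have h1 : ∀ᶠ γ in 𝓝[>] γ₀, ∀ t ∈ J, ∃ f ∈ G, γ < |f (x t) - fs (x t)| := by
      rw [Filter.eventually_all_finset]
      intro t ht
      obtain ⟨f, hf, hft⟩ := (Finset.mem_filter.1 ht).2
      filter_upwards [Ioo_mem_nhdsGT hft] with γ hγ
      exact ⟨f, hf, hγ.2⟩
    obtain ⟨γ, h2, h3⟩ := (h1.and self_mem_nhdsWithin).exists
    exact ⟨γ, h3, h2⟩
  let μ : Measure X := (I.card : ℝ≥0∞)⁻¹ • ∑ t ∈ I, Measure.dirac (x t)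
  have hc0 : (I.card : ℝ≥0∞) ≠ 0 := by simpa using hI.ne_empty
  have hμ : IsProbabilityMeasure μ := ⟨by
    simp only [μ, Measure.smul_apply, Measure.finsetSum_apply, measure_univ, Finset.sum_const,
      nsmul_eq_mul, mul_one, smul_eq_mul]
    exact ENNReal.inv_mul_cancel hc0 (ENNReal.natCast_ne_top _)⟩
  set ε := Real.sqrt (ρ / I.card) with hε
  have hε0 : 0 < ε := Real.sqrt_pos.2 (by positivity)
  have hL2 : ∀ f ∈ G, Real.sqrt (∫ z, (f z - fs z) ^ 2 ∂μ) ≤ ε := by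
    intro f hf
    apply Real.sqrt_le_sqrt
    have hm : Measurable fun z => (f z - fs z) ^ 2 :=
      ((hmeas f (hG hf)).sub (hmeas fs hfs)).pow_const 2
    rw [integral_smul_measure, integral_finsetSum_measure]
    · simp_rw [integral_dirac' _ _ hm.stronglyMeasurable]
      rw [ENNReal.toReal_inv, ENNReal.toReal_natCast, smul_eq_mul, inv_mul_eq_div]
      gcongr
      exact hGρ f hf
    · intro t _
      exact integrable_dirac' hm.stronglyMeasurable (by simp)
  have hcard : (J.card : ℝ) / I.card ≤
      μ.real {y | ∃ f ∈ F, γ < |f y - fs y| ∧ Real.sqrt (∫ z, (f z - fs z) ^ 2 ∂μ) ≤ ε} := by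
    have : (I.card : ℝ≥0∞)⁻¹ * J.card ≤
        μ {y | ∃ f ∈ F, γ < |f y - fs y| ∧ Real.sqrt (∫ z, (f z - fs z) ^ 2 ∂μ) ≤ ε} := by
      simp only [μ, Measure.smul_apply, Measure.finsetSum_apply, smul_eq_mul]
      gcongr
      calc (J.card : ℝ≥0∞) = ∑ t ∈ J, 1 := by simp
        _ ≤ ∑ t ∈ J, Measure.dirac (x t)
            {y | ∃ f ∈ F, γ < |f y - fs y| ∧ Real.sqrt (∫ z, (f z - fs z) ^ 2 ∂μ) ≤ ε} := by
          refine Finset.sum_le_sum fun t ht => ?_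
          obtain ⟨f, hf, hft⟩ := hJγ t ht
          -- The disagreement set need not be measurable; the lower bound for a Dirac measure holds
          -- regardless.
          refine le_trans ?_ Measure.le_dirac_apply
          rw [Set.indicator_of_mem]
          · simp
          · exact ⟨f, hG hf, hft, hL2 f hf⟩
        _ ≤ _ := Finset.sum_le_sum_of_subset (Finset.filter_subset _ _)
    have h2 := ENNReal.toReal_mono (measure_ne_top μ _) this
    rw [ENNReal.toReal_mul, ENNReal.toReal_inv, ENNReal.toReal_natCast,
      ENNReal.toReal_natCast] at h2
    rw [div_eq_inv_mul]; exact h2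
  have hmain := measure_disagreement_le hfs hθ μ hγ hε0
  have hεsq : ε ^ 2 = ρ / I.card := Real.sq_sqrt (by positivity)
  have hθ0 : 0 ≤ (disagreementCoeff F γ₀).toReal := ENNReal.toReal_nonneg
  rw [le_div_iff₀ (by positivity)]
  have h3 : γ ^ 2 / ε ^ 2 * ((J.card : ℝ) / I.card) ≤ (disagreementCoeff F γ₀).toReal :=
    le_trans (by gcongr) hmain
  rw [hεsq] at h3
  have h4 : γ ^ 2 / (ρ / I.card) * ((J.card : ℝ) / I.card) = γ ^ 2 * J.card / ρ := by
    field_simp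
  rw [h4, div_le_iff₀ hρ] at h3
  calc (J.card : ℝ) * γ₀ ^ 2 ≤ J.card * γ ^ 2 := by gcongr
    _ ≤ _ := by linarith

end Disagreement

/- ### Structure of the collected data -/

section Collected

variable {X : Type u} (A : CISubroutine X) (O : List (WExample X) → X → ℝ) (p : EpochParams)

lemma tau_zero : tau 0 = 0 := rfl

lemma tau_succ (m : ℕ) : tau (m + 1) = 2 ^ (m + 1) := by simp [tau]

lemma tau_mono : Monotone tau := by
  refine monotone_nat_of_le_succ fun m => ?_
  rw [tau_succ]
  unfold tau
  split_ifs
  · simp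
  · exact Nat.pow_le_pow_right (by norm_num) (by omega)

/-- The epoch to which a time belongs. -/
def epochOf (t : ℕ) : ℕ := max 1 (Nat.clog 2 t)

lemma epochOf_eq {m t : ℕ} (h1 : tau m < t) (h2 : t ≤ tau (m + 1)) : epochOf t = m + 1 := by
  unfold epochOf
  rw [tau_succ] at h2
  have h3 : Nat.clog 2 t ≤ m + 1 := Nat.clog_le_of_le_pow h2
  rcases Nat.eq_zero_or_pos m with rfl | hm
  · omega
  · have : m < Nat.clog 2 t := by
      rw [Nat.lt_clog_iff_pow_lt (by norm_num)]
      simpa [tau, hm.ne'] using h1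
    omega

lemma tau_epochOf_lt {t : ℕ} (ht : 1 ≤ t) : tau (epochOf t - 1) < t := by
  unfold epochOf
  rcases Nat.eq_zero_or_pos (max 1 (Nat.clog 2 t) - 1) with h | h
  · rw [h, tau_zero]; omega
  · have : tau (max 1 (Nat.clog 2 t) - 1) = 2 ^ (max 1 (Nat.clog 2 t) - 1) := by
      simp [tau, h.ne']
    rw [this, ← Nat.lt_clog_iff_pow_lt (by norm_num)]
    omega

open Classical in
/-- Indicator that the label of time `t` is queried. -/
def queryInd (z : ℕ → X × Bool) (t : ℕ) : ℝ :=
  if Queried A O p (epochOf t) (collected A O p z (epochOf t - 1)) (z t).1 then 1 else 0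

lemma queryInd_nonneg (z : ℕ → X × Bool) (t : ℕ) : 0 ≤ queryInd A O p z t := by
  unfold queryInd; split_ifs <;> norm_num

lemma queryInd_le_one (z : ℕ → X × Bool) (t : ℕ) : queryInd A O p z t ≤ 1 := by
  unfold queryInd; split_ifs <;> norm_num

/-- A sum over the collected data is a sum over the times whose label is queried. -/
lemma sum_collected (z : ℕ → X × Bool) (φ : X × Bool → ℝ) (m : ℕ) :
    ((collected A O p z m).map φ).sum
      = ∑ t ∈ Finset.Ioc 0 (tau m), queryInd A O p z t * φ (z t) := by
  classical
  induction m with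
  | zero => simp [collected, tau_zero]
  | succ m ih =>
    rw [← Finset.sum_Ioc_consecutive _ (Nat.zero_le (tau m)) (tau_mono (Nat.le_succ m)), ← ih]
    simp only [collected, List.map_append, List.sum_append]
    congr 1
    have h1 : Finset.Ioc (tau m) (tau (m + 1))
        = (List.range' (tau m + 1) (tau (m + 1) - tau m)).toFinset := by
      ext t; simp [List.mem_range'_1]; have := tau_mono (Nat.le_succ m); omega
    have h2 : ∀ t ∈ List.range' (tau m + 1) (tau (m + 1) - tau m), epochOf t = m + 1 := by
      intro t ht
      rw [List.mem_range'_1] at ht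
      exact epochOf_eq (by omega) (by omega)
    rw [h1, List.sum_toFinset _ (List.nodup_range' )]
    generalize List.range' (tau m + 1) (tau (m + 1) - tau m) = l at h2
    induction l with
    | nil => simp
    | cons t l ihl =>
      have h3 := ihl fun s hs => h2 s (List.mem_cons_of_mem _ hs)
      have h4 := h2 t List.mem_cons_self
      simp only [List.map_cons, List.filter_cons, List.sum_cons, ← h3]
      unfold queryInd
      rw [h4, Nat.add_sub_cancel]
      by_cases hq : Queried A O p (m + 1) (collected A O p z m) (z t).1 <;> simp [hq]

lemma length_collected (z : ℕ → X × Bool) (m : ℕ) :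
    ((collected A O p z m).length : ℝ) = ∑ t ∈ Finset.Ioc 0 (tau m), queryInd A O p z t := by
  have := sum_collected A O p z (fun _ => 1) m
  simpa using this

/-- The data collected until the end of an epoch depend on the samples until then only. -/
lemma collected_congr {z z' : ℕ → X × Bool} (m : ℕ) (h : ∀ t ≤ tau m, z t = z' t) :
    collected A O p z m = collected A O p z' m := by
  classical
  induction m with
  | zero => rfl
  | succ m ih =>
    have ih' := ih fun t ht => h t (ht.trans (tau_mono (Nat.le_succ m)))
    simp only [collected]
    rw [ih']
    congr 2
    apply List.map_congr_left
    intro t ht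
    rw [List.mem_range'_1] at ht
    have := tau_mono (Nat.le_succ m)
    exact h t (by omega)

lemma weightedLoss_unitWeights (B : List (X × Bool)) (f : X → ℝ) :
    weightedLoss (unitWeights B) f = (B.map fun q => (f q.1 - labelValue q.2) ^ 2).sum := by
  simp [weightedLoss, unitWeights, Function.comp_def]

end Collected

/- ### Tail bounds from resampling operators -/

section Resampling

variable {Ω : Type*}

/-- One step of resampling: with weight `w z b` the point `z` is replaced by `ψ z b`. -/
def resample (w : Ω → Bool → ℝ≥0∞) (ψ : Ω → Bool → Ω) (g : Ω → ℝ≥0∞) (z : Ω) : ℝ≥0∞ :=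
  w z true * g (ψ z true) + w z false * g (ψ z false)

/-- Successive resampling by the steps `0, …, n - 1`. -/
def iterResample (w : ℕ → Ω → Bool → ℝ≥0∞) (ψ : ℕ → Ω → Bool → Ω) :
    ℕ → (Ω → ℝ≥0∞) → Ω → ℝ≥0∞
  | 0, g => g
  | n + 1, g => iterResample w ψ n (resample (w n) (ψ n) g)

variable {w : ℕ → Ω → Bool → ℝ≥0∞} {ψ : ℕ → Ω → Bool → Ω} {Rel : Ω → Ω → Prop}

lemma iterResample_mono (hrel : ∀ i z b z₀, Rel z₀ z → Rel z₀ (ψ i z b)) (n : ℕ)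
    {g g' : Ω → ℝ≥0∞} {z₀ : Ω} (h : ∀ z, Rel z₀ z → g z ≤ g' z) (z : Ω) (hz : Rel z₀ z) :
    iterResample w ψ n g z ≤ iterResample w ψ n g' z := by
  induction n generalizing g g' with
  | zero => exact h z hz
  | succ n ih =>
    refine ih fun z hz => ?_
    unfold resample
    gcongr <;> exact h _ (hrel _ _ _ _ hz)

lemma iterResample_const_mul (n : ℕ) (c : ℝ≥0∞) (g : Ω → ℝ≥0∞) (z : Ω) :
    iterResample w ψ n (fun z => c * g z) z = c * iterResample w ψ n g z := by
  induction n generalizing g with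
  | zero => rfl
  | succ n ih =>
    simp only [iterResample, ← ih]
    congr 1
    funext z
    unfold resample
    ring

lemma iterResample_sum {ι : Type*} (s : Finset ι) (n : ℕ) (g : ι → Ω → ℝ≥0∞) (z : Ω) :
    iterResample w ψ n (fun z => ∑ k ∈ s, g k z) z = ∑ k ∈ s, iterResample w ψ n (g k) z := by
  induction n generalizing g with
  | zero => rfl
  | succ n ih =>
    simp only [iterResample, ← ih]
    congr 1
    funext z
    unfold resample
    rw [Finset.sum_add_distrib, Finset.mul_sum, Finset.mul_sum]

/-- A supermartingale argument without conditional expectations: the last step averages its own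
factor to at most `1` and leaves the earlier factors unchanged, so the factors are peeled off from
the end. -/
lemma iterResample_exp_le (hrel : ∀ i z b z₀, Rel z₀ z → Rel z₀ (ψ i z b)) (n : ℕ)
    (φ : ℕ → Ω → ℝ) (z₀ : Ω)
    (hφ : ∀ i < n, ∀ z, Rel z₀ z →
      resample (w i) (ψ i) (fun z => ENNReal.ofReal (Real.exp (φ i z))) z ≤ 1 ∧
      ∀ j < i, ∀ b, φ j (ψ i z b) = φ j z) (z : Ω) (hz : Rel z₀ z) :
    iterResample w ψ n (fun z => ENNReal.ofReal (Real.exp (∑ i ∈ Finset.range n, φ i z))) z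
      ≤ 1 := by
  induction n with
  | zero => simp [iterResample]
  | succ n ih =>
    refine le_trans ?_ (ih fun i hi => hφ i (by omega))
    refine iterResample_mono hrel n (fun z hz => ?_) z hz
    obtain ⟨h1, h2⟩ := hφ n (by omega) z hz
    have h3 (b : Bool) : ENNReal.ofReal (Real.exp (∑ i ∈ Finset.range (n + 1), φ i (ψ n z b)))
        = ENNReal.ofReal (Real.exp (∑ i ∈ Finset.range n, φ i z))
          * ENNReal.ofReal (Real.exp (φ n (ψ n z b))) := by
      rw [Finset.sum_range_succ, Real.exp_add, ENNReal.ofReal_mul (Real.exp_pos _).le]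
      rw [Finset.sum_congr rfl fun j hj => h2 j (Finset.mem_range.1 hj) b]
    calc resample (w n) (ψ n)
          (fun z => ENNReal.ofReal (Real.exp (∑ i ∈ Finset.range (n + 1), φ i z))) z
        = ENNReal.ofReal (Real.exp (∑ i ∈ Finset.range n, φ i z)) *
          resample (w n) (ψ n) (fun z => ENNReal.ofReal (Real.exp (φ n z))) z := by
          unfold resample
          simp only [h3]
          ring
      _ ≤ ENNReal.ofReal (Real.exp (∑ i ∈ Finset.range n, φ i z)) * 1 := by gcongr
      _ = _ := mul_one _

variable [MeasurableSpace Ω] {ν : Measure Ω}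

lemma lintegral_iterResample (hw : ∀ i b, Measurable fun z => w i z b)
    (hψ : ∀ i b, Measurable fun z => ψ i z b)
    (hinv : ∀ i, ∀ g : Ω → ℝ≥0∞, Measurable g → ∫⁻ z, resample (w i) (ψ i) g z ∂ν = ∫⁻ z, g z ∂ν)
    (n : ℕ) {g : Ω → ℝ≥0∞} (hg : Measurable g) :
    ∫⁻ z, iterResample w ψ n g z ∂ν = ∫⁻ z, g z ∂ν := by
  induction n generalizing g with
  | zero => rfl
  | succ n ih =>
    simp only [iterResample]
    rw [ih, hinv n g hg]
    exact ((hw n true).mul (hg.comp (hψ n true))).add ((hw n false).mul (hg.comp (hψ n false)))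

/-- A union bound over a family that may depend on everything that is not resampled. -/
lemma measure_le_of_resample [IsProbabilityMeasure ν] (hw : ∀ i b, Measurable fun z => w i z b)
    (hψ : ∀ i b, Measurable fun z => ψ i z b)
    (hinv : ∀ i, ∀ g : Ω → ℝ≥0∞, Measurable g → ∫⁻ z, resample (w i) (ψ i) g z ∂ν = ∫⁻ z, g z ∂ν)
    (hrefl : ∀ z, Rel z z) (hrel : ∀ i z b z₀, Rel z₀ z → Rel z₀ (ψ i z b))
    {S : Set Ω} (hS : MeasurableSet S) (n N : ℕ) (c : ℝ)
    (H : ∀ z₀, ∃ (ι : Type u) (s : Finset ι) (φ : ι → ℕ → Ω → ℝ), s.card ≤ N ∧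
      (∀ z, Rel z₀ z → z ∈ S → ∃ k ∈ s, c ≤ ∑ i ∈ Finset.range n, φ k i z) ∧
      ∀ k ∈ s, ∀ i < n, ∀ z, Rel z₀ z →
        resample (w i) (ψ i) (fun z => ENNReal.ofReal (Real.exp (φ k i z))) z ≤ 1 ∧
        ∀ j < i, ∀ b, φ k j (ψ i z b) = φ k j z) :
    ν S ≤ ENNReal.ofReal (N * Real.exp (-c)) := by
  rw [← lintegral_indicator_one hS,
    ← lintegral_iterResample hw hψ hinv n (measurable_one.indicator hS)]
  -- The bound holds at every starting point, because everything reachable from `z₀` is related to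
  -- it and shares its finite family.
  have key : ∀ z₀, iterResample w ψ n (S.indicator 1) z₀
      ≤ ENNReal.ofReal (N * Real.exp (-c)) := by
    intro z₀
    obtain ⟨ι, s, φ, hs, hS', hφ⟩ := H z₀
    calc iterResample w ψ n (S.indicator 1) z₀
        ≤ iterResample w ψ n (fun z => ∑ k ∈ s, ENNReal.ofReal (Real.exp (-c)) *
            ENNReal.ofReal (Real.exp (∑ i ∈ Finset.range n, φ k i z))) z₀ := by
          refine iterResample_mono hrel n (fun z hz => ?_) z₀ (hrefl z₀)
          by_cases hzS : z ∈ S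
          · obtain ⟨k, hk, hle⟩ := hS' z hz hzS
            rw [Set.indicator_of_mem hzS]
            refine le_trans ?_ (Finset.single_le_sum (f := fun k => ENNReal.ofReal (Real.exp (-c)) *
              ENNReal.ofReal (Real.exp (∑ i ∈ Finset.range n, φ k i z)))
              (fun _ _ => zero_le) hk)
            rw [← ENNReal.ofReal_mul (Real.exp_pos _).le, ← Real.exp_add, Pi.one_apply,
              ENNReal.one_le_ofReal]
            exact Real.one_le_exp (by linarith)
          · rw [Set.indicator_of_notMem hzS]; exact zero_le
      _ = ∑ k ∈ s, ENNReal.ofReal (Real.exp (-c)) * iterResample w ψ n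
            (fun z => ENNReal.ofReal (Real.exp (∑ i ∈ Finset.range n, φ k i z))) z₀ := by
          rw [iterResample_sum]
          exact Finset.sum_congr rfl fun k _ => iterResample_const_mul n _ _ _
      _ ≤ ∑ k ∈ s, ENNReal.ofReal (Real.exp (-c)) * 1 := by
          gcongr with k hk
          exact iterResample_exp_le hrel n (φ k) z₀ (hφ k hk) z₀ (hrefl z₀)
      _ = s.card * ENNReal.ofReal (Real.exp (-c)) := by simp
      _ ≤ N * ENNReal.ofReal (Real.exp (-c)) := by gcongr
      _ = _ := by rw [ENNReal.ofReal_mul (Nat.cast_nonneg N), ENNReal.ofReal_natCast]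
  calc ∫⁻ z, iterResample w ψ n (S.indicator 1) z ∂ν
      ≤ ∫⁻ _, ENNReal.ofReal (N * Real.exp (-c)) ∂ν := lintegral_mono key
    _ = _ := by simp

end Resampling

/- ### Infinite products -/

section InfiniteProduct

variable {E : Type*} [MeasurableSpace E] (D : Measure E) [IsProbabilityMeasure D]

/-- The law of an i.i.d. sequence. -/
abbrev iidLaw : Measure (ℕ → E) := Measure.infinitePi fun _ : ℕ => D

lemma measurable_update_pair (t : ℕ) :
    Measurable fun q : (ℕ → E) × E => Function.update q.1 t q.2 := by
  refine measurable_pi_lambda _ fun s => ?_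
  by_cases h : s = t
  · subst h; simpa using measurable_snd
  · simpa [Function.update_of_ne h] using! (measurable_pi_apply s).comp measurable_fst

/-- Replacing one coordinate by an independent draw preserves the product law; it suffices to check
this on cylinders. -/
lemma map_update_iidLaw (t : ℕ) :
    ((iidLaw D).prod D).map (fun q => Function.update q.1 t q.2) = iidLaw D := by
  refine Measure.eq_infinitePi _ fun s B hB => ?_
  have hm := measurable_update_pair (E := E) t
  rw [Measure.map_apply hm (MeasurableSet.pi s.countable_toSet fun i _ => hB i)]
  have : (fun q : (ℕ → E) × E => Function.update q.1 t q.2) ⁻¹' Set.pi s B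
      = (Set.pi (s.erase t : Finset ℕ) B) ×ˢ (if t ∈ s then B t else Set.univ) := by
    ext ⟨z, e⟩
    simp only [Set.mem_preimage, Set.mem_pi, Finset.mem_coe, Set.mem_prod, Finset.mem_erase]
    constructor
    · intro h
      refine ⟨fun i hi => ?_, ?_⟩
      · simpa [Function.update_of_ne hi.1] using h i hi.2
      · split_ifs with ht
        · simpa using h t ht
        · trivial
    · rintro ⟨h1, h2⟩ i hi
      by_cases hit : i = t
      · subst hit; simpa [hi] using h2
      · simpa [Function.update_of_ne hit] using h1 i ⟨hit, hi⟩
  rw [this, Measure.prod_prod, Measure.infinitePi_pi _ (fun i _ => hB i)]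
  by_cases ht : t ∈ s
  · rw [if_pos ht, Finset.prod_erase_mul _ _ ht]
  · rw [if_neg ht, measure_univ, mul_one, Finset.erase_eq_of_notMem ht]

lemma lintegral_update_iidLaw (t : ℕ) {g : (ℕ → E) → ℝ≥0∞} (hg : Measurable g) :
    ∫⁻ z, ∫⁻ e, g (Function.update z t e) ∂D ∂(iidLaw D) = ∫⁻ z, g z ∂(iidLaw D) := by
  conv_rhs => rw [← map_update_iidLaw D t, lintegral_map hg (measurable_update_pair t)]
  exact (lintegral_prod _ (hg.comp (measurable_update_pair t)).aemeasurable).symm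

lemma lintegral_comp_perm_iidLaw (e : Equiv.Perm ℕ) {g : (ℕ → E) → ℝ≥0∞} (hg : Measurable g) :
    ∫⁻ z, g (fun i => z (e i)) ∂(iidLaw D) = ∫⁻ z, g z ∂(iidLaw D) := by
  have hm : Measurable fun (z : ℕ → E) i => z (e i) :=
    measurable_pi_lambda _ fun i => measurable_pi_apply _
  have h : (iidLaw D).map (fun z i => z (e i)) = iidLaw D := by
    refine Measure.eq_infinitePi _ fun s B hB => ?_
    rw [Measure.map_apply hm (MeasurableSet.pi s.countable_toSet fun i _ => hB i)]
    have : (fun (z : ℕ → E) i => z (e i)) ⁻¹' Set.pi s B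
        = Set.pi (s.map e.toEmbedding : Finset ℕ) (fun j => B (e.symm j)) := by
      ext z
      simp only [Set.mem_preimage, Set.mem_pi, Finset.mem_coe, Finset.mem_map_equiv]
      exact ⟨fun hz i hi => by simpa using hz _ hi, fun hz i hi => by
        simpa using hz (e i) (by simpa using hi)⟩
    rw [this, Measure.infinitePi_pi _ (fun i _ => hB _)]
    simp
  conv_rhs => rw [← h, lintegral_map hg hm]

end InfiniteProduct

/-! ### Redrawing labels and exchanging samples under the i.i.d. law. -/

section LabelLaw

variable {X : Type u} [MeasurableSpace X]

/-- The law of the label given the regression function. -/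
def labelProb (fs : X → ℝ) (x : X) (b : Bool) : ℝ := if b then fs x else 1 - fs x

lemma measurable_labelProb {fs : X → ℝ} (hfs : Measurable fs) (b : Bool) :
    Measurable fun x => labelProb fs x b := by
  cases b <;> simp only [labelProb, Bool.false_eq_true, if_false, if_true] <;> fun_prop

variable (D : Measure (X × Bool)) [IsProbabilityMeasure D] {fs : X → ℝ}

/-- Disintegration along the first coordinate; as `fs` equals the conditional probability almost
everywhere, it may replace it under the integral. -/
lemma lintegral_eq_labelProb (h : fs =ᵐ[D.fst] condProb D) {g : X × Bool → ℝ≥0∞}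
    (hg : Measurable g) :
    ∫⁻ q, g q ∂D = ∫⁻ x, (ENNReal.ofReal (labelProb fs x true) * g (x, true)
      + ENNReal.ofReal (labelProb fs x false) * g (x, false)) ∂D.fst := by
  conv_lhs => rw [← D.disintegrate D.condKernel, Measure.lintegral_compProd hg]
  refine lintegral_congr_ae ?_
  filter_upwards [h] with x hx
  have h1 : D.condKernel x {true} = ENNReal.ofReal (fs x) := by
    rw [hx, condProb, ofReal_measureReal]
  have h2 : D.condKernel x {false} = ENNReal.ofReal (1 - fs x) := by
    have h3 : ({false} : Set Bool) = {true}ᶜ := by ext b; cases b <;> simp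
    rw [h3, hx, condProb, ← probReal_compl_eq_one_sub (measurableSet_singleton _),
      ofReal_measureReal]
  rw [lintegral_fintype, Fintype.sum_bool, h1, h2]
  simp only [labelProb, if_true, Bool.false_eq_true, if_false]
  ring

lemma lintegral_labelProb (h : fs =ᵐ[D.fst] condProb D) (hfs : Measurable fs)
    {g : X × Bool → ℝ≥0∞} (hg : Measurable g) :
    ∫⁻ q, (ENNReal.ofReal (labelProb fs q.1 true) * g (q.1, true)
      + ENNReal.ofReal (labelProb fs q.1 false) * g (q.1, false)) ∂D = ∫⁻ q, g q ∂D := by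
  have hm : Measurable fun x : X => ENNReal.ofReal (labelProb fs x true) * g (x, true)
      + ENNReal.ofReal (labelProb fs x false) * g (x, false) := by
    have h1 := measurable_labelProb hfs true
    have h2 := measurable_labelProb hfs false
    exact (h1.ennreal_ofReal.mul (hg.comp (by fun_prop))).add
      (h2.ennreal_ofReal.mul (hg.comp (by fun_prop)))
  rw [lintegral_eq_labelProb D h hg, Measure.fst, lintegral_map hm measurable_fst]

/-- Resampling the label of one time from its conditional law. -/
lemma lintegral_resample_label (h : fs =ᵐ[D.fst] condProb D) (hfs : Measurable fs) (t : ℕ)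
    {g : (ℕ → X × Bool) → ℝ≥0∞} (hg : Measurable g) :
    ∫⁻ z, resample (fun z b => ENNReal.ofReal (labelProb fs (z t).1 b))
      (fun z b => Function.update z t ((z t).1, b)) g z ∂(iidLaw D) = ∫⁻ z, g z ∂(iidLaw D) := by
  have hm (b : Bool) : Measurable fun z : ℕ → X × Bool => Function.update z t ((z t).1, b) :=
    (measurable_update_pair t).comp (measurable_id.prodMk
      (((measurable_fst.comp (measurable_pi_apply t))).prodMk measurable_const))
  have hl (b : Bool) : Measurable fun z : ℕ → X × Bool =>
      ENNReal.ofReal (labelProb fs (z t).1 b) :=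
    ((measurable_labelProb hfs b).comp
      (measurable_fst.comp (measurable_pi_apply t))).ennreal_ofReal
  rw [← lintegral_update_iidLaw D t hg, ← lintegral_update_iidLaw D t]
  · refine lintegral_congr fun z => ?_
    have := lintegral_labelProb D h hfs (g := fun e => g (Function.update z t e))
      (hg.comp ((measurable_update_pair t).comp (measurable_const.prodMk measurable_id)))
    simpa [resample] using this
  · exact ((hl true).mul (hg.comp (hm true))).add ((hl false).mul (hg.comp (hm false)))

/-- Exchanging the samples of two times with probability one half. -/
lemma lintegral_resample_swap (s t : ℕ) {g : (ℕ → X × Bool) → ℝ≥0∞} (hg : Measurable g) :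
    ∫⁻ z, resample (fun _ _ => 2⁻¹)
      (fun z b => if b then z else fun i => z (Equiv.swap s t i)) g z ∂(iidLaw D)
        = ∫⁻ z, g z ∂(iidLaw D) := by
  have h := lintegral_comp_perm_iidLaw D (Equiv.swap s t) hg
  have hm : Measurable fun (z : ℕ → X × Bool) i => z (Equiv.swap s t i) :=
    measurable_pi_lambda _ fun i => measurable_pi_apply _
  simp only [resample, if_true, Bool.false_eq_true, if_false]
  rw [lintegral_add_left (by fun_prop), lintegral_const_mul _ hg,
    lintegral_const_mul' _ _ (by simp), h, ← add_mul, ENNReal.inv_two_add_inv_two, one_mul]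

end LabelLaw

/- ### The three concentration events -/

section Elementary

/-- For a label with mean `s` the linear term vanishes, and the variance term is at most `g ^ 2 /
16`, exactly what the subtracted square compensates. The estimate used is `exp u ≤ 1 + u + u ^ 2`
for `|u| ≤ 1`. -/
lemma exp_label_le {s g : ℝ} (hs : s ∈ Set.Icc (0 : ℝ) 1) (hg : |g| ≤ 1) :
    s * Real.exp ((2 * g * (1 - s) - g ^ 2 / 2) / 8)
      + (1 - s) * Real.exp ((2 * g * (0 - s) - g ^ 2 / 2) / 8) ≤ 1 := by
  obtain ⟨hg1, hg2⟩ := abs_le.1 hg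
  obtain ⟨hs0, hs1⟩ := hs
  have hsg1 : |g * (1 - s) / 4| ≤ 1 := by rw [abs_le]; constructor <;> nlinarith
  have hsg2 : |-(g * s) / 4| ≤ 1 := by rw [abs_le]; constructor <;> nlinarith
  have h1 := (abs_le.1 (Real.abs_exp_sub_one_sub_id_le hsg1)).2
  have h2 := (abs_le.1 (Real.abs_exp_sub_one_sub_id_le hsg2)).2
  have e1 : (2 * g * (1 - s) - g ^ 2 / 2) / 8 = g * (1 - s) / 4 + -(g ^ 2 / 16) := by ring
  have e2 : (2 * g * (0 - s) - g ^ 2 / 2) / 8 = -(g * s) / 4 + -(g ^ 2 / 16) := by ring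
  rw [e1, e2, Real.exp_add, Real.exp_add, ← mul_assoc, ← mul_assoc, ← add_mul]
  have h3 : s * Real.exp (g * (1 - s) / 4) + (1 - s) * Real.exp (-(g * s) / 4)
      ≤ 1 + g ^ 2 / 16 := by
    have h4 := mul_le_mul_of_nonneg_left h1 hs0
    have h5 := mul_le_mul_of_nonneg_left h2 (sub_nonneg.2 hs1)
    have h6 : s * (g * (1 - s) / 4) ^ 2 + (1 - s) * (-(g * s) / 4) ^ 2
        = g ^ 2 / 16 * (s * (1 - s)) := by ring
    have h7 : g ^ 2 / 16 * (s * (1 - s)) ≤ g ^ 2 / 16 * 1 := by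
      gcongr; nlinarith
    nlinarith
  have h8 : 1 + g ^ 2 / 16 ≤ Real.exp (g ^ 2 / 16) := by
    linarith [Real.add_one_le_exp (g ^ 2 / 16)]
  calc _ ≤ Real.exp (g ^ 2 / 16) * Real.exp (-(g ^ 2 / 16)) := by
        gcongr; exact h3.trans h8
    _ = 1 := by rw [← Real.exp_add]; simp

/-- The factor `2` gives the average over both orders a negative linear term, which absorbs the
quadratic terms because `a` and `b` lie in the unit interval. -/
lemma exp_swap_le {a b : ℝ} (ha : a ∈ Set.Icc (0 : ℝ) 1) (hb : b ∈ Set.Icc (0 : ℝ) 1) :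
    2⁻¹ * Real.exp ((b - 2 * a) / 8) + 2⁻¹ * Real.exp ((a - 2 * b) / 8) ≤ 1 := by
  obtain ⟨ha0, ha1⟩ := ha
  obtain ⟨hb0, hb1⟩ := hb
  have h1 := (abs_le.1 (Real.abs_exp_sub_one_sub_id_le
    (x := (b - 2 * a) / 8) (by rw [abs_le]; constructor <;> linarith))).2
  have h2 := (abs_le.1 (Real.abs_exp_sub_one_sub_id_le
    (x := (a - 2 * b) / 8) (by rw [abs_le]; constructor <;> linarith))).2
  nlinarith [mul_nonneg ha0 hb0, mul_nonneg ha0 (sub_nonneg.2 ha1),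
    mul_nonneg hb0 (sub_nonneg.2 hb1)]

lemma exp_neg_half_le {v : ℝ} (hv : v ∈ Set.Icc (0 : ℝ) 1) : Real.exp (-(v / 2)) ≤ 1 - v / 4 := by
  obtain ⟨h0, h1⟩ := hv
  have := (abs_le.1 (Real.abs_exp_sub_one_sub_id_le
    (x := -(v / 2)) (by rw [abs_le]; constructor <;> linarith))).2
  nlinarith

end Elementary

section Events

variable {X : Type u} {F : Set (X → ℝ)} {O : List (WExample X) → X → ℝ}

/-- The cross term in the expansion of the square loss around `fs`. -/
def noiseTerm (fs f : X → ℝ) (q : X × Bool) : ℝ :=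
  2 * (f q.1 - fs q.1) * (labelValue q.2 - fs q.1)

/-- A strict inequality survives a small perturbation, so a witness can be found in the countable
dense subclass. -/
lemma measurableSet_exists_lt (hP : PointwiseMeasurable F) {Ω : Type*} [MeasurableSpace Ω]
    (V : (X → ℝ) → Ω → ℝ) (hV : ∀ f ∈ F, Measurable (V f))
    (hcont : ∀ z (g : ℕ → X → ℝ) (f : X → ℝ), (∀ x, Tendsto (fun n => g n x) atTop (𝓝 (f x))) →
      Tendsto (fun n => V (g n) z) atTop (𝓝 (V f z))) (c : ℝ) :
    MeasurableSet {z | ∃ f ∈ F, c < V f z} := by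
  obtain ⟨F₀, hF₀, hc, hd⟩ := hP
  have : {z | ∃ f ∈ F, c < V f z} = ⋃ f ∈ F₀, {z | c < V f z} := by
    ext z
    simp only [Set.mem_ofPred_eq, Set.mem_iUnion, exists_prop]
    constructor
    · rintro ⟨f, hf, h⟩
      obtain ⟨g, hg, hgf⟩ := hd f hf
      obtain ⟨n, hn⟩ := ((hcont z g f hgf).eventually (lt_mem_nhds h)).exists
      exact ⟨g n, hg n, hn⟩
    · rintro ⟨f, hf, h⟩
      exact ⟨f, hF₀ hf, h⟩
  rw [this]
  exact MeasurableSet.biUnion hc fun f hf => measurableSet_lt measurable_const (hV f (hF₀ hf))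

variable {A : CISubroutine X} (p : EpochParams)

/-- Predictability: the decision at time `t` uses the earlier samples and the point of time `t`, not
its label. -/
lemma queryInd_congr {z z' : ℕ → X × Bool} {t : ℕ} (ht : 1 ≤ t) (h : ∀ s < t, z s = z' s)
    (hx : (z t).1 = (z' t).1) : queryInd A O p z t = queryInd A O p z' t := by
  unfold queryInd
  rw [hx, collected_congr A O p _ fun s hs => h s (hs.trans_lt (tau_epochOf_lt ht))]

lemma abs_sub_le_one (hF : ∀ f ∈ F, ∀ x, f x ∈ Set.Icc (0 : ℝ) 1)
    {f g : X → ℝ} (hf : f ∈ F) (hg : g ∈ F) (x : X) : |f x - g x| ≤ 1 := by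
  have h1 := hF f hf x
  have h2 := hF g hg x
  rw [abs_le]; constructor <;> linarith [h1.1, h1.2, h2.1, h2.2]

variable [MeasurableSpace X]

lemma measurableSet_queried_collected (hA : MeasurableSubroutine A O) (m : ℕ) :
    MeasurableSet {q : (ℕ → X × Bool) × X | Queried A O p (m + 1) (collected A O p q.1 m) q.2} :=
  (((measurable_collected p hA m).comp measurable_fst).prodMk measurable_snd)
    (measurableSet_queried p hA (m + 1))

lemma measurable_queryInd (hA : MeasurableSubroutine A O) (t : ℕ) :
    Measurable fun z : ℕ → X × Bool => queryInd A O p z t := by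
  unfold queryInd
  refine Measurable.ite ?_ measurable_const measurable_const
  exact ((measurable_collected p hA _).prodMk (measurable_fst.comp (measurable_pi_apply t)))
    (measurableSet_queried p hA (epochOf t))

variable (D : Measure (X × Bool)) [IsProbabilityMeasure D]

open Classical in
/-- Uniform bound on the noise: the cross terms of the square loss over the labels queried in
consecutive epochs are dominated by the squared distances. -/
lemma measure_noise_le (hF : ∀ f ∈ F, ∀ x, f x ∈ Set.Icc (0 : ℝ) 1)
    (hmeas : ∀ f ∈ F, Measurable f) (hP : PointwiseMeasurable F)
    (hA : MeasurableSubroutine A O) {fs : X → ℝ} (hfs : fs ∈ F)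
    (hη : fs =ᵐ[D.fst] condProb D) {d : ℕ} (hd : pseudoDim F ≤ d) (a b : ℕ) {N : ℕ}
    (hN : 1 ≤ N) (hbN : tau b ≤ N) (c : ℝ) :
    iidLaw D {z | ∃ f ∈ F, c < ∑ t ∈ Finset.Ioc (tau a) (tau b), queryInd A O p z t *
        (noiseTerm fs f (z t) - (f (z t).1 - fs (z t).1) ^ 2 / 2)}
      ≤ ENNReal.ofReal ((((N + 1) * N + 1) ^ d : ℕ) * Real.exp (-((c - 3) / 8))) := by
  set I := Finset.Ioc (tau a) (tau b) with hI
  have hI1 : ∀ t ∈ I, 1 ≤ t ∧ t ≤ N := by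
    intro t ht
    rw [hI, Finset.mem_Ioc] at ht
    omega
  have hIcard : (I.card : ℝ) ≤ N := by
    rw [hI, Nat.card_Ioc]
    exact_mod_cast (Nat.sub_le _ _).trans hbN
  have hlab (t : ℕ) (b : Bool) : Measurable fun z : ℕ → X × Bool =>
      ENNReal.ofReal (labelProb fs (z t).1 b) :=
    ((measurable_labelProb (hmeas fs hfs) b).comp
      (measurable_fst.comp (measurable_pi_apply t))).ennreal_ofReal
  have hupd (t : ℕ) (b : Bool) : Measurable fun z : ℕ → X × Bool =>
      Function.update z t ((z t).1, b) :=
    (measurable_update_pair t).comp (measurable_id.prodMk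
      (((measurable_fst.comp (measurable_pi_apply t))).prodMk measurable_const))
  have hx (t : ℕ) : Measurable fun z : ℕ → X × Bool => (z t).1 :=
    measurable_fst.comp (measurable_pi_apply t)
  have hy (t : ℕ) : Measurable fun z : ℕ → X × Bool => labelValue (z t).2 :=
    measurable_labelValue.comp (measurable_snd.comp (measurable_pi_apply t))
  -- Only labels are redrawn. The points stay fixed, so a cover on the points of `z₀` can serve as
  -- the finite family.
  refine measure_le_of_resample (Rel := fun z z' : ℕ → X × Bool => ∀ t, (z t).1 = (z' t).1)
    hlab hupd (fun t g hg => lintegral_resample_label D hη (hmeas fs hfs) t hg) (fun _ _ => rfl)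
    (fun i z b z₀ h t => ?_) ?_ (N + 1) _ _ fun z₀ => ?_
  · by_cases hti : t = i
    · subst hti; simpa using h t
    · simpa [Function.update_of_ne hti] using h t
  · refine measurableSet_exists_lt hP _ (fun f hf => ?_) (fun z g f hgf => ?_) c
    · refine Finset.measurable_sum _ fun t _ => (measurable_queryInd p hA t).mul ?_
      have h1 := (hmeas f hf).comp (hx t)
      have h2 := (hmeas fs hfs).comp (hx t)
      exact (((h1.sub h2).const_mul 2).mul ((hy t).sub h2)).sub
        (((h1.sub h2).pow_const 2).div_const 2)
    · refine tendsto_finsetSum _ fun t _ => Tendsto.const_mul _ ?_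
      have h1 := (hgf (z t).1).sub_const (fs (z t).1)
      exact ((h1.const_mul 2).mul_const _).sub ((h1.pow 2).div_const 2)
  · obtain ⟨G, hGF, hGcard, hG⟩ := exists_cover hF hd
      ((Finset.range (N + 1)).image fun t => (z₀ t).1) hN
    refine ⟨X → ℝ, G, fun f t z => if t ∈ I then queryInd A O p z t *
      (noiseTerm fs f (z t) - (f (z t).1 - fs (z t).1) ^ 2 / 2) / 8 else 0, ?_, ?_, ?_⟩
    · refine hGcard.trans (Nat.pow_le_pow_left ?_ d)
      have : (Finset.image (fun t => (z₀ t).1) (Finset.range (N + 1))).card ≤ N + 1 :=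
        Finset.card_image_le.trans (by simp)
      gcongr
    · rintro z hz ⟨f, hf, hfc⟩
      obtain ⟨g, hg, hfg⟩ := hG f hf
      refine ⟨g, hg, ?_⟩
      have hsum : ∑ t ∈ Finset.range (N + 1), (if t ∈ I then queryInd A O p z t *
          (noiseTerm fs g (z t) - (g (z t).1 - fs (z t).1) ^ 2 / 2) / 8 else 0)
          = (∑ t ∈ I, queryInd A O p z t *
          (noiseTerm fs g (z t) - (g (z t).1 - fs (z t).1) ^ 2 / 2)) / 8 := by
        rw [← Finset.sum_filter, Finset.sum_div]
        refine Finset.sum_congr ?_ fun _ _ => rfl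
        ext t
        simp only [Finset.mem_filter, Finset.mem_range]
        exact ⟨fun h => h.2, fun h => ⟨by have := hI1 t h; omega, h⟩⟩
      rw [hsum]
      have hdiff : ∑ t ∈ I, queryInd A O p z t *
          (noiseTerm fs f (z t) - (f (z t).1 - fs (z t).1) ^ 2 / 2)
          ≤ ∑ t ∈ I, (queryInd A O p z t *
          (noiseTerm fs g (z t) - (g (z t).1 - fs (z t).1) ^ 2 / 2) + 3 * (1 / N)) := by
        refine Finset.sum_le_sum fun t ht => ?_
        have hclose : |f (z t).1 - g (z t).1| ≤ 1 / N := by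
          rw [← hz t]
          exact hfg _ (Finset.mem_image_of_mem _ (Finset.mem_range.2 (by have := hI1 t ht; omega)))
        have hq0 := queryInd_nonneg A O p z t
        have hq1 := queryInd_le_one A O p z t
        have h1 := hF f hf (z t).1
        have h2 := hF g (hGF hg) (z t).1
        have h3 := hF fs hfs (z t).1
        have h4 : labelValue (z t).2 ∈ Set.Icc (0 : ℝ) 1 := by
          rcases labelValue_mem (z t).2 with h | h <;> rw [h] <;> simp
        have hN0 : (0 : ℝ) ≤ 1 / N := by positivity
        -- Passing to the cover costs at most `3 / N` per time, hence at most `3` in total; this is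
        -- the `3` in the exponent.
        have h5 : (noiseTerm fs f (z t) - (f (z t).1 - fs (z t).1) ^ 2 / 2)
            - (noiseTerm fs g (z t) - (g (z t).1 - fs (z t).1) ^ 2 / 2) ≤ 3 * (1 / N) := by
          unfold noiseTerm
          have e : 2 * (f (z t).1 - fs (z t).1) * (labelValue (z t).2 - fs (z t).1)
              - (f (z t).1 - fs (z t).1) ^ 2 / 2
              - (2 * (g (z t).1 - fs (z t).1) * (labelValue (z t).2 - fs (z t).1)
              - (g (z t).1 - fs (z t).1) ^ 2 / 2)
              = (f (z t).1 - g (z t).1) * (2 * (labelValue (z t).2 - fs (z t).1)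
                - (f (z t).1 + g (z t).1 - 2 * fs (z t).1) / 2) := by ring
          rw [e]
          refine (le_abs_self _).trans ?_
          rw [abs_mul, mul_comm 3]
          refine mul_le_mul hclose ?_ (abs_nonneg _) hN0
          rw [abs_le]
          constructor <;> linarith [h1.1, h1.2, h2.1, h2.2, h3.1, h3.2, h4.1, h4.2]
        have h6 : queryInd A O p z t * ((noiseTerm fs f (z t) - (f (z t).1 - fs (z t).1) ^ 2 / 2)
            - (noiseTerm fs g (z t) - (g (z t).1 - fs (z t).1) ^ 2 / 2)) ≤ 3 * (1 / N) := by
          calc _ ≤ queryInd A O p z t * (3 * (1 / N)) := by gcongr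
            _ ≤ 1 * (3 * (1 / N)) := by gcongr
            _ = _ := one_mul _
        linarith
      rw [Finset.sum_add_distrib, Finset.sum_const, nsmul_eq_mul] at hdiff
      have hN' : (0 : ℝ) < N := by exact_mod_cast hN
      have h7 : (I.card : ℝ) * (3 * (1 / N)) ≤ 3 := by
        calc (I.card : ℝ) * (3 * (1 / N)) ≤ N * (3 * (1 / N)) := by gcongr
          _ = 3 := by field_simp
      change (c - 3) / 8 ≤ _
      linarith
    · intro f hf t ht z hz
      have hfF := hGF hf
      refine ⟨?_, ?_⟩
      · have hs := hF fs hfs (z t).1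
        simp only [resample]
        by_cases htI : t ∈ I
        -- Given the past, the query decision is a constant zero-one factor, and only the label of
        -- time `t` is averaged.
        · have hq (b : Bool) : queryInd A O p (Function.update z t ((z t).1, b)) t
              = queryInd A O p z t :=
            queryInd_congr p (hI1 t htI).1
              (fun s hs => Function.update_of_ne hs.ne _ _) (by simp)
          simp only [if_pos htI, hq, Function.update_self, labelProb, if_true,
            Bool.false_eq_true, if_false]
          rw [← ENNReal.ofReal_mul hs.1, ← ENNReal.ofReal_mul (sub_nonneg.2 hs.2),
            ← ENNReal.ofReal_add (mul_nonneg hs.1 (Real.exp_pos _).le)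
              (mul_nonneg (sub_nonneg.2 hs.2) (Real.exp_pos _).le)]
          rw [ENNReal.ofReal_le_one]
          unfold queryInd
          split_ifs
          · simpa [noiseTerm, labelValue] using
              exp_label_le hs (abs_sub_le_one hF hfF hfs (z t).1)
          · simp
        · simp only [if_neg htI, Real.exp_zero, ENNReal.ofReal_one, mul_one, labelProb, if_true,
            Bool.false_eq_true, if_false]
          rw [← ENNReal.ofReal_add hs.1 (sub_nonneg.2 hs.2)]
          simp
      · intro s hst b
        by_cases hsI : s ∈ I
        · simp only [if_pos hsI]
          rw [queryInd_congr p (z' := z) (hI1 s hsI).1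
            (fun r hr => Function.update_of_ne (by omega) _ _)
            (by rw [Function.update_of_ne hst.ne]), Function.update_of_ne hst.ne]
        · simp only [if_neg hsI]

open Classical in
/-- Uniform comparison of the squared distances on two disjoint blocks of samples, for a sampling
rule `Q` that is determined by earlier samples. -/
lemma measure_two_sample_le (hF : ∀ f ∈ F, ∀ x, f x ∈ Set.Icc (0 : ℝ) 1)
    (hmeas : ∀ f ∈ F, Measurable f) (hP : PointwiseMeasurable F)
    {fs : X → ℝ} (hfs : fs ∈ F) {d : ℕ} (hd : pseudoDim F ≤ d)
    (Q : (ℕ → X × Bool) → X → ℝ) (hQm : Measurable fun q : (ℕ → X × Bool) × X => Q q.1 q.2)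
    (hQ : ∀ z x, Q z x ∈ Set.Icc (0 : ℝ) 1) {s₀ a₀ b₀ n N : ℕ}
    (hQs : ∀ z z', (∀ t ≤ s₀, z t = z' t) → Q z = Q z') (ha₀ : s₀ < a₀) (hab : a₀ + n ≤ b₀)
    (hbN : b₀ + n ≤ N + 1) (hN : 1 ≤ N) (c : ℝ) :
    iidLaw D {z | ∃ f ∈ F, c < ∑ i ∈ Finset.range n,
        (Q z (z (b₀ + i)).1 * (f (z (b₀ + i)).1 - fs (z (b₀ + i)).1) ^ 2
          - 2 * (Q z (z (a₀ + i)).1 * (f (z (a₀ + i)).1 - fs (z (a₀ + i)).1) ^ 2))}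
      ≤ ENNReal.ofReal ((((N + 1) * N + 1) ^ d : ℕ) * Real.exp (-((c - 6) / 8))) := by
  have hx (t : ℕ) : Measurable fun z : ℕ → X × Bool => (z t).1 :=
    measurable_fst.comp (measurable_pi_apply t)
  have hsw (i : ℕ) (b : Bool) : Measurable fun z : ℕ → X × Bool =>
      (if b then z else fun j => z (Equiv.swap (a₀ + i % n) (b₀ + i % n) j)) := by
    cases b
    · simpa using measurable_pi_lambda _ fun j => measurable_pi_apply _
    · exact measurable_id
  have hn0 (i : ℕ) (hi : i < n) : i % n = i := Nat.mod_eq_of_lt hi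
  refine measure_le_of_resample (w := fun _ _ _ => 2⁻¹)
    -- Reducing `i` modulo `n` keeps every swap inside the two blocks when `n > 0`, also for the
    -- unused steps `i ≥ n`.
    (ψ := fun i z b => if b then z else fun j => z (Equiv.swap (a₀ + i % n) (b₀ + i % n) j))
    -- Swaps fix the samples that determine `Q` and only permute the points up to time `N`, so a
    -- cover on the points of `z₀` remains valid. The alternative `n = 0` takes care of the case
    -- where the swaps are not confined to the blocks.
    (Rel := fun z z' : ℕ → X × Bool => (∀ t ≤ s₀, z t = z' t) ∧
      ∀ t ≤ N, ∃ s ≤ N, z' t = z s ∨ n = 0)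
    (fun _ _ => measurable_const) hsw
    (fun i g hg => lintegral_resample_swap D _ _ hg) (fun z => ⟨fun _ _ => rfl,
      fun t ht => ⟨t, ht, Or.inl rfl⟩⟩)
    (fun i z b z₀ h => ?_) ?_ n _ _ fun z₀ => ?_
  · rcases Nat.eq_zero_or_pos n with hn | hn
    · refine ⟨fun t ht => ?_, fun t ht => ⟨t, ht, Or.inr hn⟩⟩
      cases b
      · simp only [Bool.false_eq_true, if_false]
        rw [h.1 t ht, Equiv.swap_apply_of_ne_of_ne] <;> omega
      · simpa using h.1 t ht
    · have hin := Nat.mod_lt i hn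
      cases b
      · refine ⟨fun t ht => ?_, fun t ht => ?_⟩
        · simp only [Bool.false_eq_true, if_false]
          rw [h.1 t ht, Equiv.swap_apply_of_ne_of_ne] <;> omega
        · simp only [Bool.false_eq_true, if_false]
          refine h.2 _ ?_
          rw [Equiv.swap_apply_def]
          split_ifs <;> omega
      · simpa using h
  · refine measurableSet_exists_lt hP _ (fun f hf => ?_) (fun z g f hgf => ?_) c
    · refine Finset.measurable_sum _ fun i _ => ?_
      have h1 (t : ℕ) : Measurable fun z : ℕ → X × Bool =>
          Q z (z t).1 * (f (z t).1 - fs (z t).1) ^ 2 :=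
        (hQm.comp (measurable_id.prodMk (hx t))).mul
          ((((hmeas f hf).comp (hx t)).sub ((hmeas fs hfs).comp (hx t))).pow_const 2)
      exact (h1 _).sub ((h1 _).const_mul 2)
    · have h1 (t : ℕ) := (((hgf (z t).1).sub_const (fs (z t).1)).pow 2).const_mul (Q z (z t).1)
      exact tendsto_finsetSum _ fun i _ => (h1 _).sub ((h1 _).const_mul 2)
  · obtain ⟨G, hGF, hGcard, hG⟩ := exists_cover hF hd
      ((Finset.range (N + 1)).image fun t => (z₀ t).1) hN
    refine ⟨X → ℝ, G, fun f i z =>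
      (Q z (z (b₀ + i)).1 * (f (z (b₀ + i)).1 - fs (z (b₀ + i)).1) ^ 2
          - 2 * (Q z (z (a₀ + i)).1 * (f (z (a₀ + i)).1 - fs (z (a₀ + i)).1) ^ 2)) / 8, ?_, ?_, ?_⟩
    · refine hGcard.trans (Nat.pow_le_pow_left ?_ d)
      have : (Finset.image (fun t => (z₀ t).1) (Finset.range (N + 1))).card ≤ N + 1 :=
        Finset.card_image_le.trans (by simp)
      gcongr
    · rintro z hz ⟨f, hf, hfc⟩
      obtain ⟨g, hg, hfg⟩ := hG f hf
      refine ⟨g, hg, ?_⟩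
      have hN' : (0 : ℝ) < N := by exact_mod_cast hN
      have hclose (hn : n ≠ 0) (t : ℕ) (ht : t ≤ N) :
          |Q z (z t).1 * (f (z t).1 - fs (z t).1) ^ 2
            - Q z (z t).1 * (g (z t).1 - fs (z t).1) ^ 2| ≤ 2 * (1 / N) := by
        have hfgt : |f (z t).1 - g (z t).1| ≤ 1 / N := by
          obtain ⟨s, hs, h | h⟩ := hz.2 t ht
          · rw [h]
            exact hfg _ (Finset.mem_image_of_mem _ (Finset.mem_range.2 (by omega)))
          · exact absurd h hn
        have h1 := hF f hf (z t).1
        have h2 := hF g (hGF hg) (z t).1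
        have h3 := hF fs hfs (z t).1
        have h4 := hQ z (z t).1
        have e : Q z (z t).1 * (f (z t).1 - fs (z t).1) ^ 2
            - Q z (z t).1 * (g (z t).1 - fs (z t).1) ^ 2
            = Q z (z t).1 * ((f (z t).1 + g (z t).1 - 2 * fs (z t).1)
              * (f (z t).1 - g (z t).1)) := by ring
        rw [e, abs_mul, abs_mul, abs_of_nonneg h4.1]
        calc Q z (z t).1 * (|f (z t).1 + g (z t).1 - 2 * fs (z t).1| * |f (z t).1 - g (z t).1|)
              ≤ 1 * (2 * (1 / (N : ℝ))) := by
              refine mul_le_mul h4.2 (mul_le_mul ?_ hfgt (abs_nonneg _) (by norm_num))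
                (by positivity) (by norm_num)
              rw [abs_le]
              constructor <;> linarith [h1.1, h1.2, h2.1, h2.2, h3.1, h3.2]
          _ = _ := one_mul _
      have hdiff : ∑ i ∈ Finset.range n,
          (Q z (z (b₀ + i)).1 * (f (z (b₀ + i)).1 - fs (z (b₀ + i)).1) ^ 2
            - 2 * (Q z (z (a₀ + i)).1 * (f (z (a₀ + i)).1 - fs (z (a₀ + i)).1) ^ 2))
          ≤ ∑ i ∈ Finset.range n,
          (Q z (z (b₀ + i)).1 * (g (z (b₀ + i)).1 - fs (z (b₀ + i)).1) ^ 2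
            - 2 * (Q z (z (a₀ + i)).1 * (g (z (a₀ + i)).1 - fs (z (a₀ + i)).1) ^ 2)
            + 6 * (1 / N)) := by
        refine Finset.sum_le_sum fun i hi => ?_
        rw [Finset.mem_range] at hi
        have h1 := abs_le.1 (hclose (by omega) (b₀ + i) (by omega))
        have h2 := abs_le.1 (hclose (by omega) (a₀ + i) (by omega))
        linarith [h1.1, h1.2, h2.1, h2.2]
      rw [Finset.sum_add_distrib, Finset.sum_const, Finset.card_range, nsmul_eq_mul] at hdiff
      have h7 : (n : ℝ) * (6 * (1 / N)) ≤ 6 := by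
        have : (n : ℝ) ≤ N := by exact_mod_cast (by omega : n ≤ N)
        calc (n : ℝ) * (6 * (1 / N)) ≤ N * (6 * (1 / N)) := by gcongr
          _ = 6 := by field_simp
      rw [← Finset.sum_div]
      change (c - 6) / 8 ≤ _
      linarith
    · intro f hf i hi z hz
      have hfF := hGF hf
      have hQeq (k : ℕ) : Q (fun j => z (Equiv.swap (a₀ + k) (b₀ + k) j)) = Q z := by
        refine hQs _ _ fun t ht => ?_
        rw [Equiv.swap_apply_of_ne_of_ne] <;> omega
      refine ⟨?_, ?_⟩
      · have hmem (t : ℕ) : Q z (z t).1 * (f (z t).1 - fs (z t).1) ^ 2 ∈ Set.Icc (0 : ℝ) 1 := by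
          have h1 := hQ z (z t).1
          have h2 := abs_sub_le_one hF hfF hfs (z t).1
          refine ⟨mul_nonneg h1.1 (sq_nonneg _), mul_le_one₀ h1.2 (sq_nonneg _) ?_⟩
          rw [← sq_abs]
          exact pow_le_one₀ (abs_nonneg _) h2
        simp only [resample, if_true, Bool.false_eq_true, if_false, hn0 i hi, hQeq,
          Equiv.swap_apply_left, Equiv.swap_apply_right]
        have e : (2⁻¹ : ℝ≥0∞) = ENNReal.ofReal 2⁻¹ := by
          rw [ENNReal.ofReal_inv_of_pos (by norm_num)]; norm_num
        rw [e, ← ENNReal.ofReal_mul (by norm_num), ← ENNReal.ofReal_mul (by norm_num),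
          ← ENNReal.ofReal_add (by positivity) (by positivity), ENNReal.ofReal_le_one]
        exact exp_swap_le (hmem _) (hmem _)
      · intro j hj b
        cases b
        · simp only [Bool.false_eq_true, if_false, hn0 i hi, hQeq]
          rw [Equiv.swap_apply_of_ne_of_ne (by omega) (by omega),
            Equiv.swap_apply_of_ne_of_ne (by omega) (by omega)]
        · simp

/-- Lower tail of the average of a function that is determined by earlier samples. -/
lemma measure_fresh_sample_le (v : (ℕ → X × Bool) → X → ℝ)
    (hvm : Measurable fun q : (ℕ → X × Bool) × X => v q.1 q.2)
    (hv : ∀ z x, v z x ∈ Set.Icc (0 : ℝ) 1) {s₀ b₀ : ℕ}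
    (hvs : ∀ z z', (∀ t ≤ s₀, z t = z' t) → v z = v z') (hb₀ : s₀ < b₀) (n : ℕ) (c : ℝ) :
    iidLaw D {z | c < n * ∫ q, v z q.1 ∂D - 2 * ∑ i ∈ Finset.range n, v z (z (b₀ + i)).1}
      ≤ ENNReal.ofReal (Real.exp (-(c / 4))) := by
  set U : (ℕ → X × Bool) → ℝ := fun z => ∫ q, v z q.1 ∂D with hU
  have hvm2 : Measurable fun q : (ℕ → X × Bool) × (X × Bool) => v q.1 q.2.1 :=
    hvm.comp (measurable_fst.prodMk (measurable_fst.comp measurable_snd))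
  have hUm : Measurable U := by
    have := (hvm2.stronglyMeasurable).integral_prod_right' (ν := D)
    exact this.measurable
  have hvi (t : ℕ) : Measurable fun z : ℕ → X × Bool => v z (z t).1 :=
    hvm.comp (measurable_id.prodMk (measurable_fst.comp (measurable_pi_apply t)))
  let g : ℕ → (ℕ → X × Bool) → ℝ := fun n z =>
    ∑ i ∈ Finset.range n, (U z - 2 * v z (z (b₀ + i)).1) / 4
  have hgm (n : ℕ) : Measurable (g n) := by
    refine Finset.measurable_sum _ fun i _ => ?_
    exact (hUm.sub ((hvi _).const_mul 2)).div_const 4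
  -- Induction integrates out the latest coordinate, on which `v` does not depend, using `E exp(-V /
  -- 2) ≤ 1 - E V / 4 ≤ exp(-E V / 4)`.
  have hexp : ∫⁻ z, ENNReal.ofReal (Real.exp (g n z)) ∂(iidLaw D) ≤ 1 := by
    clear c
    induction n with
    | zero => simp [g]
    | succ n ih =>
      refine le_trans ?_ ih
      rw [← lintegral_update_iidLaw D (b₀ + n) (hgm (n + 1)).exp.ennreal_ofReal]
      refine lintegral_mono fun z => ?_
      have hvz (e : X × Bool) : v (Function.update z (b₀ + n) e) = v z :=
        hvs _ _ fun t ht => Function.update_of_ne (by omega) _ _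
      have hgz (e : X × Bool) : g (n + 1) (Function.update z (b₀ + n) e)
          = g n z + (U z / 4 - v z e.1 / 2) := by
        simp only [g, Finset.sum_range_succ, hU, hvz, Function.update_self]
        congr 1
        · refine Finset.sum_congr rfl fun i hi => ?_
          rw [Finset.mem_range] at hi
          rw [Function.update_of_ne (by omega)]
        · ring
      have hvz' : Measurable fun e : X × Bool => v z e.1 :=
        hvm2.comp (measurable_const.prodMk measurable_id)
      have hint : Integrable (fun e : X × Bool => v z e.1) D := by
        refine Integrable.of_bound hvz'.aestronglyMeasurable 1 (ae_of_all _ fun e => ?_)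
        rw [Real.norm_eq_abs, abs_of_nonneg (hv z e.1).1]
        exact (hv z e.1).2
      have hint2 : Integrable (fun e : X × Bool => 1 - v z e.1 / 4) D :=
        (integrable_const 1).sub (hint.div_const 4)
      simp only [hgz]
      have hle : ∫⁻ e, ENNReal.ofReal (Real.exp (-(v z e.1 / 2))) ∂D
          ≤ ENNReal.ofReal (Real.exp (-(U z / 4))) := by
        calc ∫⁻ e, ENNReal.ofReal (Real.exp (-(v z e.1 / 2))) ∂D
            ≤ ∫⁻ e, ENNReal.ofReal (1 - v z e.1 / 4) ∂D :=
              lintegral_mono fun e => ENNReal.ofReal_le_ofReal (exp_neg_half_le (hv z e.1))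
          _ = ENNReal.ofReal (∫ e, (1 - v z e.1 / 4) ∂D) := by
              rw [ofReal_integral_eq_lintegral_ofReal hint2]
              exact ae_of_all _ fun e => by
                have := (hv z e.1).2
                simp only [Pi.zero_apply]
                linarith
          _ ≤ _ := by
              apply ENNReal.ofReal_le_ofReal
              rw [integral_sub (integrable_const 1) (hint.div_const 4), integral_div]
              have := Real.add_one_le_exp (-(U z / 4))
              simp only [integral_const, probReal_univ, smul_eq_mul, mul_one]
              change 1 - U z / 4 ≤ _
              linarith
      calc ∫⁻ e, ENNReal.ofReal (Real.exp (g n z + (U z / 4 - v z e.1 / 2))) ∂D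
          = ∫⁻ e, ENNReal.ofReal (Real.exp (g n z + U z / 4)) *
              ENNReal.ofReal (Real.exp (-(v z e.1 / 2))) ∂D := by
            refine lintegral_congr fun e => ?_
            rw [← ENNReal.ofReal_mul (Real.exp_pos _).le, ← Real.exp_add]
            congr 2; ring
        _ = ENNReal.ofReal (Real.exp (g n z + U z / 4)) *
              ∫⁻ e, ENNReal.ofReal (Real.exp (-(v z e.1 / 2))) ∂D :=
            lintegral_const_mul' _ _ ENNReal.ofReal_ne_top
        _ ≤ ENNReal.ofReal (Real.exp (g n z + U z / 4)) *
              ENNReal.ofReal (Real.exp (-(U z / 4))) := by gcongr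
        _ = ENNReal.ofReal (Real.exp (g n z)) := by
            rw [← ENNReal.ofReal_mul (Real.exp_pos _).le, ← Real.exp_add]
            congr 2; ring
  have hsub : {z | c < n * ∫ q, v z q.1 ∂D - 2 * ∑ i ∈ Finset.range n, v z (z (b₀ + i)).1}
      ⊆ {z | ENNReal.ofReal (Real.exp (c / 4)) ≤ ENNReal.ofReal (Real.exp (g n z))} := by
    intro z hz
    apply ENNReal.ofReal_le_ofReal
    apply Real.exp_le_exp.2
    have e : g n z = (n * U z - 2 * ∑ i ∈ Finset.range n, v z (z (b₀ + i)).1) / 4 := by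
      simp only [g]
      rw [← Finset.sum_div, Finset.sum_sub_distrib, Finset.sum_const, Finset.card_range,
        nsmul_eq_mul, Finset.mul_sum]
    rw [e]
    have : c < n * U z - 2 * ∑ i ∈ Finset.range n, v z (z (b₀ + i)).1 := hz
    linarith
  have hpos : ENNReal.ofReal (Real.exp (c / 4)) ≠ 0 := by
    simpa using Real.exp_pos (c / 4)
  calc _ ≤ iidLaw D {z | ENNReal.ofReal (Real.exp (c / 4)) ≤ ENNReal.ofReal (Real.exp (g n z))} :=
        measure_mono hsub
    _ ≤ (∫⁻ z, ENNReal.ofReal (Real.exp (g n z)) ∂(iidLaw D)) / ENNReal.ofReal (Real.exp (c / 4)) :=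
        meas_ge_le_lintegral_div (hgm n).exp.ennreal_ofReal.aemeasurable hpos ENNReal.ofReal_ne_top
    _ ≤ 1 / ENNReal.ofReal (Real.exp (c / 4)) := by gcongr
    _ = ENNReal.ofReal (Real.exp (-(c / 4))) := by
        rw [one_div, ← ENNReal.ofReal_inv_of_pos (Real.exp_pos _), Real.exp_neg]

end Events

/- ### Analysis of a run on which the concentration bounds hold -/

section GoodRun

variable {X : Type u}

/-- A run of the learner in which the noise is dominated by the squared distances. -/
structure GoodRun (F : Set (X → ℝ)) (fs : X → ℝ) (A : CISubroutine X)
    (O : List (WExample X) → X → ℝ) (p : EpochParams) (z : ℕ → X × Bool) : Prop where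
  range : ∀ f ∈ F, ∀ x, f x ∈ Set.Icc (0 : ℝ) 1
  oracle : IsRegressionOracle F O
  certifies : Certifies A F O 1
  strict : StrictBounds A F O
  fs_mem : fs ∈ F
  two_le_M : 2 ≤ p.M
  C_pos : 0 < p.C
  γ_pos : 0 < p.γ
  γ_lt : p.γ < 1 / 2
  noise : ∀ a < p.M, ∀ b < p.M, ∀ f ∈ F, ∑ t ∈ Finset.Ioc (tau a) (tau b),
    queryInd A O p z t * (noiseTerm fs f (z t) - (f (z t).1 - fs (z t).1) ^ 2 / 2) ≤ p.C / 4

variable {F : Set (X → ℝ)} {fs : X → ℝ} {A : CISubroutine X} {O : List (WExample X) → X → ℝ}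
  {p : EpochParams} {z : ℕ → X × Bool}

variable (A O p z) in
/-- The loss on the data collected up to the end of an epoch. -/
def epochLoss (m : ℕ) (f : X → ℝ) : ℝ := weightedLoss (unitWeights (collected A O p z m)) f

variable (A O p z fs) in
/-- Squared distance from `fs` on the labels queried after epoch `a` and until the end of
epoch `b`. -/
def sqDist (a b : ℕ) (f : X → ℝ) : ℝ :=
  ∑ t ∈ Finset.Ioc (tau a) (tau b), queryInd A O p z t * (f (z t).1 - fs (z t).1) ^ 2

lemma sqDist_nonneg (a b : ℕ) (f : X → ℝ) : 0 ≤ sqDist fs A O p z a b f :=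
  Finset.sum_nonneg fun t _ => mul_nonneg (queryInd_nonneg A O p z t) (sq_nonneg _)

lemma sqDist_le_sqDist_zero (a b : ℕ) (f : X → ℝ) :
    sqDist fs A O p z a b f ≤ sqDist fs A O p z 0 b f :=
  Finset.sum_le_sum_of_subset_of_nonneg
    (Finset.Ioc_subset_Ioc_left (by rw [tau_zero]; exact Nat.zero_le _))
    fun t _ _ => mul_nonneg (queryInd_nonneg A O p z t) (sq_nonneg _)

lemma epochLoss_sub (m : ℕ) (f : X → ℝ) :
    epochLoss A O p z m f - epochLoss A O p z m fs
      = ∑ t ∈ Finset.Ioc (tau 0) (tau m), queryInd A O p z t *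
        ((f (z t).1 - fs (z t).1) ^ 2 - noiseTerm fs f (z t)) := by
  unfold epochLoss
  rw [weightedLoss_unitWeights, weightedLoss_unitWeights,
    sum_collected A O p z (fun q => (f q.1 - labelValue q.2) ^ 2),
    sum_collected A O p z (fun q => (fs q.1 - labelValue q.2) ^ 2), ← Finset.sum_sub_distrib,
    tau_zero]
  refine Finset.sum_congr rfl fun t _ => ?_
  unfold noiseTerm
  ring

namespace GoodRun

/-- The noise bound costs half of the squared distance and `C / 4`; the other half survives as a
lower bound on the excess loss. -/
lemma excess_ge (h : GoodRun F fs A O p z) {a b : ℕ} (ha : a < p.M) (hb : b < p.M) {f : X → ℝ}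
    (hf : f ∈ F) :
    sqDist fs A O p z a b f / 2 - p.C / 4 ≤ ∑ t ∈ Finset.Ioc (tau a) (tau b),
      queryInd A O p z t * ((f (z t).1 - fs (z t).1) ^ 2 - noiseTerm fs f (z t)) := by
  have h1 := h.noise a ha b hb f hf
  have h2 : ∑ t ∈ Finset.Ioc (tau a) (tau b),
      queryInd A O p z t * ((f (z t).1 - fs (z t).1) ^ 2 - noiseTerm fs f (z t))
      = sqDist fs A O p z a b f / 2 - ∑ t ∈ Finset.Ioc (tau a) (tau b),
    queryInd A O p z t * (noiseTerm fs f (z t) - (f (z t).1 - fs (z t).1) ^ 2 / 2) := by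
    unfold sqDist
    rw [Finset.sum_div, ← Finset.sum_sub_distrib]
    exact Finset.sum_congr rfl fun t _ => by ring
  linarith

lemma epochLoss_ge (h : GoodRun F fs A O p z) {m : ℕ} (hm : m < p.M) {f : X → ℝ} (hf : f ∈ F) :
    sqDist fs A O p z 0 m f / 2 - p.C / 4 ≤ epochLoss A O p z m f - epochLoss A O p z m fs := by
  rw [epochLoss_sub]
  exact h.excess_ge (by have := h.two_le_M; omega) hm hf

/-- Squared distances are nonnegative, so no function of the class, in particular not the empirical
minimizer, beats `fs` by more than `C / 4`. -/
lemma fs_mem_activeSet (h : GoodRun F fs A O p z) {m : ℕ} (hm : m < p.M) {β : ℝ}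
    (hβ : p.C / 4 ≤ β) : fs ∈ activeSet F O (collected A O p z m) β := by
  refine ⟨h.fs_mem, ?_⟩
  have h1 := h.epochLoss_ge hm (h.oracle (unitWeights (collected A O p z m))).1
  have h2 := sqDist_nonneg (fs := fs) (A := A) (O := O) (p := p) (z := z) 0 m
    (O (unitWeights (collected A O p z m)))
  unfold epochLoss at h1
  unfold empMin
  linarith

lemma sqDist_le (h : GoodRun F fs A O p z) {m : ℕ} (hm : m < p.M) {β : ℝ} {f : X → ℝ}
    (hf : f ∈ activeSet F O (collected A O p z m) β) :
    sqDist fs A O p z 0 m f ≤ 2 * β + p.C / 2 := by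
  have h1 := h.epochLoss_ge hm hf.1
  have h2 := hf.2
  have h3 := h.oracle.le_unitWeights (collected A O p z m) h.fs_mem
  unfold epochLoss at h1
  linarith

lemma beta_ge (h : GoodRun F fs A O p z) {m : ℕ} (hm : m < p.M) : p.C ≤ p.beta (m + 1) := by
  have : (m : ℝ) + 1 ≤ p.M := by exact_mod_cast hm
  unfold EpochParams.beta
  push_cast
  nlinarith [h.C_pos]

lemma beta_succ (p : EpochParams) (m : ℕ) : p.beta (m + 1) + p.C = p.beta m := by
  unfold EpochParams.beta; push_cast; ring

/-- The active sets are nested, with room for the slack. -/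
lemma activeSet_succ (h : GoodRun F fs A O p z) {m : ℕ} (hm : m + 1 < p.M) {f : X → ℝ}
    (hf : f ∈ activeSet F O (collected A O p z (m + 1)) (p.beta (m + 2) + 1 * (p.C / 2))) :
    f ∈ activeSet F O (collected A O p z m) (p.beta (m + 1)) := by
  refine ⟨hf.1, ?_⟩
  have h1 := hf.2
  have h2 := h.oracle.le_unitWeights (collected A O p z (m + 1)) h.fs_mem
  have h3 := (h.fs_mem_activeSet (m := m) (by omega) le_rfl).2
  have h4 := h.excess_ge (a := m) (by omega) hm hf.1
  have h5 := sqDist_nonneg (fs := fs) (A := A) (O := O) (p := p) (z := z) m (m + 1) f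
  have h6 := epochLoss_sub (A := A) (O := O) (p := p) (z := z) (fs := fs) (m + 1) f
  have h7 := epochLoss_sub (A := A) (O := O) (p := p) (z := z) (fs := fs) m f
  rw [← Finset.sum_Ioc_consecutive _ (tau_mono (Nat.zero_le m)) (tau_mono (Nat.le_succ m)),
    ← h7] at h6
  -- The drop `C` of the radius is spent entirely: `C / 2` on the slack, `C / 4` on the noise of the
  -- new epoch, `C / 4` on the suboptimality of `fs` on the old data.
  have h8 := beta_succ p (m + 1)
  unfold epochLoss at h6
  linarith

lemma precision_pos (h : GoodRun F fs A O p z) : 0 < p.precision := by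
  have h1 : (0 : ℝ) < p.M := by exact_mod_cast (by have := h.two_le_M; omega : 0 < p.M)
  have := h.γ_pos
  unfold EpochParams.precision
  positivity

lemma precision_le_one (h : GoodRun F fs A O p z) : p.precision ≤ 1 := by
  have h1 : (2 : ℝ) ≤ p.M := by exact_mod_cast h.two_le_M
  have := h.γ_lt
  unfold EpochParams.precision
  rw [div_le_one (by linarith)]
  linarith

lemma widening_nonneg (h : GoodRun F fs A O p z) {m : ℕ} (hm : m ≤ p.M) : 0 ≤ p.widening m := by
  have : (m : ℝ) ≤ p.M := by exact_mod_cast hm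
  have := h.γ_pos
  unfold EpochParams.widening
  apply div_nonneg (mul_nonneg (by linarith) this.le)
  positivity

lemma widening_succ (h : GoodRun F fs A O p z) (m : ℕ) :
    p.widening (m + 1) + p.precision = p.widening m := by
  have h1 : (0 : ℝ) < p.M := by exact_mod_cast (by have := h.two_le_M; omega : 0 < p.M)
  unfold EpochParams.widening EpochParams.precision
  field_simp
  push_cast
  ring

lemma cert (h : GoodRun F fs A O p z) {m : ℕ} (hm : m < p.M) (x : X) :
    (lcb (activeSet F O (collected A O p z m) (p.beta (m + 1) + 1 * (p.C / 2))) x - p.precision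
        ≤ (A.algLcb x (collected A O p z m) (p.beta (m + 1)) (p.C / 2) p.precision).eval O ∧
      (A.algLcb x (collected A O p z m) (p.beta (m + 1)) (p.C / 2) p.precision).eval O
        ≤ lcb (activeSet F O (collected A O p z m) (p.beta (m + 1))) x) ∧
    (ucb (activeSet F O (collected A O p z m) (p.beta (m + 1))) x
        ≤ (A.algUcb x (collected A O p z m) (p.beta (m + 1)) (p.C / 2) p.precision).eval O ∧
      (A.algUcb x (collected A O p z m) (p.beta (m + 1)) (p.C / 2) p.precision).eval O
        ≤ ucb (activeSet F O (collected A O p z m) (p.beta (m + 1) + 1 * (p.C / 2))) x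
          + p.precision) :=
  h.certifies x (collected A O p z m) (p.beta (m + 1)) (p.C / 2) p.precision
    (h.C_pos.trans_le (h.beta_ge hm)) (half_pos h.C_pos) h.precision_pos h.precision_le_one

lemma mem_Ioo (h : GoodRun F fs A O p z) {m : ℕ} (hm : m < p.M) {f : X → ℝ}
    (hf : f ∈ activeSet F O (collected A O p z m) (p.beta (m + 1))) (x : X) :
    lcbHat A O p (m + 1) (collected A O p z m) x < f x ∧
      f x < ucbHat A O p (m + 1) (collected A O p z m) x := by
  have h1 := h.strict x (collected A O p z m) (p.beta (m + 1)) (p.C / 2) p.precision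
    (h.C_pos.trans_le (h.beta_ge hm)) (half_pos h.C_pos) h.precision_pos h.precision_le_one f hf
  have h2 := h.widening_nonneg (m := m + 1) hm
  unfold lcbHat ucbHat lcbProg ucbProg
  constructor <;> linarith [h1.1, h1.2]

lemma fs_mem_Ioo (h : GoodRun F fs A O p z) {m : ℕ} (hm : m < p.M) (x : X) :
    lcbHat A O p (m + 1) (collected A O p z m) x < fs x ∧
      fs x < ucbHat A O p (m + 1) (collected A O p z m) x :=
  h.mem_Ioo hm (h.fs_mem_activeSet hm (by linarith [h.beta_ge hm, h.C_pos])) x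

lemma empMin_mem_Ioo (h : GoodRun F fs A O p z) {m : ℕ} (hm : m < p.M) (x : X) :
    lcbHat A O p (m + 1) (collected A O p z m) x < empMin O (collected A O p z m) x ∧
      empMin O (collected A O p z m) x < ucbHat A O p (m + 1) (collected A O p z m) x :=
  h.mem_Ioo hm (empMin_mem_activeSet h.oracle _ (by linarith [h.beta_ge hm, h.C_pos])) x

/-- Nested active sets order the exact bounds. The computed ones may overshoot by one precision,
which is exactly how much the widening decreases. -/
lemma bounds_succ (h : GoodRun F fs A O p z) {m : ℕ} (hm : m + 1 < p.M) (x : X) :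
    lcbHat A O p (m + 1) (collected A O p z m) x
        ≤ lcbHat A O p (m + 2) (collected A O p z (m + 1)) x ∧
      ucbHat A O p (m + 2) (collected A O p z (m + 1)) x
        ≤ ucbHat A O p (m + 1) (collected A O p z m) x := by
  have h1 := h.cert (m := m) (by omega) x
  have h2 := h.cert hm x
  have h3 := h.widening_succ (m + 1)
  have hne : (activeSet F O (collected A O p z (m + 1))
      (p.beta (m + 2) + 1 * (p.C / 2))).Nonempty :=
    ⟨_, empMin_mem_activeSet h.oracle _ (by linarith [h.beta_ge hm, h.C_pos])⟩
  have h4 := le_lcb hne (x := x) fun f hf =>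
    lcb_le h.range (activeSet_subset _ _) (h.activeSet_succ hm hf) x
  have h5 := ucb_le hne (x := x) fun f hf =>
    le_ucb h.range (activeSet_subset _ _) (h.activeSet_succ hm hf) x
  unfold lcbHat ucbHat lcbProg ucbProg
  constructor
  · linarith [h1.1.2, h2.1.1]
  · linarith [h1.2.1, h2.2.2]

lemma queried_of_succ (h : GoodRun F fs A O p z) {m : ℕ} (hm : m + 1 < p.M) {x : X}
    (hq : Queried A O p (m + 2) (collected A O p z (m + 1)) x) :
    Queried A O p (m + 1) (collected A O p z m) x := by
  obtain ⟨hl, hu⟩ := h.bounds_succ hm x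
  obtain ⟨⟨h1, h2⟩, h3⟩ := hq
  refine ⟨⟨by linarith, by linarith⟩, ?_⟩
  rw [epochClassifier_ne_none_iff] at h3 ⊢
  refine ⟨by linarith, ?_⟩
  rcases h3.2 with h4 | h4
  · left; linarith
  · right; linarith

lemma nestedRegions (h : GoodRun F fs A O p z) : NestedRegions A O p z := by
  intro m hm1 hm x
  obtain ⟨k, rfl⟩ : ∃ k, m = k + 1 := ⟨m - 1, by omega⟩
  rw [Nat.add_sub_cancel]
  obtain ⟨hl, hu⟩ := h.bounds_succ hm x
  exact ⟨Set.Icc_subset_Icc hl hu, h.queried_of_succ hm⟩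

/-- At a queried point some active function is far from `fs`. -/
lemma exists_far_of_queried (h : GoodRun F fs A O p z) {m : ℕ} (hm : m < p.M) {x : X}
    (hq : Queried A O p (m + 1) (collected A O p z m) x) :
    ∃ f ∈ activeSet F O (collected A O p z m) (p.beta (m + 1) + 1 * (p.C / 2)),
      p.γ / 4 < |f x - fs x| := by
  by_contra! hcon
  have hne : (activeSet F O (collected A O p z m)
      (p.beta (m + 1) + 1 * (p.C / 2))).Nonempty :=
    ⟨_, empMin_mem_activeSet h.oracle _ (by linarith [h.beta_ge hm, h.C_pos])⟩
  have h1 := le_lcb hne (x := x) (v := fs x - p.γ / 4) fun f hf => by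
    have := abs_le.1 (hcon f hf); linarith [this.1]
  have h2 := ucb_le hne (x := x) (v := fs x + p.γ / 4) fun f hf => by
    have := abs_le.1 (hcon f hf); linarith [this.2]
  have h3 := h.cert hm x
  have h4 := h.widening_succ m
  have h5 : p.widening m ≤ p.γ / 4 := by
    have hM : (0 : ℝ) < p.M := by exact_mod_cast (by have := h.two_le_M; omega : 0 < p.M)
    unfold EpochParams.widening
    rw [div_le_div_iff₀ (by positivity) (by norm_num)]
    have := h.γ_pos
    have : 0 ≤ (m : ℝ) * p.γ := by positivity
    nlinarith
  obtain ⟨⟨hl, hu⟩, hc⟩ := hq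
  rw [epochClassifier_ne_none_iff] at hc
  -- The exact bounds are at most `γ / 2` apart, and two widenings with two precisions add at most
  -- `γ / 2`. An interval of length at most `γ` around `1 / 2` would lead to abstention.
  have hw : ucbHat A O p (m + 1) (collected A O p z m) x
      - lcbHat A O p (m + 1) (collected A O p z m) x ≤ p.γ := by
    unfold lcbHat ucbHat lcbProg ucbProg
    linarith [h3.1.1, h3.2.2]
  rcases hc.2 with h6 | h6 <;> linarith

end GoodRun

/-- Comparison of the squared distances in one epoch with those in the two halves of the next. -/
def TwoSampleBound (F : Set (X → ℝ)) (fs : X → ℝ) (p : EpochParams) (z : ℕ → X × Bool)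
    (Q : ℕ → X → ℝ) : Prop :=
  ∀ m, m + 1 < p.M → ∀ r < 2, ∀ f ∈ F,
    ∑ i ∈ Finset.range (tau (m + 1) - tau m),
      (Q m (z (tau (m + 1) + 1 + r * (tau (m + 1) - tau m) + i)).1
          * (f (z (tau (m + 1) + 1 + r * (tau (m + 1) - tau m) + i)).1
            - fs (z (tau (m + 1) + 1 + r * (tau (m + 1) - tau m) + i)).1) ^ 2
        - 2 * (Q m (z (tau m + 1 + i)).1
          * (f (z (tau m + 1 + i)).1 - fs (z (tau m + 1 + i)).1) ^ 2)) ≤ p.C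

open Classical in
variable (A O p) in
/-- Indicator of the sampling region of epoch `m + 1`. -/
def regionInd (m : ℕ) (z : ℕ → X × Bool) (x : X) : ℝ :=
  if Queried A O p (m + 1) (collected A O p z m) x then 1 else 0

lemma sum_range_eq_sum_Ioc (a b : ℕ) (φ : ℕ → ℝ) :
    ∑ i ∈ Finset.range (b - a), φ (a + 1 + i) = ∑ t ∈ Finset.Ioc a b, φ t := by
  have : Finset.Ioc a b = Finset.Ico (a + 1) (b + 1) := by ext; simp
  rw [this, Finset.sum_Ico_eq_sum_range, Nat.add_sub_add_right]

lemma queryInd_eq_regionInd {m t : ℕ} (h1 : tau m < t) (h2 : t ≤ tau (m + 1)) :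
    queryInd A O p z t = regionInd A O p m z (z t).1 := by
  unfold queryInd regionInd
  rw [epochOf_eq h1 h2, Nat.add_sub_cancel]

namespace GoodRun

/-- Squared distances on half of the next epoch, restricted to the current sampling region. -/
lemma sum_block_le (h : GoodRun F fs A O p z)
    (h2 : TwoSampleBound F fs p z fun m => regionInd A O p m z) {m : ℕ} (hm : m + 1 < p.M)
    {r : ℕ} (hr : r < 2) {f : X → ℝ}
    (hf : f ∈ activeSet F O (collected A O p z (m + 1)) (p.beta (m + 2) + 1 * (p.C / 2))) :
    ∑ i ∈ Finset.range (tau (m + 1) - tau m),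
      regionInd A O p m z (z (tau (m + 1) + 1 + r * (tau (m + 1) - tau m) + i)).1
          * (f (z (tau (m + 1) + 1 + r * (tau (m + 1) - tau m) + i)).1
            - fs (z (tau (m + 1) + 1 + r * (tau (m + 1) - tau m) + i)).1) ^ 2
      ≤ 4 * (p.beta (m + 2) + p.C) := by
  have h3 := h2 m hm r hr f hf.1
  rw [Finset.sum_sub_distrib, ← Finset.mul_sum] at h3
  have h4 := h.sqDist_le hm hf
  have h5 := sqDist_le_sqDist_zero (fs := fs) (A := A) (O := O) (p := p) (z := z) m (m + 1) f
  have h6 : ∑ i ∈ Finset.range (tau (m + 1) - tau m), regionInd A O p m z (z (tau m + 1 + i)).1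
          * (f (z (tau m + 1 + i)).1 - fs (z (tau m + 1 + i)).1) ^ 2
      = sqDist fs A O p z m (m + 1) f := by
    rw [sum_range_eq_sum_Ioc _ _ fun t =>
      regionInd A O p m z (z t).1 * (f (z t).1 - fs (z t).1) ^ 2]
    refine Finset.sum_congr rfl fun t ht => ?_
    rw [Finset.mem_Ioc] at ht
    rw [queryInd_eq_regionInd ht.1 ht.2]
  -- Twice the bound `2 (β + C / 2) + C / 2` on the earlier epoch, plus `C`, is `4 (β + C)`.
  linarith

variable [MeasurableSpace X]

open Classical in
/-- Few points of half of the next epoch are in its sampling region. -/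
lemma card_block_le (h : GoodRun F fs A O p z) (hmeas : ∀ f ∈ F, Measurable f)
    (hθ : disagreementCoeff F (p.γ / 4) ≠ ⊤)
    (h2 : TwoSampleBound F fs p z fun m => regionInd A O p m z) {m : ℕ} (hm : m + 1 < p.M)
    {r : ℕ} (hr : r < 2) :
    (((Finset.range (tau (m + 1) - tau m)).filter fun i =>
      Queried A O p (m + 2) (collected A O p z (m + 1))
        (z (tau (m + 1) + 1 + r * (tau (m + 1) - tau m) + i)).1).card : ℝ)
      ≤ (disagreementCoeff F (p.γ / 4)).toReal * (4 * (p.beta (m + 2) + p.C)) / (p.γ / 4) ^ 2 := by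
  have hρ : 0 < 4 * (p.beta (m + 2) + p.C) := by linarith [h.beta_ge hm, h.C_pos]
  -- Squared distances are controlled only inside the previous sampling region, so the other points
  -- are dropped first; by nestedness no queried point is lost.
  refine le_trans ?_ (card_disagreement_le (by linarith [h.γ_pos]) h.fs_mem hmeas hθ
    ((Finset.range (tau (m + 1) - tau m)).filter fun i =>
      Queried A O p (m + 1) (collected A O p z m)
        (z (tau (m + 1) + 1 + r * (tau (m + 1) - tau m) + i)).1)
    (fun i => (z (tau (m + 1) + 1 + r * (tau (m + 1) - tau m) + i)).1) hρ
    (activeSet F O (collected A O p z (m + 1)) (p.beta (m + 2) + 1 * (p.C / 2)))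
    (activeSet_subset _ _) fun f hf => ?_)
  · norm_cast
    refine Finset.card_le_card fun i hi => ?_
    rw [Finset.mem_filter] at hi
    rw [Finset.mem_filter, Finset.mem_filter]
    exact ⟨⟨hi.1, h.queried_of_succ hm hi.2⟩, h.exists_far_of_queried hm hi.2⟩
  · refine le_trans (le_of_eq ?_) (h.sum_block_le h2 hm hr hf)
    rw [Finset.sum_filter]
    refine Finset.sum_congr rfl fun i _ => ?_
    unfold regionInd
    split_ifs <;> simp

/-- Number of labels queried in one epoch. -/
lemma epoch_labels_le (h : GoodRun F fs A O p z) (hmeas : ∀ f ∈ F, Measurable f)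
    (hθ : disagreementCoeff F (p.γ / 4) ≠ ⊤)
    (h2 : TwoSampleBound F fs p z fun m => regionInd A O p m z) {m : ℕ} (hm : m + 1 < p.M) :
    ∑ t ∈ Finset.Ioc (tau (m + 1)) (tau (m + 2)), queryInd A O p z t
      ≤ 128 * (disagreementCoeff F (p.γ / 4)).toReal * p.C * (p.M - m) / p.γ ^ 2 := by
  classical
  have hb (r : ℕ) (hr : r < 2) := h.card_block_le hmeas hθ h2 hm hr
  have hblock (r : ℕ) : ∑ i ∈ Finset.range (tau (m + 1) - tau m),
      regionInd A O p (m + 1) z (z (tau (m + 1) + 1 + r * (tau (m + 1) - tau m) + i)).1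
      = (((Finset.range (tau (m + 1) - tau m)).filter fun i =>
      Queried A O p (m + 2) (collected A O p z (m + 1))
        (z (tau (m + 1) + 1 + r * (tau (m + 1) - tau m) + i)).1).card : ℝ) := by
    unfold regionInd
    rw [Finset.sum_boole]
  -- Two blocks of the length of one epoch cover the next epoch. The first two epochs have equal
  -- length, and for `m = 0` the second block overshoots.
  have hn : tau (m + 2) ≤ tau (m + 1) + 2 * (tau (m + 1) - tau m) := by
    rw [tau_succ, tau_succ]
    unfold tau
    split_ifs with h0
    · subst h0; norm_num
    · have e1 : 2 ^ (m + 1 + 1) = 4 * 2 ^ m := by ring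
      have e2 : 2 ^ (m + 1) = 2 * 2 ^ m := by ring
      omega
  set n := tau (m + 1) - tau m with hn_def
  set φ : ℕ → ℝ := fun t => regionInd A O p (m + 1) z (z t).1 with hφ
  have hφ0 (t : ℕ) : 0 ≤ φ t := by simp only [hφ, regionInd]; split_ifs <;> norm_num
  have h3 : ∑ t ∈ Finset.Ioc (tau (m + 1)) (tau (m + 2)), queryInd A O p z t
      ≤ ∑ t ∈ Finset.Ioc (tau (m + 1)) (tau (m + 1) + 2 * n), φ t := by
    rw [Finset.sum_congr rfl fun t ht => queryInd_eq_regionInd (Finset.mem_Ioc.1 ht).1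
      (Finset.mem_Ioc.1 ht).2]
    exact Finset.sum_le_sum_of_subset_of_nonneg (Finset.Ioc_subset_Ioc_right hn)
      fun t _ _ => hφ0 t
  have h4 : ∑ t ∈ Finset.Ioc (tau (m + 1)) (tau (m + 1) + 2 * n), φ t
      = ∑ i ∈ Finset.range n, φ (tau (m + 1) + 1 + 0 * n + i)
        + ∑ i ∈ Finset.range n, φ (tau (m + 1) + 1 + 1 * n + i) := by
    rw [← sum_range_eq_sum_Ioc, Nat.add_sub_cancel_left, two_mul, Finset.sum_range_add]
    congr 1
    · simp
    · refine Finset.sum_congr rfl fun i _ => ?_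
      congr 1; ring
  have h5 : p.beta (m + 2) + p.C = (p.M - m) * p.C := by
    unfold EpochParams.beta; push_cast; ring
  rw [h4, hblock 0, hblock 1] at h3
  rw [h5] at hb
  have h6 : (disagreementCoeff F (p.γ / 4)).toReal * (4 * ((p.M - m) * p.C)) / (p.γ / 4) ^ 2
      = 64 * (disagreementCoeff F (p.γ / 4)).toReal * p.C * (p.M - m) / p.γ ^ 2 := by
    have := h.γ_pos
    field_simp
    ring
  rw [h6] at hb
  have h7 := hb 0 (by norm_num)
  have h8 := hb 1 (by norm_num)
  calc _ ≤ _ := h3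
    _ ≤ _ := add_le_add h7 h8
    _ = _ := by ring

/-- Label complexity, with the trivial bound for the epochs until `j`. -/
lemma labelCount_le (h : GoodRun F fs A O p z) (hmeas : ∀ f ∈ F, Measurable f)
    (hθ : disagreementCoeff F (p.γ / 4) ≠ ⊤)
    (h2 : TwoSampleBound F fs p z fun m => regionInd A O p m z) {j : ℕ} (hj : 1 ≤ j)
    (hjM : j < p.M) :
    (labelCount A O p z : ℝ) ≤ tau j
      + 128 * (disagreementCoeff F (p.γ / 4)).toReal * p.C * (p.M - j + 1) ^ 2 / p.γ ^ 2 := by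
  set θ := (disagreementCoeff F (p.γ / 4)).toReal with hθ_def
  have hθ0 : 0 ≤ θ := ENNReal.toReal_nonneg
  have hC := h.C_pos
  have hγ := h.γ_pos
  have key : ∀ k, j + k < p.M → ((collected A O p z (j + k)).length : ℝ) ≤ tau j
      + k * (128 * θ * p.C * (p.M - j + 1) / p.γ ^ 2) := by
    intro k
    induction k with
    | zero =>
      intro _
      rw [add_zero, length_collected]
      calc ∑ t ∈ Finset.Ioc 0 (tau j), queryInd A O p z t
          ≤ ∑ t ∈ Finset.Ioc 0 (tau j), (1 : ℝ) :=
            Finset.sum_le_sum fun t _ => queryInd_le_one A O p z t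
        _ = tau j := by simp
        _ ≤ _ := by simp
    | succ k ih =>
      intro hk
      have h3 := ih (by omega)
      obtain ⟨m, hm⟩ : ∃ m, j + k = m + 1 := ⟨j + k - 1, by omega⟩
      have h4 := h.epoch_labels_le hmeas hθ h2 (m := m) (by omega)
      rw [length_collected] at h3 ⊢
      rw [← add_assoc, ← Finset.sum_Ioc_consecutive _ (Nat.zero_le (tau (j + k)))
        (tau_mono (Nat.le_succ _)), Nat.cast_add, Nat.cast_one]
      have h5 : 128 * θ * p.C * (p.M - m) / p.γ ^ 2
          ≤ 128 * θ * p.C * (p.M - j + 1) / p.γ ^ 2 := by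
        have : (j : ℝ) ≤ m + 1 := by exact_mod_cast (by omega : j ≤ m + 1)
        gcongr
        linarith
      rw [hm] at h3 ⊢
      have h6 : (m + 1).succ = m + 2 := rfl
      linarith
  have h3 := key (p.M - 1 - j) (by omega)
  rw [show j + (p.M - 1 - j) = p.M - 1 by omega] at h3
  have h4 : ((p.M - 1 - j : ℕ) : ℝ) ≤ p.M - j + 1 := by
    have : ((p.M - 1 - j : ℕ) : ℝ) + j ≤ p.M := by
      exact_mod_cast (by omega : p.M - 1 - j + j ≤ p.M)
    linarith
  have hMj : (0 : ℝ) ≤ p.M - j + 1 := by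
    have : (j : ℝ) ≤ p.M := by exact_mod_cast hjM.le
    linarith
  calc (labelCount A O p z : ℝ) ≤ _ := h3
    _ ≤ tau j + (p.M - j + 1) * (128 * θ * p.C * (p.M - j + 1) / p.γ ^ 2) := by gcongr
    _ = _ := by ring

/-- The distance of the final empirical minimizer from `fs`, over the final sampling region, on a
block of fresh samples. -/
lemma sum_fresh_le (h : GoodRun F fs A O p z) (hmeas : ∀ f ∈ F, Measurable f)
    (hθ : disagreementCoeff F (p.γ / 4) ≠ ⊤)
    (h2 : TwoSampleBound F fs p z fun m => regionInd A O p m z) {m : ℕ} (hm : p.M = m + 2) :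
    ∑ i ∈ Finset.range (tau (m + 1) - tau m),
      regionInd A O p (m + 1) z (z (tau (m + 1) + 1 + i)).1
          * |empMin O (collected A O p z (m + 1)) (z (tau (m + 1) + 1 + i)).1
            - fs (z (tau (m + 1) + 1 + i)).1|
      ≤ 32 * (disagreementCoeff F (p.γ / 4)).toReal * p.C / p.γ := by
  classical
  set θ := (disagreementCoeff F (p.γ / 4)).toReal with hθ_def
  have hθ1 : 1 ≤ θ := by
    have := ENNReal.toReal_mono hθ (one_le_disagreementCoeff ⟨fs, h.fs_mem⟩)
    simpa using this
  have hγ := h.γ_pos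
  have hC := h.C_pos
  have hM : m + 1 < p.M := by omega
  have hβ : p.beta (m + 2) = p.C := by
    unfold EpochParams.beta; rw [hm]; push_cast; ring
  -- As `M = m + 2`, this block lies after `tau (M - 1)`: the run never uses these samples.
  have h3 := h.card_block_le hmeas hθ h2 hM (r := 0) (by norm_num)
  have h4 := h.sum_block_le h2 hM (r := 0) (by norm_num)
    (empMin_mem_activeSet h.oracle (collected A O p z (m + 1)) (by rw [hβ]; linarith))
  rw [hβ] at h3 h4
  simp only [zero_mul, add_zero] at h3 h4
  set f := empMin O (collected A O p z (m + 1))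
  set x : ℕ → X := fun i => (z (tau (m + 1) + 1 + i)).1 with hx
  set I := (Finset.range (tau (m + 1) - tau m)).filter fun i =>
      Queried A O p (m + 2) (collected A O p z (m + 1)) (x i) with hI
  have h5 : ∑ i ∈ Finset.range (tau (m + 1) - tau m),
      regionInd A O p (m + 1) z (x i) * |f (x i) - fs (x i)| = ∑ i ∈ I, 1 * |f (x i) - fs (x i)| := by
    rw [hI, Finset.sum_filter]
    refine Finset.sum_congr rfl fun i _ => ?_
    unfold regionInd
    split_ifs <;> simp
  have h6 : ∑ i ∈ I, |f (x i) - fs (x i)| ^ 2 ≤ 4 * (p.C + p.C) := by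
    refine le_trans ?_ h4
    rw [hI, Finset.sum_filter]
    refine Finset.sum_le_sum fun i _ => ?_
    unfold regionInd
    by_cases hq : Queried A O p (m + 2) (collected A O p z (m + 1)) (x i)
    · rw [if_pos hq, if_pos (h.queried_of_succ hM hq), sq_abs, one_mul]
    · rw [if_neg hq]
      split_ifs <;> simp [sq_nonneg]
  -- Cauchy-Schwarz with the number of points in the region. Replacing `θ` by `θ ^ 2` afterwards
  -- gives up a factor `√θ`.
  have h7 := Finset.sum_mul_sq_le_sq_mul_sq I (fun _ => (1 : ℝ)) fun i => |f (x i) - fs (x i)|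
  change ∑ i ∈ Finset.range (tau (m + 1) - tau m),
      regionInd A O p (m + 1) z (x i) * |f (x i) - fs (x i)| ≤ _
  rw [h5]
  refine le_of_sq_le_sq ?_ (by positivity)
  calc (∑ i ∈ I, 1 * |f (x i) - fs (x i)|) ^ 2
      ≤ (∑ i ∈ I, (1 : ℝ) ^ 2) * ∑ i ∈ I, |f (x i) - fs (x i)| ^ 2 := h7
    _ = I.card * ∑ i ∈ I, |f (x i) - fs (x i)| ^ 2 := by simp
    _ ≤ (θ * (4 * (p.C + p.C)) / (p.γ / 4) ^ 2) * (4 * (p.C + p.C)) := by gcongr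
    _ = θ * 1024 * p.C ^ 2 / p.γ ^ 2 := by field_simp; ring
    _ ≤ θ ^ 2 * 1024 * p.C ^ 2 / p.γ ^ 2 := by gcongr; nlinarith
    _ = (32 * θ * p.C / p.γ) ^ 2 := by field_simp; ring

end GoodRun

end GoodRun

/- ### Chow excess error -/

section Chow

variable {X : Type u} [MeasurableSpace X] (D : Measure (X × Bool)) [IsProbabilityMeasure D]
  {fs : X → ℝ}

-- Integrating out the label turns each error probability into an integral over the point, so that
-- errors can be compared pointwise.
open Classical in
lemma measureReal_eq_labelProb (h : fs =ᵐ[D.fst] condProb D) (hfs : Measurable fs)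
    (hr : ∀ x, fs x ∈ Set.Icc (0 : ℝ) 1) {S : Set (X × Bool)} (hS : MeasurableSet S) :
    D.real S = ∫ q, (fs q.1 * S.indicator 1 (q.1, true)
      + (1 - fs q.1) * S.indicator 1 (q.1, false)) ∂D ∧
    Integrable (fun q : X × Bool => fs q.1 * S.indicator (1 : X × Bool → ℝ) (q.1, true)
      + (1 - fs q.1) * S.indicator 1 (q.1, false)) D := by
  have hm1 : Measurable (S.indicator (1 : X × Bool → ℝ)) := measurable_one.indicator hS
  have hm : Measurable (fun q : X × Bool => fs q.1 * S.indicator (1 : X × Bool → ℝ) (q.1, true)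
      + (1 - fs q.1) * S.indicator 1 (q.1, false)) := by
    have hf := hfs.comp (measurable_fst : Measurable (Prod.fst : X × Bool → X))
    exact (hf.mul (hm1.comp (by fun_prop))).add ((hf.const_sub 1).mul (hm1.comp (by fun_prop)))
  have hi01 (q : X × Bool) : S.indicator (1 : X × Bool → ℝ) q ∈ Set.Icc (0 : ℝ) 1 := by
    by_cases hq : q ∈ S <;> simp [hq]
  have h0 (q : X × Bool) : 0 ≤ fs q.1 * S.indicator (1 : X × Bool → ℝ) (q.1, true)
      + (1 - fs q.1) * S.indicator 1 (q.1, false) :=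
    add_nonneg (mul_nonneg (hr _).1 (hi01 _).1) (mul_nonneg (sub_nonneg.2 (hr _).2) (hi01 _).1)
  have h1 (q : X × Bool) : fs q.1 * S.indicator (1 : X × Bool → ℝ) (q.1, true)
      + (1 - fs q.1) * S.indicator 1 (q.1, false) ≤ 1 := by
    nlinarith [mul_le_mul_of_nonneg_left (hi01 (q.1, true)).2 (hr q.1).1,
      mul_le_mul_of_nonneg_left (hi01 (q.1, false)).2 (sub_nonneg.2 (hr q.1).2)]
  refine ⟨?_, Integrable.of_bound hm.aestronglyMeasurable 1 (ae_of_all _ fun q => ?_)⟩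
  · rw [integral_eq_lintegral_of_nonneg_ae (ae_of_all _ h0) hm.aestronglyMeasurable,
      measureReal_def, ← lintegral_indicator_one hS,
      ← lintegral_labelProb D h hfs (measurable_one.indicator hS)]
    congr 1
    refine lintegral_congr fun q => ?_
    simp only [labelProb, if_true, Bool.false_eq_true, if_false]
    rw [ENNReal.ofReal_add (mul_nonneg (hr _).1 (hi01 _).1)
      (mul_nonneg (sub_nonneg.2 (hr _).2) (hi01 _).1), ENNReal.ofReal_mul (hr _).1,
      ENNReal.ofReal_mul (sub_nonneg.2 (hr _).2)]
    congr 2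
    · by_cases hq : (q.1, true) ∈ S <;> simp [hq]
    · by_cases hq : (q.1, false) ∈ S <;> simp [hq]
  · rw [Real.norm_eq_abs, abs_of_nonneg (h0 q)]
    exact h1 q

lemma measurable_inducedClassifier {f : X → ℝ} (hf : Measurable f) :
    Measurable (inducedClassifier f) := by
  classical
  unfold inducedClassifier sgnLabel
  exact Measurable.ite (measurableSet_le measurable_const ((hf.const_mul 2).sub_const 1))
    measurable_const measurable_const

/-- Chow excess error from a pointwise bound on the conditional excess error. -/
lemma chow_excess_le (h : fs =ᵐ[D.fst] condProb D) (hfs : Measurable fs)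
    (hr : ∀ x, fs x ∈ Set.Icc (0 : ℝ) 1) {γ : ℝ} {c : X → Option Bool}
    (hc : ∀ o, MeasurableSet {x | c x = o}) {v : X → ℝ}
    (hv : Integrable (fun q : X × Bool => v q.1) D)
    (hnone : ∀ x, c x = none → fs x ∈ Set.Icc (1 / 2 - γ) (1 / 2 + γ)) (hv0 : ∀ x, 0 ≤ v x)
    (htrue : ∀ x, c x = some true → fs x < 1 / 2 → 1 / 2 - fs x ≤ v x)
    (hfalse : ∀ x, c x = some false → 1 / 2 ≤ fs x → fs x - 1 / 2 ≤ v x) :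
    chowError D γ c - stdError D (inducedClassifier fs) ≤ 2 * ∫ q, v q.1 ∂D := by
  have hS1 : MeasurableSet {q : X × Bool | c q.1 ≠ some q.2 ∧ c q.1 ≠ none} := by
    have : {q : X × Bool | c q.1 ≠ some q.2 ∧ c q.1 ≠ none}
        = ({x | c x = some true} ×ˢ {false}) ∪ ({x | c x = some false} ×ˢ {true}) := by
      ext ⟨x, b⟩
      rcases hcx : c x with _ | b' <;> cases b <;> simp [hcx]
    rw [this]
    exact ((hc _).prod (measurableSet_singleton _)).union ((hc _).prod (measurableSet_singleton _))
  have hS2 : MeasurableSet {q : X × Bool | c q.1 = none} := measurable_fst (hc none)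
  have hS3 : MeasurableSet {q : X × Bool | inducedClassifier fs q.1 ≠ q.2} :=
    (measurableSet_eq_fun ((measurable_inducedClassifier hfs).comp measurable_fst)
      measurable_snd).compl
  obtain ⟨e1, i1⟩ := measureReal_eq_labelProb D h hfs hr hS1
  obtain ⟨e2, i2⟩ := measureReal_eq_labelProb D h hfs hr hS2
  obtain ⟨e3, i3⟩ := measureReal_eq_labelProb D h hfs hr hS3
  unfold chowError stdError
  rw [e1, e2, e3, ← integral_const_mul, ← integral_const_mul,
    ← integral_add i1 (i2.const_mul _)]
  refine le_trans (le_of_eq (integral_sub (i1.add (i2.const_mul _)) i3).symm) ?_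
  -- Pointwise, abstaining costs `1 / 2 - γ`, at most `min (fs) (1 - fs)` if `fs` is within `γ` of
  -- `1 / 2`; a wrong sign costs `|2 fs - 1|` in excess.
  refine integral_mono ((i1.add (i2.const_mul _)).sub i3) (hv.const_mul 2) fun q => ?_
  have hq := hr q.1
  have hvq := hv0 q.1
  have n1 := hnone q.1
  have n2 := htrue q.1
  have n3 := hfalse q.1
  by_cases hs : (1 : ℝ) / 2 ≤ fs q.1
  · have hind : inducedClassifier fs q.1 = true := by
      unfold inducedClassifier sgnLabel; rw [if_pos (by linarith)]
    rcases hcq : c q.1 with _ | b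
    · have := n1 hcq
      simp [hcq, hind]
      linarith [this.1, this.2]
    · cases b
      · have := n3 hcq hs
        simp [hcq, hind]
        linarith
      · simp [hcq, hind, hvq]
  · have hs' : fs q.1 < 1 / 2 := not_le.1 hs
    have hind : inducedClassifier fs q.1 = false := by
      unfold inducedClassifier sgnLabel; rw [if_neg (by linarith)]
    rcases hcq : c q.1 with _ | b
    · have := n1 hcq
      simp [hcq, hind]
      linarith [this.1, this.2]
    · cases b
      · simp [hcq, hind, hvq]
      · have := n2 hcq hs'
        simp [hcq, hind]
        linarith

variable {F : Set (X → ℝ)} {A : CISubroutine X} {O : List (WExample X) → X → ℝ}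
  {p : EpochParams} {z : ℕ → X × Bool}

/-- The excess error of the returned classifier is governed by the distance of the empirical
minimizer from `fs` over the final sampling region. -/
lemma GoodRun.chow_excess_le (h : GoodRun F fs A O p z) (hη : fs =ᵐ[D.fst] condProb D)
    (hmeas : ∀ f ∈ F, Measurable f) (hA : MeasurableSubroutine A O) (hO : MeasurableOracle O)
    {m : ℕ} (hm : p.M = m + 1) :
    chowError D p.γ (outputClassifier A O p z) - stdError D (inducedClassifier fs)
      ≤ 2 * ∫ q, regionInd A O p m z q.1 * |empMin O (collected A O p z m) q.1 - fs q.1| ∂D := by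
  classical
  have hfs := hmeas fs h.fs_mem
  have hout : outputClassifier A O p z = epochClassifier A O p (m + 1) (collected A O p z m) := by
    unfold outputClassifier; rw [hm, Nat.add_sub_cancel]
  have hmM : m < p.M := by omega
  set B := collected A O p z m with hB
  have hslice : Measurable fun x : X => (B, x) := measurable_const.prodMk measurable_id
  have hemp : Measurable (empMin O B) := (measurable_empMin hO).comp hslice
  have hne : MeasurableSet {x | epochClassifier A O p (m + 1) B x ≠ none} :=
    hslice (measurableSet_epochClassifier_ne_none p hA (m + 1))
  have hreg : MeasurableSet {x | Queried A O p (m + 1) B x} :=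
    hslice (measurableSet_queried p hA (m + 1))
  have hsome (x : X) (b : Bool) (hb : epochClassifier A O p (m + 1) B x = some b) :
      inducedClassifier (empMin O B) x = b := by
    unfold epochClassifier at hb
    split_ifs at hb
    exact Option.some_injective _ hb
  have hqueried (x : X) (hx : epochClassifier A O p (m + 1) B x ≠ none)
      (h1 : lcbHat A O p (m + 1) B x < 1 / 2) (h2 : 1 / 2 < ucbHat A O p (m + 1) B x) :
      regionInd A O p m z x = 1 := if_pos ⟨⟨h1, h2⟩, hx⟩
  rw [hout]
  refine ActiveAbstain.chow_excess_le D hη hfs (h.range fs h.fs_mem) (γ := p.γ)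
    (v := fun x => regionInd A O p m z x * |empMin O B x - fs x|) ?_ ?_ ?_ ?_ ?_ ?_
  · intro o
    cases o with
    | none =>
      have : {x | epochClassifier A O p (m + 1) B x = none}
          = {x | epochClassifier A O p (m + 1) B x ≠ none}ᶜ := by ext x; simp
      rw [this]
      exact hne.compl
    | some b =>
      have : {x | epochClassifier A O p (m + 1) B x = some b}
          = {x | epochClassifier A O p (m + 1) B x ≠ none} ∩
            inducedClassifier (empMin O B) ⁻¹' {b} := by
        ext x
        simp only [Set.mem_ofPred_eq, Set.mem_inter_iff, Set.mem_preimage, Set.mem_singleton_iff]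
        constructor
        · intro hx
          exact ⟨by rw [hx]; simp, hsome x b hx⟩
        · rintro ⟨hx1, hx2⟩
          obtain ⟨b', hb'⟩ := Option.ne_none_iff_exists'.1 hx1
          rw [hb', ← hx2, hsome x b' hb']
      rw [this]
      exact hne.inter (measurable_inducedClassifier hemp (measurableSet_singleton b))
  · have hmv : Measurable fun x => regionInd A O p m z x * |empMin O B x - fs x| := by
      refine Measurable.mul ?_ (hemp.sub hfs).abs
      unfold regionInd
      exact Measurable.ite hreg measurable_const measurable_const
    refine Integrable.of_bound (hmv.comp measurable_fst).aestronglyMeasurable 1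
      (ae_of_all _ fun q => ?_)
    have h1 := abs_sub_le_one h.range (h.oracle (unitWeights B)).1 h.fs_mem q.1
    change |empMin O B q.1 - fs q.1| ≤ 1 at h1
    rw [Real.norm_eq_abs, abs_mul, abs_abs]
    unfold regionInd
    split_ifs <;> simp [h1]
  · intro x hx
    have h1 := h.fs_mem_Ioo hmM x
    unfold epochClassifier at hx
    split_ifs at hx with hsub
    exact hsub ⟨h1.1.le, h1.2.le⟩
  · intro x
    refine mul_nonneg ?_ (abs_nonneg _)
    unfold regionInd
    split_ifs <;> norm_num
  · intro x hx hlt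
    have h1 := h.fs_mem_Ioo hmM x
    have h2 := h.empMin_mem_Ioo hmM x
    have h3 := hsome x true hx
    have h4 : 1 / 2 ≤ empMin O B x := by
      unfold inducedClassifier sgnLabel at h3
      split_ifs at h3 with h5
      linarith
    -- The empirical minimizer and `fs` lie on different sides of `1 / 2` and strictly inside the
    -- interval, so `1 / 2` is interior. With bounds that are not strict, an empirical minimizer
    -- equal to `1 / 2` could escape the region.
    rw [hqueried x (by rw [hx]; simp) (by linarith [h1.1]) (by linarith [h2.2]), one_mul]
    linarith [le_abs_self (empMin O B x - fs x)]
  · intro x hx hle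
    have h1 := h.fs_mem_Ioo hmM x
    have h2 := h.empMin_mem_Ioo hmM x
    have h3 := hsome x false hx
    have h4 : empMin O B x < 1 / 2 := by
      unfold inducedClassifier sgnLabel at h3
      split_ifs at h3 with h5
      linarith
    rw [hqueried x (by rw [hx]; simp) (by linarith [h2.1]) (by linarith [h1.2]), one_mul]
    linarith [neg_abs_le (empMin O B x - fs x)]

end Chow

/- ### Numerical bounds for the parameters of the learner -/

section Parameters

/-- The standing assumptions on the real parameters. -/
structure ParamBounds (θ d ε γ δ : ℝ) : Prop where
  hθ : 1 ≤ θ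
  hd : 1 ≤ d
  hε : 0 < ε
  hε1 : ε ≤ 1
  hγ : 0 < γ
  hγ2 : γ < 1 / 2
  hδ : 0 < δ
  hδ1 : δ < 1

/-- The number `T` that determines the number of epochs. -/
def sampleSize (θ d ε γ δ : ℝ) : ℝ :=
  10 ^ 8 * (θ * d / (ε * γ)) * Real.log (θ * d / (ε * γ * δ))

/-- The parameters of the run. -/
def runParams (θ d ε γ δ : ℝ) : EpochParams :=
  ⟨⌈Real.logb 2 (sampleSize θ d ε γ δ)⌉₊, 1000 * d * Real.log (sampleSize θ d ε γ δ / δ), γ⟩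

namespace ParamBounds

variable {θ d ε γ δ : ℝ}

lemma ratio_ge (P : ParamBounds θ d ε γ δ) : 1 / γ ≤ θ * d / (ε * γ) := by
  obtain ⟨hθ, hd, hε, hε1, hγ, hγ2, hδ, hδ1⟩ := P
  rw [div_le_div_iff₀ hγ (by positivity)]
  have : 1 ≤ θ * d := by nlinarith
  nlinarith [mul_le_mul this hε1 hε.le (by positivity)]

lemma two_lt_inv (P : ParamBounds θ d ε γ δ) : 2 < 1 / γ := by
  rw [lt_div_iff₀ P.hγ]; linarith [P.hγ2]

lemma two_le_ratio (P : ParamBounds θ d ε γ δ) : 2 ≤ θ * d / (ε * γ) :=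
  P.two_lt_inv.le.trans P.ratio_ge

lemma log_ratio_ge (P : ParamBounds θ d ε γ δ) : 0.69 ≤ Real.log (θ * d / (ε * γ)) := by
  have := Real.log_le_log (by norm_num) P.two_le_ratio
  linarith [Real.log_two_gt_d9]

lemma log_inv_delta_pos (P : ParamBounds θ d ε γ δ) : 0 < Real.log (1 / δ) := by
  apply Real.log_pos
  rw [lt_div_iff₀ P.hδ]; linarith [P.hδ1]

lemma log_eq (P : ParamBounds θ d ε γ δ) : Real.log (θ * d / (ε * γ * δ))
    = Real.log (θ * d / (ε * γ)) + Real.log (1 / δ) := by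
  have h1 := P.two_le_ratio
  have h2 := P.hδ
  rw [← Real.log_mul (by linarith) (by positivity)]
  congr 1
  rw [div_mul_div_comm, mul_one]

lemma log_ge (P : ParamBounds θ d ε γ δ) : 0.69 ≤ Real.log (θ * d / (ε * γ * δ)) := by
  rw [P.log_eq]; linarith [P.log_ratio_ge, P.log_inv_delta_pos]

lemma sampleSize_ge (P : ParamBounds θ d ε γ δ) : 10 ^ 8 ≤ sampleSize θ d ε γ δ := by
  have h1 := P.two_le_ratio
  have h2 := P.log_ge
  unfold sampleSize
  rw [mul_assoc]
  have : 1 ≤ θ * d / (ε * γ) * Real.log (θ * d / (ε * γ * δ)) := by nlinarith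
  linarith

lemma sampleSize_pos (P : ParamBounds θ d ε γ δ) : 0 < sampleSize θ d ε γ δ := by
  linarith [P.sampleSize_ge]

lemma log_const_le : Real.log (10 ^ 8) ≤ 18.5 := by
  have h1 : (10 : ℝ) ^ 8 ≤ 2 ^ (26.6 : ℝ) := by
    -- Fifth powers make the exponent an integer: `10 ^ 40 ≤ 2 ^ 133`.
    have h2 : ((2 : ℝ) ^ (26.6 : ℝ)) ^ (5 : ℕ) = 2 ^ (133 : ℕ) := by
      rw [← Real.rpow_natCast, ← Real.rpow_mul (by norm_num), ← Real.rpow_natCast]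
      norm_num
    by_contra! hlt
    have h3 := pow_lt_pow_left₀ hlt (by positivity) (n := 5) (by norm_num)
    rw [h2] at h3
    norm_num at h3
  have h4 := Real.log_le_log (by norm_num) h1
  rw [Real.log_rpow (by norm_num)] at h4
  linarith [Real.log_two_lt_d9]

lemma log_sampleSize (P : ParamBounds θ d ε γ δ) : Real.log (sampleSize θ d ε γ δ)
    ≤ 18.5 + Real.log (θ * d / (ε * γ)) + Real.log (Real.log (θ * d / (ε * γ * δ))) := by
  have h1 := P.two_le_ratio
  have h2 := P.log_ge
  unfold sampleSize
  rw [Real.log_mul (by positivity) (by linarith), Real.log_mul (by norm_num) (by linarith)]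
  linarith [log_const_le]

lemma log_sampleSize_div_le (P : ParamBounds θ d ε γ δ) :
    Real.log (sampleSize θ d ε γ δ / δ) ≤ 29 * Real.log (θ * d / (ε * γ * δ)) := by
  have h1 := P.log_sampleSize
  have h2 := P.log_ge
  have h3 := Real.log_le_sub_one_of_pos (by linarith : 0 < Real.log (θ * d / (ε * γ * δ)))
  have h4 := P.sampleSize_pos
  rw [div_eq_mul_one_div, Real.log_mul h4.ne' (by have := P.hδ; positivity)]
  have h5 := P.log_eq
  linarith

lemma log_sampleSize_le_div (P : ParamBounds θ d ε γ δ) :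
    Real.log (sampleSize θ d ε γ δ) ≤ Real.log (sampleSize θ d ε γ δ / δ) := by
  rw [div_eq_mul_one_div, Real.log_mul P.sampleSize_pos.ne' (by have := P.hδ; positivity)]
  linarith [P.log_inv_delta_pos]

lemma log_sampleSize_ge (P : ParamBounds θ d ε γ δ) :
    10 ≤ Real.log (sampleSize θ d ε γ δ) := by
  have h1 : (2 : ℝ) ^ 16 ≤ sampleSize θ d ε γ δ := by
    have := P.sampleSize_ge; norm_num at this ⊢; linarith
  have h2 := Real.log_le_log (by norm_num) h1
  rw [Real.log_pow] at h2
  push_cast at h2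
  linarith [Real.log_two_gt_d9]

lemma le_two_pow (P : ParamBounds θ d ε γ δ) :
    sampleSize θ d ε γ δ ≤ 2 ^ (runParams θ d ε γ δ).M := by
  have h : Real.logb 2 (sampleSize θ d ε γ δ) ≤ (runParams θ d ε γ δ).M := Nat.le_ceil _
  rw [Real.logb_le_iff_le_rpow (by norm_num) P.sampleSize_pos] at h
  simpa using h

lemma M_lt (P : ParamBounds θ d ε γ δ) : ((runParams θ d ε γ δ).M : ℝ)
    < Real.logb 2 (sampleSize θ d ε γ δ) + 1 :=
  Nat.ceil_lt_add_one (Real.logb_nonneg (by norm_num) (by linarith [P.sampleSize_ge]))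

lemma two_pow_le (P : ParamBounds θ d ε γ δ) :
    2 ^ (runParams θ d ε γ δ).M ≤ 2 * sampleSize θ d ε γ δ := by
  have h := P.M_lt
  rw [← sub_lt_iff_lt_add, Real.lt_logb_iff_rpow_lt (by norm_num) P.sampleSize_pos,
    Real.rpow_sub (by norm_num), Real.rpow_natCast, Real.rpow_one] at h
  linarith

lemma three_le_M (P : ParamBounds θ d ε γ δ) : 3 ≤ (runParams θ d ε γ δ).M := by
  by_contra! hlt
  have h1 : (2 : ℝ) ^ (runParams θ d ε γ δ).M ≤ 2 ^ 3 :=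
    pow_le_pow_right₀ (by norm_num) hlt.le
  have h2 := P.le_two_pow
  have h3 := P.sampleSize_ge
  norm_num at h1 h3
  linarith

lemma M_le_log (P : ParamBounds θ d ε γ δ) : ((runParams θ d ε γ δ).M : ℝ)
    ≤ 1.45 * Real.log (sampleSize θ d ε γ δ) + 1 := by
  have h1 := P.M_lt
  have h2 : Real.logb 2 (sampleSize θ d ε γ δ) ≤ 1.45 * Real.log (sampleSize θ d ε γ δ) := by
    have h3 := P.log_sampleSize_ge
    rw [Real.logb, div_le_iff₀ (Real.log_pos (by norm_num))]
    nlinarith [Real.log_two_gt_d9]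
  linarith

lemma M_le (P : ParamBounds θ d ε γ δ) : ((runParams θ d ε γ δ).M : ℝ)
    ≤ 44 * Real.log (θ * d / (ε * γ * δ)) := by
  linarith [P.M_le_log, P.log_sampleSize_le_div, P.log_sampleSize_div_le, P.log_ge]

/-- The quantity `Λ` in the bound for inference. -/
def lam (θ d ε γ δ : ℝ) : ℝ :=
  1 + Real.log (θ * d / (ε * γ)) + Real.log (1 + Real.log (1 / δ))

lemma one_le_lam (P : ParamBounds θ d ε γ δ) : 1 ≤ lam θ d ε γ δ := by
  have h1 := P.log_ratio_ge
  have h2 := Real.log_nonneg (by linarith [P.log_inv_delta_pos] : 1 ≤ 1 + Real.log (1 / δ))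
  unfold lam
  linarith

/-- The number of epochs depends on `δ` only through an iterated logarithm, because `δ` enters the
sample size only inside a logarithm. The logarithm of a sum is split by `a + b ≤ (1 + a) (1 + b)`.
-/
lemma M_le_lam (P : ParamBounds θ d ε γ δ) : ((runParams θ d ε γ δ).M : ℝ)
    ≤ 29 * lam θ d ε γ δ := by
  have h1 := P.log_sampleSize
  have h2 := P.log_ratio_ge
  have h3 := P.log_inv_delta_pos
  have h4 : Real.log (Real.log (θ * d / (ε * γ * δ)))
      ≤ Real.log (θ * d / (ε * γ)) + Real.log (1 + Real.log (1 / δ)) := by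
    have h5 : Real.log (θ * d / (ε * γ * δ))
        ≤ (1 + Real.log (θ * d / (ε * γ))) * (1 + Real.log (1 / δ)) := by
      rw [P.log_eq]; nlinarith
    have h6 := Real.log_le_log (by linarith [P.log_ge]) h5
    rw [Real.log_mul (by linarith) (by linarith)] at h6
    have h7 := Real.log_le_sub_one_of_pos (by linarith : 0 < 1 + Real.log (θ * d / (ε * γ)))
    linarith
  have h5 := Real.log_nonneg (by linarith [P.log_inv_delta_pos] : 1 ≤ 1 + Real.log (1 / δ))
  have h6 := P.M_le_log
  unfold lam
  linarith

lemma two_le_lam_div (P : ParamBounds θ d ε γ δ) : 2 ≤ lam θ d ε γ δ / γ := by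
  rw [le_div_iff₀ P.hγ]
  linarith [P.one_le_lam, P.hγ2]

lemma log_lam_div_ge (P : ParamBounds θ d ε γ δ) : 0.69 ≤ Real.log (lam θ d ε γ δ / γ) := by
  have := Real.log_le_log (by norm_num) P.two_le_lam_div
  linarith [Real.log_two_gt_d9]

lemma C_ge (P : ParamBounds θ d ε γ δ) : 1000 ≤ (runParams θ d ε γ δ).C := by
  have h1 : 1 ≤ Real.log (sampleSize θ d ε γ δ / δ) := by
    linarith [P.log_sampleSize_ge, P.log_sampleSize_le_div]
  change 1000 ≤ 1000 * d * Real.log (sampleSize θ d ε γ δ / δ)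
  nlinarith [P.hd]

lemma C_le (P : ParamBounds θ d ε γ δ) :
    (runParams θ d ε γ δ).C ≤ 29000 * d * Real.log (θ * d / (ε * γ * δ)) := by
  change 1000 * d * Real.log (sampleSize θ d ε γ δ / δ) ≤ _
  nlinarith [P.hd, P.log_sampleSize_div_le]

/-- The failure probability is small enough. -/
lemma failure_le (P : ParamBounds θ d ε γ δ) {D N : ℕ} (hD : (D : ℝ) = d)
    (hN : N = 2 ^ (runParams θ d ε γ δ).M) :
    (N : ℝ) ^ 2 * (((((N + 1) * N + 1) ^ D : ℕ) : ℝ)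
      * Real.exp (-(((runParams θ d ε γ δ).C / 4 - 3) / 8))) ≤ 2 * δ := by
  have hNT : (N : ℝ) ≤ 2 * sampleSize θ d ε γ δ := by
    rw [hN]; push_cast; exact P.two_pow_le
  have hN8 : 8 ≤ N := by
    rw [hN]
    calc 8 = 2 ^ 3 := by norm_num
      _ ≤ _ := Nat.pow_le_pow_right (by norm_num) P.three_le_M
  have hN0 : (0 : ℝ) < N := by exact_mod_cast (by omega : 0 < N)
  have hlogN : Real.log N ≤ 2 * Real.log (sampleSize θ d ε γ δ) := by
    have h1 := Real.log_le_log hN0 hNT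
    rw [Real.log_mul (by norm_num) P.sampleSize_pos.ne'] at h1
    linarith [P.log_sampleSize_ge, Real.log_two_lt_d9]
  have hN3 : (N + 1) * N + 1 ≤ N ^ 3 := by nlinarith [mul_le_mul hN8 hN8 (by omega) (by omega)]
  have hpow : ((((N + 1) * N + 1) ^ D : ℕ) : ℝ) ≤ (N : ℝ) ^ (3 * D) := by
    rw [pow_mul]
    exact_mod_cast Nat.pow_le_pow_left hN3 D
  have hexp : (N : ℝ) ^ 2 * (N : ℝ) ^ (3 * D) = Real.exp ((2 + 3 * d) * Real.log N) := by
    rw [← pow_add, ← hD]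
    have : (2 + 3 * (D : ℝ)) * Real.log N = ((2 + 3 * D : ℕ) : ℝ) * Real.log N := by push_cast; ring
    rw [this, Real.exp_nat_mul, Real.exp_log hN0]
  have hδ : δ = Real.exp (-Real.log (1 / δ)) := by
    rw [one_div, Real.log_inv, neg_neg, Real.exp_log P.hδ]
  calc (N : ℝ) ^ 2 * (((((N + 1) * N + 1) ^ D : ℕ) : ℝ)
      * Real.exp (-(((runParams θ d ε γ δ).C / 4 - 3) / 8)))
      ≤ (N : ℝ) ^ 2 * ((N : ℝ) ^ (3 * D)
        * Real.exp (-(((runParams θ d ε γ δ).C / 4 - 3) / 8))) := by gcongr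
    _ = Real.exp ((2 + 3 * d) * Real.log N - (((runParams θ d ε γ δ).C / 4 - 3) / 8)) := by
        rw [← mul_assoc, hexp, ← Real.exp_add]; congr 1
    _ ≤ Real.exp (-Real.log (1 / δ)) := by
        -- The union bound contributes at most `(4 + 6 d) log T`, while `C / 32` exceeds `31 d (log
        -- T + log (1 / δ))`.
        apply Real.exp_le_exp.2
        have h1 : Real.log (sampleSize θ d ε γ δ / δ)
            = Real.log (sampleSize θ d ε γ δ) + Real.log (1 / δ) := by
          rw [div_eq_mul_one_div,
            Real.log_mul P.sampleSize_pos.ne' (by have := P.hδ; positivity)]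
        have h2 : (runParams θ d ε γ δ).C
            = 1000 * d * (Real.log (sampleSize θ d ε γ δ) + Real.log (1 / δ)) := by
          rw [← h1]; rfl
        rw [h2]
        have h3 := P.log_sampleSize_ge
        have h4 := P.log_inv_delta_pos
        have h5 := P.hd
        have h6 : (2 + 3 * d) * Real.log N
            ≤ (2 + 3 * d) * (2 * Real.log (sampleSize θ d ε γ δ)) := by gcongr
        nlinarith [mul_nonneg (sub_nonneg.2 h5) (by linarith : 0 ≤ Real.log (sampleSize θ d ε γ δ)),
          mul_nonneg (sub_nonneg.2 h5) h4.le]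
    _ = δ := hδ.symm
    _ ≤ 2 * δ := by linarith [P.hδ]

/-- The bound on the excess error is small enough. -/
lemma excess_le (P : ParamBounds θ d ε γ δ) {n : ℕ} (hn : 2 ^ (runParams θ d ε γ δ).M = 4 * n)
    {I : ℝ} (hI : n * I ≤ 2 * (32 * θ * (runParams θ d ε γ δ).C / γ) + (runParams θ d ε γ δ).C) :
    2 * I ≤ ε := by
  have hγ := P.hγ
  have hε := P.hε
  have hC := P.C_ge
  have h1 : (runParams θ d ε γ δ).C ≤ θ * (runParams θ d ε γ δ).C / γ := by
    rw [le_div_iff₀ hγ]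
    nlinarith [P.hθ, P.hγ2]
  have h2 : n * I ≤ 65 * (θ * (runParams θ d ε γ δ).C / γ) := by
    have e : 2 * (32 * θ * (runParams θ d ε γ δ).C / γ)
        = 64 * (θ * (runParams θ d ε γ δ).C / γ) := by ring
    linarith
  have h3 : sampleSize θ d ε γ δ ≤ 4 * n := by
    have := P.le_two_pow
    have e : (2 : ℝ) ^ (runParams θ d ε γ δ).M = 4 * n := by exact_mod_cast hn
    rwa [e] at this
  have h4 : θ * (runParams θ d ε γ δ).C / γ
      ≤ θ * (29000 * d * Real.log (θ * d / (ε * γ * δ))) / γ := by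
    have := P.C_le
    have := P.hθ
    gcongr
  have h5 : sampleSize θ d ε γ δ * ε
      = 10 ^ 8 * (θ * d * Real.log (θ * d / (ε * γ * δ)) / γ) := by
    unfold sampleSize; field_simp
  have h6 : θ * (29000 * d * Real.log (θ * d / (ε * γ * δ))) / γ
      = 29000 * (θ * d * Real.log (θ * d / (ε * γ * δ)) / γ) := by ring
  have h7 : 0 ≤ θ * d * Real.log (θ * d / (ε * γ * δ)) / γ := by
    have := P.log_ge
    have := P.hθ
    have := P.hd
    positivity
  -- With `Y = θ d log(θ d / (ε γ δ)) / γ` one has `n I ≤ 65 * 29000 Y` and `10 ^ 8 Y ≤ 4 n ε`; the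
  -- claim reduces to `8 * 65 * 29000 < 10 ^ 8`.
  by_contra! hcon
  have hnpos : (0 : ℝ) < n := by linarith [P.sampleSize_pos]
  have h8 : n * ε < n * (2 * I) := by gcongr
  have h9 : sampleSize θ d ε γ δ * ε ≤ 4 * n * ε := by gcongr
  have h10 : 0 < sampleSize θ d ε γ δ * ε := mul_pos P.sampleSize_pos hε
  rw [h5] at h9 h10
  norm_num at h9 h10
  linarith

/-- A cut-off epoch for which the bound on the label complexity is small enough. -/
lemma exists_cutoff (P : ParamBounds θ d ε γ δ) : ∃ j, 1 ≤ j ∧ j < (runParams θ d ε γ δ).M ∧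
    (tau j : ℝ) + 128 * θ * (runParams θ d ε γ δ).C * ((runParams θ d ε γ δ).M - j + 1) ^ 2 / γ ^ 2
      ≤ 10 ^ 10 * (θ * d / γ ^ 2) * Real.log (θ * d / (ε * γ)) ^ 2
        * Real.log (θ * d / (ε * γ * δ)) := by
  set M := (runParams θ d ε γ δ).M with hM
  set K := θ * d / (ε * γ) with hK
  set ℓ := Real.log (θ * d / (ε * γ * δ)) with hℓ
  have hM3 : 3 ≤ M := P.three_le_M
  have hK2 : 2 ≤ K := P.two_le_ratio
  have hlogK : 0.69 ≤ Real.log K := P.log_ratio_ge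
  have hℓ1 : 0.69 ≤ ℓ := P.log_ge
  set W := ⌈Real.logb 2 K⌉₊ with hW
  have hlogb1 : 1 ≤ Real.logb 2 K := by
    rw [Real.le_logb_iff_rpow_le (by norm_num) (by linarith)]; simpa using hK2
  have hW1 : 1 ≤ W := Nat.one_le_ceil_iff.2 (by linarith)
  have hWlt : (W : ℝ) < Real.logb 2 K + 1 := Nat.ceil_lt_add_one (by linarith)
  have hWK : K ≤ 2 ^ W := by
    have h : Real.logb 2 K ≤ W := Nat.le_ceil _
    rw [Real.logb_le_iff_le_rpow (by norm_num) (by linarith)] at h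
    simpa using h
  have hlogb : Real.logb 2 K ≤ 1.45 * Real.log K := by
    rw [Real.logb, div_le_iff₀ (Real.log_pos (by norm_num))]
    nlinarith [Real.log_two_gt_d9]
  -- Only `W`, about `log₂ (θ d / (ε γ))`, epochs remain after the cut-off, whereas `2 ^ (M - W)` is
  -- at most `2 T / K`, of order `log (θ d / (ε γ δ))`.
  refine ⟨max 1 (M - W), le_max_left _ _, by omega, ?_⟩
  have hj : (M : ℝ) - (max 1 (M - W) : ℕ) + 1 ≤ 5 * Real.log K := by
    have h1 : M ≤ max 1 (M - W) + W := by omega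
    have h2 : (M : ℝ) ≤ (max 1 (M - W) : ℕ) + W := by exact_mod_cast h1
    linarith
  have hj0 : (0 : ℝ) ≤ (M : ℝ) - (max 1 (M - W) : ℕ) + 1 := by
    have h1 : max 1 (M - W) ≤ M := by omega
    have h2 : ((max 1 (M - W) : ℕ) : ℝ) ≤ M := by exact_mod_cast h1
    linarith
  have htau : (tau (max 1 (M - W)) : ℝ) ≤ 2 + 2 * 10 ^ 8 * ℓ := by
    have h1 : tau (max 1 (M - W)) = 2 ^ max 1 (M - W) := by
      unfold tau; rw [if_neg (by omega)]
    rw [h1]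
    push_cast
    rcases le_total (M - W) 1 with h | h
    · rw [max_eq_left h]; linarith
    · rw [max_eq_right h]
      have h2 : (2 : ℝ) ^ (M - W) * 2 ^ W = 2 ^ M := by
        rw [← pow_add]; congr 1; omega
      have h3 : (2 : ℝ) ^ M ≤ 2 * sampleSize θ d ε γ δ := P.two_pow_le
      have h4 : sampleSize θ d ε γ δ = 10 ^ 8 * K * ℓ := rfl
      have h5 : (2 : ℝ) ^ (M - W) * K ≤ (2 * 10 ^ 8 * ℓ) * K := by
        calc (2 : ℝ) ^ (M - W) * K ≤ 2 ^ (M - W) * 2 ^ W := by gcongr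
          _ ≤ 2 * sampleSize θ d ε γ δ := by rw [h2]; exact h3
          _ = _ := by rw [h4]; ring
      have h6 := le_of_mul_le_mul_right h5 (by linarith)
      linarith
  have hC : (runParams θ d ε γ δ).C ≤ 29000 * d * ℓ := P.C_le
  have hC0 : 0 ≤ (runParams θ d ε γ δ).C := by linarith [P.C_ge]
  have hθ := P.hθ
  have hd := P.hd
  have hγ := P.hγ
  have hR : 1 ≤ θ * d / γ ^ 2 := by
    rw [le_div_iff₀ (by positivity)]
    have := P.hγ2
    have h1 : γ ^ 2 ≤ 1 := by nlinarith
    have h2 : 1 ≤ θ * d := by nlinarith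
    linarith
  have hL2 : 0.4 ≤ Real.log K ^ 2 := by nlinarith
  have hmain : 128 * θ * (runParams θ d ε γ δ).C * ((M : ℝ) - (max 1 (M - W) : ℕ) + 1) ^ 2 / γ ^ 2
      ≤ 128 * 29000 * 25 * ((θ * d / γ ^ 2) * Real.log K ^ 2 * ℓ) := by
    calc _ ≤ 128 * θ * (29000 * d * ℓ) * (5 * Real.log K) ^ 2 / γ ^ 2 := by gcongr
      _ = _ := by ring
  have hlow : 0.4 * ℓ ≤ (θ * d / γ ^ 2) * Real.log K ^ 2 * ℓ := by
    have : 0.4 ≤ (θ * d / γ ^ 2) * Real.log K ^ 2 := by nlinarith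
    nlinarith
  have e : 10 ^ 10 * (θ * d / γ ^ 2) * Real.log K ^ 2 * ℓ
      = 10 ^ 10 * ((θ * d / γ ^ 2) * Real.log K ^ 2 * ℓ) := by ring
  rw [e]
  set Y := (θ * d / γ ^ 2) * Real.log K ^ 2 * ℓ
  norm_num at htau hmain ⊢
  linarith

end ParamBounds

end Parameters

/- ### Oracle calls -/

section Calls

variable {X : Type u} {O : List (WExample X) → X → ℝ} {θ d ε γ δ : ℝ}

lemma tau_sub_one_le (M : ℕ) : tau (M - 1) ≤ 2 ^ M := by
  unfold tau
  split_ifs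
  · exact Nat.zero_le _
  · exact Nat.pow_le_pow_right (by norm_num) (Nat.sub_le _ _)

lemma totalCalls_le (A : CISubroutine X) (p : EpochParams) (z : ℕ → X × Bool) {c : ℝ}
    (hc0 : 0 ≤ c)
    (hc : ∀ m B x, 1 ≤ m → m ≤ p.M → (pointCalls A O p m B x : ℝ) ≤ c) :
    (totalCalls A O p z : ℝ) ≤ p.M + 2 ^ p.M * c := by
  have key : ∀ n : ℕ, n ≤ p.M → ∑ m ∈ Finset.Icc 1 n, ∑ t ∈ Finset.Icc (tau (m - 1) + 1) (tau m),
      (pointCalls A O p m (collected A O p z (m - 1)) (z t).1 : ℝ) ≤ tau n * c := by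
    intro n
    induction n with
    | zero => intro _; simp [tau_zero]
    | succ n ih =>
      intro hn
      rw [Finset.sum_Icc_succ_top (by omega), Nat.add_sub_cancel]
      have h1 : ∑ t ∈ Finset.Icc (tau n + 1) (tau (n + 1)),
          (pointCalls A O p (n + 1) (collected A O p z n) (z t).1 : ℝ)
          ≤ ∑ t ∈ Finset.Icc (tau n + 1) (tau (n + 1)), c :=
        Finset.sum_le_sum fun t _ => hc _ _ _ (by omega) hn
      rw [Finset.sum_const, Nat.card_Icc, nsmul_eq_mul, Nat.add_sub_add_right,
        Nat.cast_sub (tau_mono (Nat.le_succ n))] at h1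
      have h2 := ih (by omega)
      linarith
  have h1 := key (p.M - 1) (Nat.sub_le _ _)
  have h2 : (tau (p.M - 1) : ℝ) ≤ 2 ^ p.M := by exact_mod_cast tau_sub_one_le p.M
  unfold totalCalls
  push_cast
  have h3 : (tau (p.M - 1) : ℝ) * c ≤ 2 ^ p.M * c := by gcongr
  linarith

namespace ParamBounds

lemma precision_eq : (runParams θ d ε γ δ).precision = γ / (4 * (runParams θ d ε γ δ).M) := rfl

/-- The ratio of radius to slack is `2 (M - m + 1)`. It is constant in the last epoch, where
evaluation takes only of order `M / γ` calls. -/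
lemma grid_pointCalls_le (P : ParamBounds θ d ε γ δ) {m : ℕ} (hm : m ≤ (runParams θ d ε γ δ).M)
    (B : List (X × Bool)) (x : X) :
    (pointCalls (gridSubroutine X) O (runParams θ d ε γ δ) m B x : ℝ)
      ≤ 2 * ((3 + 2 * ((runParams θ d ε γ δ).M - m + 1))
        * (4 * (runParams θ d ε γ δ).M / γ) + 2) := by
  set p := runParams θ d ε γ δ with hp
  have hC : 0 < p.C := by linarith [P.C_ge]
  have hM : (3 : ℝ) ≤ p.M := by exact_mod_cast P.three_le_M
  have hγ := P.hγ
  have hmM : (m : ℝ) ≤ p.M := by exact_mod_cast hm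
  have hβ : 0 < p.beta m := by
    unfold EpochParams.beta
    exact mul_pos (by linarith) hC
  have hα : 0 < p.precision := by rw [hp, precision_eq]; positivity
  have h1 := gridBound_calls (O := O) hβ (half_pos hC) hα false x B
  have h2 := gridBound_calls (O := O) hβ (half_pos hC) hα true x B
  have e1 : p.beta m / (p.C / 2) = 2 * (p.M - m + 1) := by
    unfold EpochParams.beta; field_simp
  have e2 : (3 + 2 * ((p.M : ℝ) - m + 1)) / p.precision
      = (3 + 2 * (p.M - m + 1)) * (4 * p.M / γ) := by
    rw [hp, precision_eq]; field_simp
  rw [e1, e2] at h1 h2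
  unfold pointCalls lcbProg ucbProg gridSubroutine
  simp only [OracleProg.oneSub_calls]
  push_cast
  linarith

/-- With precision `γ / (4 M)` the quantity `16 / α ^ 3` equals `2 ^ 10 (M / γ) ^ 3`, and bisection
pays only its logarithm. -/
lemma bisect_pointCalls_le (P : ParamBounds θ d ε γ δ) (m : ℕ) (B : List (X × Bool)) (x : X) :
    (pointCalls (bisectSubroutine X) O (runParams θ d ε γ δ) m B x : ℝ)
      ≤ 30 + 9 * Real.log ((runParams θ d ε γ δ).M / γ) := by
  set p := runParams θ d ε γ δ with hp
  have hM : (3 : ℝ) ≤ p.M := by exact_mod_cast P.three_le_M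
  have hγ := P.hγ
  have h1 := bisectBound_calls (O := O) false x B (p.beta m) p.precision
  have h2 := bisectBound_calls (O := O) true x B (p.beta m) p.precision
  have hMγ : 1 ≤ (p.M : ℝ) / γ := by
    rw [le_div_iff₀ hγ]; linarith [P.hγ2]
  have hlog0 : 0 ≤ Real.log (p.M / γ) := Real.log_nonneg hMγ
  have h3 : (bisectSteps p.precision : ℝ) ≤ 11 + 4.4 * Real.log (p.M / γ) := by
    have e : 16 / p.precision ^ 3 = 2 ^ 10 * (p.M / γ) ^ 3 := by
      rw [hp, precision_eq]
      field_simp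
      ring
    have h4 : Real.logb 2 (16 / p.precision ^ 3) = 10 + 3 * Real.logb 2 (p.M / γ) := by
      rw [e, Real.logb_mul (by norm_num) (by positivity), Real.logb_pow, Real.logb_pow,
        Real.logb_self_eq_one (by norm_num)]
      norm_num
    have h5 : Real.logb 2 (p.M / γ) ≤ 1.45 * Real.log (p.M / γ) := by
      rw [Real.logb, div_le_iff₀ (Real.log_pos (by norm_num))]
      nlinarith [Real.log_two_gt_d9]
    have h6 : 0 ≤ Real.logb 2 (p.M / γ) := Real.logb_nonneg (by norm_num) hMγ
    have h7 : (bisectSteps p.precision : ℝ) < Real.logb 2 (16 / p.precision ^ 3) + 1 :=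
      Nat.ceil_lt_add_one (by rw [h4]; linarith)
    rw [h4] at h7
    linarith
  have h4 : pointCalls (bisectSubroutine X) O p m B x ≤ 2 * (bisectSteps p.precision + 3) := by
    unfold pointCalls lcbProg ucbProg bisectSubroutine
    simp only [OracleProg.oneSub_calls]
    omega
  calc (pointCalls (bisectSubroutine X) O p m B x : ℝ)
      ≤ ((2 * (bisectSteps p.precision + 3) : ℕ) : ℝ) := by exact_mod_cast h4
    _ ≤ _ := by push_cast; linarith

lemma grid_totalCalls_le (P : ParamBounds θ d ε γ δ) (z : ℕ → X × Bool) :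
    (totalCalls (gridSubroutine X) O (runParams θ d ε γ δ) z : ℝ)
      ≤ 10 ^ 14 * (θ * d / (ε * γ ^ 3)) * Real.log (θ * d / (ε * γ * δ)) ^ 3 := by
  set p := runParams θ d ε γ δ with hp
  have hγ := P.hγ
  have hε := P.hε
  have hγ2 := P.hγ2
  have hM : (3 : ℝ) ≤ p.M := by exact_mod_cast P.three_le_M
  have hMγ : (p.M : ℝ) ≤ p.M / γ := by
    rw [le_div_iff₀ hγ]; nlinarith
  have h1 := totalCalls_le (O := O) (gridSubroutine X) p z (c := 44 * (p.M ^ 2 / γ))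
    (by positivity) (fun m B x hm1 hm => by
      refine (P.grid_pointCalls_le hm B x).trans ?_
      have hm1' : (1 : ℝ) ≤ m := by exact_mod_cast hm1
      have h2 : (3 + 2 * ((p.M : ℝ) - m + 1)) * (4 * p.M / γ) ≤ (5 * p.M) * (4 * p.M / γ) := by
        gcongr
        linarith
      have e : 5 * (p.M : ℝ) * (4 * p.M / γ) = 20 * (p.M ^ 2 / γ) := by ring
      have h3 : 2 ≤ (p.M : ℝ) ^ 2 / γ := by
        rw [le_div_iff₀ hγ]; nlinarith
      linarith)
  have h2 := P.two_pow_le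
  have h3 := P.M_le
  set ℓ := Real.log (θ * d / (ε * γ * δ)) with hℓ
  have hT1 := P.sampleSize_ge
  norm_num at hT1
  have hℓ0 : 0.69 ≤ ℓ := P.log_ge
  have h4 : (p.M : ℝ) ≤ sampleSize θ d ε γ δ * (p.M ^ 2 / γ) := by
    have : (p.M : ℝ) ≤ p.M ^ 2 / γ := by
      rw [le_div_iff₀ hγ]; nlinarith
    nlinarith
  have h5 : 2 ^ p.M * (44 * ((p.M : ℝ) ^ 2 / γ))
      ≤ 2 * sampleSize θ d ε γ δ * (44 * (p.M ^ 2 / γ)) := by gcongr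
  have hT0 := P.sampleSize_pos
  have h6 : sampleSize θ d ε γ δ * ((p.M : ℝ) ^ 2 / γ)
      ≤ sampleSize θ d ε γ δ * ((44 * ℓ) ^ 2 / γ) := by gcongr
  have e : sampleSize θ d ε γ δ * ((44 * ℓ) ^ 2 / γ)
      = 193600000000 * (θ * d / (ε * γ) / γ * ℓ ^ 3) := by
    unfold sampleSize; rw [← hℓ]; ring
  have h7 : θ * d / (ε * γ) / γ ≤ θ * d / (ε * γ ^ 3) := by
    have := P.hθ
    have := P.hd
    rw [div_div]
    refine div_le_div_of_nonneg_left (by positivity) (by positivity) ?_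
    have h8 : 0 ≤ ε * γ ^ 2 * (1 - γ) := mul_nonneg (by positivity) (by linarith)
    linarith [show ε * γ * γ - ε * γ ^ 3 = ε * γ ^ 2 * (1 - γ) by ring]
  have h8 : θ * d / (ε * γ) / γ * ℓ ^ 3 ≤ θ * d / (ε * γ ^ 3) * ℓ ^ 3 := by gcongr
  have h9 : 0 ≤ θ * d / (ε * γ ^ 3) * ℓ ^ 3 := by
    have := P.hθ
    have := P.hd
    positivity
  rw [mul_assoc]
  norm_num
  linarith

lemma grid_inferenceCalls_le (P : ParamBounds θ d ε γ δ) (z : ℕ → X × Bool) (x : X) :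
    (inferenceCalls (gridSubroutine X) O (runParams θ d ε γ δ) z x : ℝ)
      ≤ 10 ^ 4 * (lam θ d ε γ δ / γ) ^ 2 * Real.log (lam θ d ε γ δ / γ) := by
  set p := runParams θ d ε γ δ with hp
  have hγ := P.hγ
  have hγ2 := P.hγ2
  have h1 := P.grid_pointCalls_le (O := O) (m := p.M) le_rfl (collected (gridSubroutine X) O p z
    (p.M - 1)) x
  have h2 := P.M_le_lam
  have h3 := P.two_le_lam_div
  have h4 := P.log_lam_div_ge
  have h5 : (p.M : ℝ) / γ ≤ 29 * (lam θ d ε γ δ / γ) := by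
    rw [← mul_div_assoc]
    gcongr
  have e : (3 + 2 * ((p.M : ℝ) - p.M + 1)) * (4 * p.M / γ) = 20 * (p.M / γ) := by ring
  rw [← hp, e] at h1
  set Y := lam θ d ε γ δ / γ
  have h6 : Y ≤ 2 * (Y ^ 2 * Real.log Y) := by
    have : 1.38 ≤ Y * Real.log Y := by nlinarith
    nlinarith
  unfold inferenceCalls
  rw [mul_assoc]
  norm_num
  linarith

lemma bisect_totalCalls_le (P : ParamBounds θ d ε γ δ) (z : ℕ → X × Bool) :
    (totalCalls (bisectSubroutine X) O (runParams θ d ε γ δ) z : ℝ)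
      ≤ 10 ^ 14 * (θ * d / (ε * γ)) * Real.log (θ * d / (ε * γ * δ)) ^ 3 := by
  set p := runParams θ d ε γ δ with hp
  have hγ := P.hγ
  have hγ2 := P.hγ2
  have hM : (3 : ℝ) ≤ p.M := by exact_mod_cast P.three_le_M
  have h3 : (p.M : ℝ) ≤ 44 * Real.log (θ * d / (ε * γ * δ)) := P.M_le
  set ℓ := Real.log (θ * d / (ε * γ * δ)) with hℓ
  have hℓ0 : 0.69 ≤ ℓ := P.log_ge
  have hlog : Real.log (p.M / γ) ≤ 45 * ℓ := by
    have h4 : Real.log (1 / γ) ≤ ℓ := by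
      have h5 := Real.log_le_log (by positivity) P.ratio_ge
      have h6 := P.log_eq
      linarith [P.log_inv_delta_pos]
    rw [div_eq_mul_one_div, Real.log_mul (by linarith) (by positivity)]
    linarith [Real.log_le_sub_one_of_pos (by linarith : (0 : ℝ) < p.M)]
  have h1 := totalCalls_le (O := O) (bisectSubroutine X) p z (c := 460 * ℓ)
    (by positivity) (fun m B x _ _ => by
      have := P.bisect_pointCalls_le (O := O) m B x
      linarith)
  have hT0 := P.sampleSize_pos
  have h5 : 2 ^ p.M * (460 * ℓ) ≤ 2 * sampleSize θ d ε γ δ * (460 * ℓ) := by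
    gcongr
    exact P.two_pow_le
  have h6 : (p.M : ℝ) ≤ sampleSize θ d ε γ δ * ℓ := by
    have := P.sampleSize_ge
    norm_num at this
    nlinarith
  have e : sampleSize θ d ε γ δ * ℓ = 100000000 * (θ * d / (ε * γ) * ℓ ^ 2) := by
    unfold sampleSize; rw [← hℓ]; ring
  have h7 : θ * d / (ε * γ) * ℓ ^ 2 ≤ 2 * (θ * d / (ε * γ) * ℓ ^ 3) := by
    have : 0 ≤ θ * d / (ε * γ) * ℓ ^ 2 := by have := P.two_le_ratio; positivity
    have e2 : θ * d / (ε * γ) * ℓ ^ 3 = θ * d / (ε * γ) * ℓ ^ 2 * ℓ := by ring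
    nlinarith
  rw [mul_assoc]
  norm_num
  have : 0 ≤ θ * d / (ε * γ) * ℓ ^ 3 := by have := P.two_le_ratio; positivity
  linarith

lemma bisect_inferenceCalls_le (P : ParamBounds θ d ε γ δ) (z : ℕ → X × Bool) (x : X) :
    (inferenceCalls (bisectSubroutine X) O (runParams θ d ε γ δ) z x : ℝ)
      ≤ 10 ^ 4 * Real.log (lam θ d ε γ δ / γ) := by
  set p := runParams θ d ε γ δ with hp
  have hγ := P.hγ
  have h1 := P.bisect_pointCalls_le (O := O) p.M (collected (bisectSubroutine X) O p z
    (p.M - 1)) x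
  have h3 := P.two_le_lam_div
  have h4 := P.log_lam_div_ge
  have hM : (3 : ℝ) ≤ p.M := by exact_mod_cast P.three_le_M
  have h5 : (p.M : ℝ) / γ ≤ 2 ^ 5 * (lam θ d ε γ δ / γ) := by
    rw [← mul_div_assoc]
    gcongr
    have := P.M_le_lam
    have := P.one_le_lam
    linarith
  have h6 := Real.log_le_log (by positivity) h5
  rw [Real.log_mul (by norm_num) (by linarith), Real.log_pow] at h6
  push_cast at h6
  have := Real.log_two_lt_d9
  unfold inferenceCalls
  norm_num
  linarith

end ParamBounds

end Calls

/- ### The statistical guarantee -/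

section Guarantee

variable {X : Type u} {F : Set (X → ℝ)} {O : List (WExample X) → X → ℝ}
  {A : CISubroutine X} {p : EpochParams} {fs : X → ℝ}

lemma regionInd_mem (m : ℕ) (z : ℕ → X × Bool) (x : X) :
    regionInd A O p m z x ∈ Set.Icc (0 : ℝ) 1 := by
  unfold regionInd; split_ifs <;> simp

lemma regionInd_congr {m : ℕ} {z z' : ℕ → X × Bool} (h : ∀ t ≤ tau m, z t = z' t) :
    regionInd A O p m z = regionInd A O p m z' := by
  funext x
  unfold regionInd
  rw [collected_congr A O p m h]

variable (A O p fs) in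
/-- Distance of the empirical minimizer from `fs` over the sampling region of epoch `m + 1`. -/
def regionDist (m : ℕ) (z : ℕ → X × Bool) (x : X) : ℝ :=
  regionInd A O p m z x * |empMin O (collected A O p z m) x - fs x|

variable [MeasurableSpace X]

lemma measurable_regionInd (hA : MeasurableSubroutine A O) (m : ℕ) :
    Measurable fun q : (ℕ → X × Bool) × X => regionInd A O p m q.1 q.2 := by
  unfold regionInd
  exact Measurable.ite (measurableSet_queried_collected p hA m) measurable_const measurable_const

variable (D : Measure (X × Bool)) [IsProbabilityMeasure D]

/-- All concentration bounds hold with high probability. -/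
lemma measure_not_concentrated_le (hF : ∀ f ∈ F, ∀ x, f x ∈ Set.Icc (0 : ℝ) 1)
    (hmeas : ∀ f ∈ F, Measurable f) (hP : PointwiseMeasurable F) (hreg : IsRegressionOracle F O)
    (hO : MeasurableOracle O) (hA : MeasurableSubroutine A O) (hfs : fs ∈ F)
    (hη : fs =ᵐ[D.fst] condProb D) {d : ℕ} (hd : pseudoDim F ≤ d) (hM : 3 ≤ p.M) (hC : 4 ≤ p.C)
    {N : ℕ} (hN : N = 2 ^ p.M) {k : ℕ} (hk : p.M = k + 2) :
    iidLaw D {z | ¬ ((∀ a < p.M, ∀ b < p.M, ∀ f ∈ F, ∑ t ∈ Finset.Ioc (tau a) (tau b),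
        queryInd A O p z t * (noiseTerm fs f (z t) - (f (z t).1 - fs (z t).1) ^ 2 / 2)
          ≤ p.C / 4) ∧
      (TwoSampleBound F fs p z fun m => regionInd A O p m z) ∧
      (tau (k + 1) - tau k : ℕ) * ∫ q, regionDist O A p fs (k + 1) z q.1 ∂D
        - 2 * ∑ i ∈ Finset.range (tau (k + 1) - tau k),
          regionDist O A p fs (k + 1) z (z (tau (k + 1) + 1 + i)).1 ≤ p.C)}
      ≤ ENNReal.ofReal ((N : ℝ) ^ 2 * (((((N + 1) * N + 1) ^ d : ℕ) : ℝ)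
        * Real.exp (-((p.C / 4 - 3) / 8)))) := by
  set q : ℝ := ((((N + 1) * N + 1) ^ d : ℕ) : ℝ) * Real.exp (-((p.C / 4 - 3) / 8)) with hq
  have hN1 : 1 ≤ N := by rw [hN]; exact Nat.one_le_two_pow
  have hMN : p.M + 1 ≤ N := by rw [hN]; exact Nat.lt_two_pow_self
  have hcard1 : (1 : ℝ) ≤ ((((N + 1) * N + 1) ^ d : ℕ) : ℝ) := by
    exact_mod_cast Nat.one_le_pow _ _ (by omega)
  let SA : ℕ → ℕ → Set (ℕ → X × Bool) := fun a b => {z | ∃ f ∈ F, p.C / 4 <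
    ∑ t ∈ Finset.Ioc (tau a) (tau b), queryInd A O p z t *
      (noiseTerm fs f (z t) - (f (z t).1 - fs (z t).1) ^ 2 / 2)}
  let SB : ℕ → ℕ → Set (ℕ → X × Bool) := fun m r => {z | ∃ f ∈ F, p.C <
    ∑ i ∈ Finset.range (tau (m + 1) - tau m),
      (regionInd A O p m z (z (tau (m + 1) + 1 + r * (tau (m + 1) - tau m) + i)).1
          * (f (z (tau (m + 1) + 1 + r * (tau (m + 1) - tau m) + i)).1
            - fs (z (tau (m + 1) + 1 + r * (tau (m + 1) - tau m) + i)).1) ^ 2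
        - 2 * (regionInd A O p m z (z (tau m + 1 + i)).1
          * (f (z (tau m + 1 + i)).1 - fs (z (tau m + 1 + i)).1) ^ 2))}
  let SD : Set (ℕ → X × Bool) := {z | p.C < (tau (k + 1) - tau k : ℕ) *
      ∫ q, regionDist O A p fs (k + 1) z q.1 ∂D
        - 2 * ∑ i ∈ Finset.range (tau (k + 1) - tau k),
          regionDist O A p fs (k + 1) z (z (tau (k + 1) + 1 + i)).1}
  have htau (m : ℕ) (hm : m ≤ p.M) : tau m ≤ N := by
    rw [hN]
    unfold tau
    split_ifs
    · exact Nat.zero_le _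
    · exact Nat.pow_le_pow_right (by norm_num) hm
  have hSA : ∀ a, ∀ b ∈ Finset.range p.M, iidLaw D (SA a b) ≤ ENNReal.ofReal q := fun a b hb =>
    measure_noise_le p D hF hmeas hP hA hfs hη hd a b hN1
      (htau b (Finset.mem_range.1 hb).le) (p.C / 4)
  have hSB : ∀ m ∈ Finset.range (p.M - 1), ∀ r ∈ Finset.range 2,
      iidLaw D (SB m r) ≤ ENNReal.ofReal q := by
    intro m hm r hr
    rw [Finset.mem_range] at hm hr
    -- For `m ≥ 1` both blocks end at `2 ^ (m + 2)`; for `m = 0` they end at time `6`, which is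
    -- where `M ≥ 3` is used.
    have hlen : tau (m + 1) + 2 * (tau (m + 1) - tau m) ≤ N := by
      rcases Nat.eq_zero_or_pos m with rfl | hm0
      · have : 2 ^ 3 ≤ N := by rw [hN]; exact Nat.pow_le_pow_right (by norm_num) hM
        simp [tau]; omega
      · have h1 := htau (m + 2) (by omega)
        rw [tau_succ] at h1 ⊢
        have h2 : tau m = 2 ^ m := by unfold tau; rw [if_neg (by omega)]
        have e1 : 2 ^ (m + 1 + 1) = 4 * 2 ^ m := by ring
        have e2 : 2 ^ (m + 1) = 2 * 2 ^ m := by ring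
        omega
    have hr' : r * (tau (m + 1) - tau m) ≤ tau (m + 1) - tau m := by
      calc _ ≤ 1 * (tau (m + 1) - tau m) := Nat.mul_le_mul_right _ (by omega)
        _ = _ := one_mul _
    have hmono := tau_mono (Nat.le_succ m)
    refine (measure_two_sample_le D hF hmeas hP hfs hd (fun z => regionInd A O p m z)
      (measurable_regionInd hA m) (regionInd_mem m) (s₀ := tau m) (a₀ := tau m + 1)
      (b₀ := tau (m + 1) + 1 + r * (tau (m + 1) - tau m)) (n := tau (m + 1) - tau m) (N := N)
      (fun z z' h => regionInd_congr h) (by omega) ?_ ?_ hN1 p.C).trans ?_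
    · simp only [Nat.succ_eq_add_one] at hmono
      generalize r * (tau (m + 1) - tau m) = y
      omega
    · generalize r * (tau (m + 1) - tau m) = y at hr' ⊢
      omega
    · apply ENNReal.ofReal_le_ofReal
      exact mul_le_mul_of_nonneg_left (Real.exp_le_exp.2 (by linarith)) (Nat.cast_nonneg _)
  have hemp : Measurable fun q : (ℕ → X × Bool) × X =>
      empMin O (collected A O p q.1 (k + 1)) q.2 :=
    (measurable_empMin hO).comp
      (((measurable_collected p hA (k + 1)).comp measurable_fst).prodMk measurable_snd)
  have hSD : iidLaw D SD ≤ ENNReal.ofReal q := by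
    refine (measure_fresh_sample_le D (regionDist O A p fs (k + 1)) ?_ ?_
      (s₀ := tau (k + 1)) (b₀ := tau (k + 1) + 1) ?_ (by omega) _ p.C).trans ?_
    · exact (measurable_regionInd hA (k + 1)).mul
        (hemp.sub ((hmeas fs hfs).comp measurable_snd)).abs
    · intro z x
      have h1 := regionInd_mem (A := A) (O := O) (p := p) (k + 1) z x
      have h2 := abs_sub_le_one hF (hreg (unitWeights (collected A O p z (k + 1)))).1 hfs x
      exact ⟨mul_nonneg h1.1 (abs_nonneg _), mul_le_one₀ h1.2 (abs_nonneg _) h2⟩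
    · intro z z' h
      funext x
      unfold regionDist
      rw [regionInd_congr h, collected_congr A O p (k + 1) h]
    · apply ENNReal.ofReal_le_ofReal
      rw [hq]
      calc Real.exp (-(p.C / 4)) ≤ 1 * Real.exp (-((p.C / 4 - 3) / 8)) := by
            rw [one_mul]; apply Real.exp_le_exp.2; linarith
        _ ≤ _ := by gcongr
  have hsub : {z | ¬ ((∀ a < p.M, ∀ b < p.M, ∀ f ∈ F, ∑ t ∈ Finset.Ioc (tau a) (tau b),
        queryInd A O p z t * (noiseTerm fs f (z t) - (f (z t).1 - fs (z t).1) ^ 2 / 2)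
          ≤ p.C / 4) ∧
      (TwoSampleBound F fs p z fun m => regionInd A O p m z) ∧
      (tau (k + 1) - tau k : ℕ) * ∫ q, regionDist O A p fs (k + 1) z q.1 ∂D
        - 2 * ∑ i ∈ Finset.range (tau (k + 1) - tau k),
          regionDist O A p fs (k + 1) z (z (tau (k + 1) + 1 + i)).1 ≤ p.C)}
      ⊆ ((⋃ a ∈ Finset.range p.M, ⋃ b ∈ Finset.range p.M, SA a b) ∪
        (⋃ m ∈ Finset.range (p.M - 1), ⋃ r ∈ Finset.range 2, SB m r)) ∪ SD := by
    intro z hz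
    by_contra hcon
    simp only [Set.mem_union, Set.mem_iUnion, not_or, not_exists, Finset.mem_range] at hcon
    obtain ⟨⟨h1, h2⟩, h3⟩ := hcon
    refine hz ⟨fun a ha b hb f hf => ?_, fun m hm r hr f hf => ?_, not_lt.1 h3⟩
    · exact not_lt.1 fun h => h1 a ha b hb ⟨f, hf, h⟩
    · exact not_lt.1 fun h => h2 m (by omega) r hr ⟨f, hf, h⟩
  have hq0 : 0 ≤ q := by positivity
  calc _ ≤ _ := measure_mono hsub
    _ ≤ (∑ a ∈ Finset.range p.M, ∑ b ∈ Finset.range p.M, ENNReal.ofReal q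
        + ∑ m ∈ Finset.range (p.M - 1), ∑ r ∈ Finset.range 2, ENNReal.ofReal q)
        + ENNReal.ofReal q := by
      refine (measure_union_le _ _).trans (add_le_add ((measure_union_le _ _).trans
        (add_le_add ?_ ?_)) hSD)
      · exact (measure_biUnion_finset_le _ _).trans (Finset.sum_le_sum fun a _ =>
          (measure_biUnion_finset_le _ _).trans (Finset.sum_le_sum fun b hb => hSA a b hb))
      · exact (measure_biUnion_finset_le _ _).trans (Finset.sum_le_sum fun m hm =>
          (measure_biUnion_finset_le _ _).trans (Finset.sum_le_sum fun r hr => hSB m hm r hr))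
    _ = ((p.M * p.M + (p.M - 1) * 2 + 1 : ℕ) : ℝ≥0∞) * ENNReal.ofReal q := by
      simp only [Finset.sum_const, Finset.card_range, nsmul_eq_mul]
      push_cast
      ring
    -- There are at most `(M + 1) ^ 2` bad events, and `M + 1 ≤ 2 ^ M = N`.
    _ ≤ ((N ^ 2 : ℕ) : ℝ≥0∞) * ENNReal.ofReal q := by
      gcongr
      calc p.M * p.M + (p.M - 1) * 2 + 1 ≤ (p.M + 1) ^ 2 := by
            have : (p.M - 1) * 2 ≤ 2 * p.M := by omega
            nlinarith
        _ ≤ N ^ 2 := Nat.pow_le_pow_left hMN 2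
    _ = _ := by
      rw [← ENNReal.ofReal_natCast, ← ENNReal.ofReal_mul (Nat.cast_nonneg _), Nat.cast_pow]

/-- The statistical guarantee, for subroutines that are certified, strict and measurable. -/
lemma measure_failure_le {θ d ε γ δ : ℝ} (P : ParamBounds θ d ε γ δ)
    (hF : ∀ f ∈ F, Measurable f ∧ ∀ x, f x ∈ Set.Icc (0 : ℝ) 1) (hP : PointwiseMeasurable F)
    (hreg : IsRegressionOracle F O) (hO : MeasurableOracle O) (hfs : fs ∈ F)
    (hη : fs =ᵐ[D.fst] condProb D) (hdim : pseudoDim F ≠ ⊤) (hd : d = (pseudoDim F).toNat)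
    (hθ : disagreementCoeff F (γ / 4) ≠ ⊤) (hθ' : θ = (disagreementCoeff F (γ / 4)).toReal)
    (hcert : Certifies A F O 1) (hstrict : StrictBounds A F O) (hA : MeasurableSubroutine A O)
    {Ω : Type*} [MeasurableSpace Ω] (Q : Measure Ω) [IsProbabilityMeasure Q]
    (Z : ℕ → Ω → X × Bool) (hZ : ∀ t, Measurable (Z t)) (hind : iIndepFun Z Q)
    (hlaw : ∀ t, Q.map (Z t) = D) :
    Q {ω | ¬ (chowError D γ (outputClassifier A O (runParams θ d ε γ δ) (Z · ω))
          - stdError D (inducedClassifier fs) ≤ ε ∧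
        (labelCount A O (runParams θ d ε γ δ) (Z · ω) : ℝ) ≤
          10 ^ 10 * (θ * d / γ ^ 2) * Real.log (θ * d / (ε * γ)) ^ 2
            * Real.log (θ * d / (ε * γ * δ)) ∧
        NestedRegions A O (runParams θ d ε γ δ) (Z · ω))} ≤ ENNReal.ofReal (2 * δ) := by
  set p := runParams θ d ε γ δ with hp
  have hrange : ∀ f ∈ F, ∀ x, f x ∈ Set.Icc (0 : ℝ) 1 := fun f hf => (hF f hf).2
  have hmeas : ∀ f ∈ F, Measurable f := fun f hf => (hF f hf).1
  have hM : 3 ≤ p.M := P.three_le_M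
  have hC : 1000 ≤ p.C := P.C_ge
  obtain ⟨k, hk⟩ : ∃ k, p.M = k + 2 := ⟨p.M - 2, by omega⟩
  have hdim' : pseudoDim F ≤ ((pseudoDim F).toNat : ℕ) := (ENat.natCast_toNat hdim).ge
  have hbad := measure_not_concentrated_le D hrange hmeas hP hreg hO hA hfs hη hdim' hM
    (by linarith) rfl hk
  have hfail := P.failure_le hd.symm (N := 2 ^ p.M) rfl
  -- Independence with common law says that the whole sequence has the infinite product law.
  have hmap : Q.map (fun ω t => Z t ω) = iidLaw D := by
    rw [(iIndepFun_iff_map_fun_eq_infinitePi_map hZ).1 hind]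
    simp only [hlaw]
  refine le_trans ?_ (hbad.trans (ENNReal.ofReal_le_ofReal hfail))
  rw [← hmap]
  -- The failure set need not be measurable; outer measure inequalities suffice.
  refine le_trans (measure_mono ?_)
    (Measure.le_map_apply (measurable_pi_lambda _ hZ).aemeasurable _)
  intro ω hω hgood
  refine hω ?_
  obtain ⟨hnoise, htwo, hfresh⟩ := hgood
  set z : ℕ → X × Bool := fun t => Z t ω
  have hrun : GoodRun F fs A O p z := ⟨hrange, hreg, hcert, hstrict, hfs, by omega, by linarith,
    P.hγ, P.hγ2, hnoise⟩
  refine ⟨?_, ?_, hrun.nestedRegions⟩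
  · have h1 := hrun.chow_excess_le D hη hmeas hA hO (m := k + 1) hk
    have h2 := hrun.sum_fresh_le hmeas hθ htwo hk
    refine h1.trans (P.excess_le (n := tau (k + 1) - tau k) ?_ ?_)
    · have hk1 : 1 ≤ k := by omega
      rw [← hp, hk]
      have e1 : tau (k + 1) = 2 * 2 ^ k := by rw [tau_succ]; ring
      have e2 : tau k = 2 ^ k := by unfold tau; rw [if_neg (by omega)]
      have e3 : 2 ^ (k + 2) = 4 * 2 ^ k := by ring
      omega
    · change ∑ i ∈ Finset.range (tau (k + 1) - tau k),
          regionDist O A p fs (k + 1) z (z (tau (k + 1) + 1 + i)).1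
        ≤ 32 * (disagreementCoeff F (γ / 4)).toReal * p.C / γ at h2
      rw [← hθ'] at h2
      change _ * ∫ q, regionDist O A p fs (k + 1) z q.1 ∂D ≤ _
      rw [← hp]
      linarith
  · obtain ⟨j, hj1, hjM, hj⟩ := P.exists_cutoff
    have h1 := hrun.labelCount_le hmeas hθ htwo hj1 hjM
    change (labelCount A O p z : ℝ) ≤ tau j + 128 * (disagreementCoeff F (γ / 4)).toReal * p.C
      * (p.M - j + 1) ^ 2 / γ ^ 2 at h1
    rw [← hθ'] at h1
    exact h1.trans hj

end Guarantee

end ActiveAbstain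

end

open ActiveAbstain in
theorem mainTheorem2 :
    ∃ (cT cC cL cN cI : ℝ) (k : ℕ), 0 < cT ∧ 0 < cC ∧ 0 < cL ∧ 0 < cN ∧ 0 < cI ∧
    ∀ X : Type*, ∃ Agen Aconv : CISubroutine X,
    ∀ (_ : MeasurableSpace X) (F : Set (X → ℝ)) (O : List (WExample X) → X → ℝ)
      (D : Measure (X × Bool)) (_ : IsProbabilityMeasure D) (fstar : X → ℝ) (ε γ δ : ℝ),
    (∀ f ∈ F, Measurable f ∧ ∀ x, f x ∈ Set.Icc (0 : ℝ) 1) → PointwiseMeasurable F →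
    IsRegressionOracle F O → MeasurableOracle O →
    fstar ∈ F → fstar =ᵐ[D.fst] condProb D →
    1 ≤ pseudoDim F → pseudoDim F ≠ ⊤ → disagreementCoeff F (γ / 4) ≠ ⊤ →
    0 < ε → ε ≤ 1 → 0 < γ → γ < 1 / 2 → 0 < δ → δ < 1 →
    let d : ℝ := (pseudoDim F).toNat
    let θ : ℝ := (disagreementCoeff F (γ / 4)).toReal
    let T : ℝ := cT * (θ * d / (ε * γ)) * Real.log (θ * d / (ε * γ * δ))
    let p : EpochParams := ⟨⌈Real.logb 2 T⌉₊, cC * d * Real.log (T / δ), γ⟩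
    let Λ : ℝ := 1 + Real.log (θ * d / (ε * γ)) + Real.log (1 + Real.log (1 / δ))
    -- statistical guarantees and nestedness, for a run with the given subroutines
    let Guarantee : CISubroutine X → Prop := fun A =>
      ∀ (Ω : Type*) (_ : MeasurableSpace Ω) (P : Measure Ω) (_ : IsProbabilityMeasure P)
        (Z : ℕ → Ω → X × Bool), (∀ t, Measurable (Z t)) → iIndepFun Z P →
        (∀ t, P.map (Z t) = D) →
        P {ω | ¬ (chowError D γ (outputClassifier A O p (Z · ω))
                    - stdError D (inducedClassifier fstar) ≤ ε ∧
                  (labelCount A O p (Z · ω) : ℝ) ≤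
                    cL * (θ * d / γ ^ 2) * Real.log (θ * d / (ε * γ)) ^ 2
                      * Real.log (θ * d / (ε * γ * δ)) ∧
                  NestedRegions A O p (Z · ω))} ≤ ENNReal.ofReal (2 * δ)
    -- a general class
    (Certifies Agen F O 1 ∧ Guarantee Agen ∧
      ∀ z : ℕ → X × Bool,
        (totalCalls Agen O p z : ℝ) ≤
          cN * (θ * d / (ε * γ ^ 3)) * Real.log (θ * d / (ε * γ * δ)) ^ k ∧
        ∀ x, (inferenceCalls Agen O p z x : ℝ) ≤ cI * (Λ / γ) ^ 2 * Real.log (Λ / γ)) ∧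
    -- a convex class closed under pointwise convergence
    (Convex ℝ F → IsSeqClosed F →
      Certifies Aconv F O 0 ∧ Guarantee Aconv ∧
      ∀ z : ℕ → X × Bool,
        (totalCalls Aconv O p z : ℝ) ≤
          cN * (θ * d / (ε * γ)) * Real.log (θ * d / (ε * γ * δ)) ^ k ∧
        ∀ x, (inferenceCalls Aconv O p z x : ℝ) ≤ cI * Real.log (Λ / γ)) := by
  refine ⟨10 ^ 8, 1000, 10 ^ 10, 10 ^ 14, 10 ^ 4, 3, by norm_num, by norm_num, by norm_num,
    by norm_num, by norm_num, fun X => ⟨gridSubroutine X, bisectSubroutine X, ?_⟩⟩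
  intro _ F O D _ fstar ε γ δ hF hP hreg hO hfs hη hdim1 hdim hθ hε hε1 hγ hγ2 hδ hδ1
    d θ T p Λ Guarantee
  have hrange : ∀ f ∈ F, ∀ x, f x ∈ Set.Icc (0 : ℝ) 1 := fun f hf => (hF f hf).2
  have hb : ParamBounds θ d ε γ δ := by
    refine ⟨?_, ?_, hε, hε1, hγ, hγ2, hδ, hδ1⟩
    · simpa using ENNReal.toReal_mono hθ (one_le_disagreementCoeff ⟨fstar, hfs⟩)
    · have h : 1 ≤ (pseudoDim F).toNat := by
        simpa using ENat.toNat_le_toNat hdim1 hdim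
      exact Nat.one_le_cast.2 h
  have hguar (A : CISubroutine X) (hcert : Certifies A F O 1) (hstrict : StrictBounds A F O)
      (hA : MeasurableSubroutine A O) : Guarantee A := fun Ω _ Q _ Z hZ hind hlaw =>
    measure_failure_le D hb hF hP hreg hO hfs hη hdim rfl hθ rfl hcert hstrict hA Q Z hZ hind hlaw
  obtain ⟨hg1, hg2⟩ := gridSubroutine_certifies hrange hreg
  refine ⟨⟨hg1, hguar _ hg1 hg2 (gridSubroutine_measurable hO), fun z =>
    ⟨hb.grid_totalCalls_le z, hb.grid_inferenceCalls_le z⟩⟩, fun hconv _ => ?_⟩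
  obtain ⟨hc1, hc2⟩ := bisectSubroutine_certifies hrange hreg hconv
  -- Certification without slack implies certification with slack, so the analysis made for the
  -- general class covers the convex one.
  exact ⟨hc1, hguar _ (hc1.slack hrange hreg) hc2 (bisectSubroutine_measurable hO), fun z =>
    ⟨hb.bisect_totalCalls_le z, hb.bisect_inferenceCalls_le z⟩⟩
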